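/- **Setting.** Let $c<2$ be real, $N\ge 1$, $h=2\pi/N$, and consider the $2N$ nodes $x_{j\pm1/4}=x_j\pm h/4$, $x_j=h(j-1)+h/2$, $j=1,\dots,N$ ($j$ taken cyclically). Let $Q$ be the operator on grid functions given by $$(Qu)_{j-\frac14}=\tfrac{1}{12(h/2)^2}\big[(-u_{j-\frac54}+16u_{j-\frac34}-30u_{j-\frac14}+16u_{j+\frac14}-u_{j+\frac34})+c\,\delta_j\big],$$ $$(Qu)_{j+\frac14}=\tfrac{1}{12(h/2)^2}\big[(-u_{j-\frac34}+16u_{j-\frac14}-30u_{j+\frac14}+16u_{j+\frac34}-u_{j+\frac54})-c\,\delta_j\big],$$ $\delta_j=u_{j-\frac54}-5u_{j-\frac34}+10u_{j-\frac14}-10u_{j+\frac14}+5u_{j+\frac34}-u_{j+\frac54}$. Let $\|v\|_h^2=\frac h2\sum|v|^2$ (sum over all nodes), and let $e^{i\omega\mathbf x}$ be the grid function of $e^{i\omega x}$. For an integer $\omega$ with $|\omega|\le N/2$ put $\nu=\omega-N$ if $\omega>0$ and $\nu=\omega+N$ if $\omega\le0$. Let $v$ denote a solution of $dv/dt=Qv$,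 $t\ge0$. Then the following hold for all $N\ge1$ and all integers $|\omega|\le N/2$. 1. **Aliasing.** $e^{i\omega x_{j-1/4}}=\pm i\,e^{i\nu x_{j-1/4}}$ and $e^{i\omega x_{j+1/4}}=\mp i\,e^{i\nu x_{j+1/4}}$, with the upper signs for $\omega>0$ and the lower signs for $\omega<0$. 2. **Action of $Q$.** $Qe^{i\omega\mathbf x}=\mathrm{diag}(\mu_1,\mu_2,\mu_1,\mu_2,\dots)e^{i\omega\mathbf x}$ and $Qe^{i\nu\mathbf x}=\mathrm{diag}(\sigma_1,\sigma_2,\dots)e^{i\nu\mathbf x}$, where, with $P=(6c-2)\cos(h\omega)+10c-30$ and $R=(32-15c)\cos\frac{h\omega}2-c\cos\frac{3h\omega}2$, $$\mu_{1,2}=\tfrac1{3h^2}\big[P+R\mp32ic\sin^5\tfrac{h\omega}4\cos\tfrac{h\omega}4\big],\qquad \sigma_{1,2}=\tfrac1{3h^2}\big[P-R\pm32ic\sin\tfrac{h\omega}4\cos^5\tfrac{h\omega}4\big].$$ 3. **Diagonalization.** Let $\Delta=\sqrt2\,[4(3c-8)(5c-8)\cos(h\omega)+c(9c-16)\cos(2h\omega)+c(59c-240)+256]^{1/2}$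 and $\hat Q_{1,2}(\omega)=\frac{P\pm\Delta}{3h^2}$. If $c\ne0$ and $\omega\neq0$, let $D=32c\sin\frac{\omega h}4\cos^5\frac{\omega h}4$, $\Omega=2\cos\frac{\omega h}2\,(-16+7c+c\cos(\omega h))/D$ and $r_{1,2}=(\Omega\pm\Delta/D)\,i$; then $\mu_1-\sigma_1r_k=\hat Q_k(1-r_k)$ and $\mu_2+\sigma_2r_k=\hat Q_k(1+r_k)$ for $k=1,2$. Let $s=\operatorname{sgn}\omega$ and $$(\alpha_1,\beta_1)=\frac{(1,\,-is\,r_1)}{\sqrt{1+|r_1|^2}},\qquad(\alpha_2,\beta_2)=\frac{(|r_2|/r_2,\,-is|r_2|)}{\sqrt{1+|r_2|^2}},$$ and $(\alpha_1,\beta_1)=(1,0)$, $(\alpha_2,\beta_2)=(0,1)$ if $c=0$ or $\omega=0$. Then $|\alpha_k|^2+|\beta_k|^2=1$, and $\psi_k(\omega)=(\alpha_ke^{i\omega\mathbf x}+\beta_ke^{i\nu\mathbf x})/\sqrt{2\pi}$ satisfies $Q\psi_k(\omega)=\hat Q_k(\omega)\psi_k(\omega)$. The $2N$ vectors $\psi_k(\omega)$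 with $-N/2<\omega\le N/2$, $k=1,2$, form a basis of the space of grid functions. 4. **Eigenvalue expansions.** There is a constant $C=C(c)$, independent of $N$ and $\omega$, such that $$\Big|\hat Q_1(\omega)+\omega^2+\tfrac{(4+13c)\omega^6h^4}{2880(c-2)}\Big|\le C\omega^8h^6,\qquad\Big|\hat Q_2(\omega)-\tfrac{32(c-2)}{3h^2}+\tfrac{(6c-5)\omega^2}{3}-\tfrac{(3c-1)\omega^4h^2}{18}\Big|\le C\omega^6h^4 .$$ 5. **Semi-discrete solution.** For every initial grid function the problem $dv/dt=Qv$, $t\ge0$, has exactly one solution. If $v(0)=e^{i\omega\mathbf x}$, then for every $t\ge0$ there are real $a,b$ with $v(t)=a\,e^{i\omega\mathbf x}+b\,e^{i\nu\mathbf x}$ and $$\Big|a-e^{-\omega^2t}\Big(1-\tfrac{(4+13c)\omega^6t\,h^4}{2880(c-2)}\Big)\Big|\le C(|\omega|h)^6,\qquad\Big|b+\tfrac{c(|\omega|h)^5}{1024(c-2)}\big(e^{-\omega^2t}-e^{\hat Q_2(\omega)t}\big)\Big|\le C(|\omega|h)^6,$$ with $C=C(c)$ independent of $N,\omega,t$.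 At fixed $\omega$ and $t>0$ the same holds without the term $e^{\hat Q_2(\omega)t}$, with both right-hand sides replaced by $C(c,\omega,t)h^6$. 6. **Global error, Fourier data.** For fixed $\omega$ and $t>0$, with $v(0)=e^{i\omega\mathbf x}$ and $E(t)=e^{-\omega^2t}e^{i\omega\mathbf x}-v(t)$, $$\|E(t)\|_h=\sqrt{2\pi}\,\tfrac{|4+13c|\,\omega^6t}{2880(2-c)}e^{-\omega^2t}h^4+O(h^5),$$ and if $c=-4/13$ then $\|E(t)\|_h=\sqrt{2\pi}\,\frac{|c||\omega|^5}{1024(2-c)}e^{-\omega^2t}h^5+O(h^6)$; the implied constants depend on $c,\omega,t$ only. So the order is exactly $4$ if $c\ne-4/13$ and exactly $5$ if $c=-4/13$ (for $\omega\ne0$). 7. **Global error, smooth data.** Let $u$ be a classical $2\pi$-periodic solution of $u_t=u_{xx}$, continuous up to $t=0$, with $u(\cdot,0)=f\in C^\infty$, let $v(0)$ be the projection of $f$ onto the grid, and let $E(t)$ be the projection of $u(\cdot,t)$ onto the grid minus $v(t)$. There is a constant $C$ depending only on $c$ and $u$ such that for all $N\ge1$ and $t\ge0$: $\|E(t)\|_h\le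 Ch^4$, and $\|E(t)\|_h\le Ch^5$ if $c=-4/13$. 8. **Truncation error.** For $w\in C^\infty$, $2\pi$-periodic, let $T_e=w''-Qw$ on the grid. With constants depending only on $c$ and $w$, $\|T_e\|_h\le Ch^3$, and at every node $(T_e)_{j\mp1/4}=\pm\frac{c\,h^3}{96}w^{(5)}(x_{j\mp1/4})+O(h^4)$. For $w=e^{i\omega x}$ with any fixed integer $\omega$, for all $N\ge1$, $\|T_e\|_h=\sqrt{2\pi}\,\frac{|c||\omega|^5}{96}h^3+O(h^4)$, so the truncation error is only of order $3$ when $c\ne0$, $\omega\ne0$ (error inhibition). -/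

import Mathlib

noncomputable section

namespace BFD

open Complex (I exp)

/-- Grid functions: `(j, 0)` is the left node and `(j, 1)` the right node of the `j`-th of `N`
cells of the periodic interval `[0, 2π)`. Cells are numbered from `0`, cyclically. -/
abbrev Grid (N : ℕ) : Type := ZMod N × Fin 2 → ℂ

/-- The cell size `h = 2π / N`. -/
def meshSize (N : ℕ) : ℝ := 2 * Real.pi / N

/-- The node `x_j - h/4` (second index `0`) or `x_j + h/4` (second index `1`), where
`x_j = h j + h/2` is the centre of the `j`-th cell. -/
def node (N : ℕ) (p : ZMod N × Fin 2) : ℝ :=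
  meshSize N * (p.1.val : ℝ) + meshSize N / 2 +
    (if p.2 = 0 then -(meshSize N / 4) else meshSize N / 4)

/-- Projection of a function onto the grid. -/
def proj (N : ℕ) (w : ℝ → ℂ) : Grid N := fun p => w (node N p)

/-- The discrete `L²` norm; neighbouring nodes are `h / 2` apart. -/
def gridNorm (N : ℕ) [NeZero N] (v : Grid N) : ℝ :=
  Real.sqrt (meshSize N / 2 * ∑ p, ‖v p‖ ^ 2)

/-- The periodic two-point block finite difference operator `Q` with parameter `c`. -/
def blockOp (c : ℝ) (N : ℕ) : Grid N →ₗ[ℂ] Grid N where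
  toFun u := fun p =>
    let j := p.1
    1 / (12 * ((meshSize N : ℂ) / 2) ^ 2) *
      (if p.2 = 0 then
        (-u (j - 1, 0) + 16 * u (j - 1, 1) - 30 * u (j, 0) + 16 * u (j, 1) - u (j + 1, 0)) +
          c * (u (j - 1, 0) - 5 * u (j - 1, 1) + 10 * u (j, 0) - 10 * u (j, 1)
            + 5 * u (j + 1, 0) - u (j + 1, 1))
      else
        (-u (j - 1, 1) + 16 * u (j, 0) - 30 * u (j, 1) + 16 * u (j + 1, 0) - u (j + 1, 1)) -
          c * (u (j - 1, 0) - 5 * u (j - 1, 1) + 10 * u (j, 0) - 10 * u (j, 1)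
            + 5 * u (j + 1, 0) - u (j + 1, 1)))
  map_add' u v := by
    ext p
    simp only [Pi.add_apply]
    split_ifs <;> ring
  map_smul' a u := by
    ext p
    simp only [Pi.smul_apply, smul_eq_mul, RingHom.id_apply]
    split_ifs <;> ring

/-- `v` solves the semi-discrete problem `dv/dt = Q v` for `t ≥ 0` with initial value `v₀`. -/
def IsSemidiscreteSolution (c : ℝ) (N : ℕ) [NeZero N] (v₀ : Grid N) (v : ℝ → Grid N) : Prop :=
  v 0 = v₀ ∧ ∀ t : ℝ, 0 ≤ t → HasDerivWithinAt v (blockOp c N (v t)) (Set.Ici 0) t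

/-- `u` (written `u x t`) is a classical solution, `2π`-periodic in `x`, of `u_t = u_xx` for
`t > 0` that attains the initial value `f` continuously. -/
structure IsHeatSolution (f : ℝ → ℂ) (u : ℝ → ℝ → ℂ) : Prop where
  initial : ∀ x, u x 0 = f x
  periodic : ∀ t, 0 ≤ t → Function.Periodic (fun x => u x t) (2 * Real.pi)
  continuousOn : ContinuousOn (fun p : ℝ × ℝ => u p.1 p.2) (Set.univ ×ˢ Set.Ici 0)
  contDiff : ∀ t, 0 < t → ContDiff ℝ 2 (fun x => u x t)
  continuousOn_xx : ContinuousOn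
    (fun p : ℝ × ℝ => iteratedDeriv 2 (fun x => u x p.2) p.1) (Set.univ ×ˢ Set.Ioi 0)
  heat : ∀ t, 0 < t → ∀ x,
    HasDerivAt (fun s => u x s) (iteratedDeriv 2 (fun y => u y t) x) t

/-- The global error `u - v` at time `t`. -/
def globalError (N : ℕ) (u : ℝ → ℝ → ℂ) (v : ℝ → Grid N) (t : ℝ) : Grid N :=
  proj N (fun x => u x t) - v t

/-- The local truncation error `w'' - Q w` on the grid. -/
def truncError (c : ℝ) (N : ℕ) (w : ℝ → ℂ) : Grid N :=
  proj N (iteratedDeriv 2 w) - blockOp c N (proj N w)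

/-- The Fourier mode `x ↦ exp (i ω x)`. -/
def wave (ω : ℤ) (x : ℝ) : ℂ := exp (I * ω * x)

/-- The heat solution `exp (-ω² t) exp (i ω x)`. -/
def waveSol (ω : ℤ) (x t : ℝ) : ℂ := (Real.exp (-(ω : ℝ) ^ 2 * t) : ℂ) * wave ω x

/-- The Fourier mode on the grid. -/
def mode (N : ℕ) (ω : ℤ) : Grid N := proj N (wave ω)

/-- The aliased high frequency `ν` of a low frequency `ω` (`ν = N` for `ω = 0`). -/
def highFreq (N : ℕ) (ω : ℤ) : ℤ := if 0 < ω then ω - N else ω + N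

/-- `diag(a, b, a, b, …) v`. -/
def diagMul {N : ℕ} (a b : ℂ) (v : Grid N) : Grid N :=
  fun p => (if p.2 = 0 then a else b) * v p

section Symbols

variable (c h ω : ℝ)

def mu1 : ℂ :=
  1 / (3 * (h : ℂ) ^ 2) *
    (((32 - 15 * c) * Real.cos (h * ω / 2) + (6 * c - 2) * Real.cos (h * ω)
        - c * Real.cos (3 * h * ω / 2) + 10 * c - 30 : ℝ)
      - 32 * I * c * (Real.sin (h * ω / 4) ^ 5 * Real.cos (h * ω / 4) : ℝ))

def mu2 : ℂ :=
  1 / (3 * (h : ℂ) ^ 2) *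
    (((32 - 15 * c) * Real.cos (h * ω / 2) + (6 * c - 2) * Real.cos (h * ω)
        - c * Real.cos (3 * h * ω / 2) + 10 * c - 30 : ℝ)
      + 32 * I * c * (Real.sin (h * ω / 4) ^ 5 * Real.cos (h * ω / 4) : ℝ))

def sigma1 : ℂ :=
  1 / (3 * (h : ℂ) ^ 2) *
    (((15 * c - 32) * Real.cos (h * ω / 2) + c * Real.cos (3 * h * ω / 2)
        + (6 * c - 2) * Real.cos (h * ω) + 10 * c - 30 : ℝ)
      + 32 * I * c * (Real.sin (h * ω / 4) * Real.cos (h * ω / 4) ^ 5 : ℝ))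

def sigma2 : ℂ :=
  1 / (3 * (h : ℂ) ^ 2) *
    (((15 * c - 32) * Real.cos (h * ω / 2) + c * Real.cos (3 * h * ω / 2)
        + (6 * c - 2) * Real.cos (h * ω) + 10 * c - 30 : ℝ)
      - 32 * I * c * (Real.sin (h * ω / 4) * Real.cos (h * ω / 4) ^ 5 : ℝ))

/-- `Δ`. -/
def Delta : ℝ :=
  Real.sqrt 2 * Real.sqrt
    (4 * (3 * c - 8) * (5 * c - 8) * Real.cos (h * ω) + c * (9 * c - 16) * Real.cos (2 * h * ω)
      + c * (59 * c - 240) + 256)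

/-- The eigenvalue `Q̂₁(ω)`. -/
def Qhat1 : ℝ := ((6 * c - 2) * Real.cos (h * ω) + 10 * c - 30 + Delta c h ω) / (3 * h ^ 2)

/-- The eigenvalue `Q̂₂(ω)`. -/
def Qhat2 : ℝ := ((6 * c - 2) * Real.cos (h * ω) + 10 * c - 30 - Delta c h ω) / (3 * h ^ 2)

/-- The common denominator of `r₁` and `r₂`. -/
def rDen : ℝ := 32 * c * Real.sin (ω * h / 4) * Real.cos (ω * h / 4) ^ 5

/-- `Ω`. -/
def Omega : ℝ :=
  2 * Real.cos (ω * h / 2) * (-16 + 7 * c + c * Real.cos (ω * h)) / rDen c h ω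

def r1 : ℂ := ((Omega c h ω + Delta c h ω / rDen c h ω : ℝ) : ℂ) * I

def r2 : ℂ := ((Omega c h ω - Delta c h ω / rDen c h ω : ℝ) : ℂ) * I

end Symbols

/-- The normalized coefficients `(α₁, β₁)` of `ψ₁(ω)`; here `r = i sgn(ω) β / α`. For `c = 0` or
`ω = 0` the two modes decouple and are themselves eigenvectors. -/
def coeff1 (c h : ℝ) (ω : ℤ) : ℂ × ℂ :=
  if c = 0 ∨ ω = 0 then (1, 0)
  else (1 / (Real.sqrt (1 + ‖r1 c h ω‖ ^ 2) : ℂ),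
    -I * (ω.sign : ℂ) * r1 c h ω / (Real.sqrt (1 + ‖r1 c h ω‖ ^ 2) : ℂ))

/-- The normalized coefficients `(α₂, β₂)` of `ψ₂(ω)`. -/
def coeff2 (c h : ℝ) (ω : ℤ) : ℂ × ℂ :=
  if c = 0 ∨ ω = 0 then (0, 1)
  else ((‖r2 c h ω‖ : ℂ) / r2 c h ω / (Real.sqrt (1 + ‖r2 c h ω‖ ^ 2) : ℂ),
    -I * (ω.sign : ℂ) * (‖r2 c h ω‖ : ℂ) / (Real.sqrt (1 + ‖r2 c h ω‖ ^ 2) : ℂ))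

/-- The combination `α exp(iωx)/√(2π) + β exp(iνx)/√(2π)` of a low mode and its aliased high
mode. -/
def combo (N : ℕ) (ω : ℤ) (ab : ℂ × ℂ) : Grid N :=
  (ab.1 / (Real.sqrt (2 * Real.pi) : ℂ)) • mode N ω +
    (ab.2 / (Real.sqrt (2 * Real.pi) : ℂ)) • mode N (highFreq N ω)

/-- The eigenvectors `ψ₁(ω)` (`k = 0`) and `ψ₂(ω)` (`k = 1`). -/
def psi (c : ℝ) (N : ℕ) (ω : ℤ) (k : Fin 2) : Grid N :=
  combo N ω (if k = 0 then coeff1 c (meshSize N) ω else coeff2 c (meshSize N) ω)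

/-- The eigenvalues `Q̂₁(ω)` (`k = 0`) and `Q̂₂(ω)` (`k = 1`). -/
def Qhat (c : ℝ) (N : ℕ) (ω : ℤ) (k : Fin 2) : ℝ :=
  if k = 0 then Qhat1 c (meshSize N) ω else Qhat2 c (meshSize N) ω

/-- A set of `N` low frequencies, one for each block. -/
abbrev LowFreq (N : ℕ) : Type := {ω : ℤ // -(N : ℤ) < 2 * ω ∧ 2 * ω ≤ N}

end BFD

end

/-!
On the grid, the low mode `ω` and the high mode `ν` of the other branch agree up to a factor `± i`
at the left nodes and `∓ i` at the right nodes. They therefore span a plane that `Q` maps into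
itself. In a suitable basis of this plane `Q` is a real `2 × 2` matrix whose off-diagonal entries
have the same sign, so that its eigenvalues are real; for `c < 2` they are negative apart from
`Q̂₁(0) = 0`.

The large truncation error of `exp (i ω x)` points along the high mode, which `Q` damps at the rate
`|Q̂₂| ~ h⁻²`. The high mode is thus excited only to size `(|ω| h)⁵`: the third-order truncation
error costs no more than `h⁵` in the solution. What remains at order `h⁴` is the error of `Q̂₁`
against `-ω²`, whose leading coefficient is proportional to `4 + 13 c`.

For smooth data the solution is a superposition of waves. Frequencies `|ω| ≤ N / 2` contribute the
error just described, times a rapidly decaying Fourier coefficient; all others satisfy `|ω| h ≥ π`,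
so that the boundedness of the semigroup suffices for them.
-/

noncomputable section

namespace BFD

open Complex (I)
open Real (cos sin exp sqrt)
open scoped Real Topology
open Filter Set Asymptotics

theorem node_right {N : ℕ} (j : ZMod N) : node N (j, 1) = node N (j, 0) + meshSize N / 2 := by
  simp only [node, one_ne_zero, if_true, if_false]
  ring

section Mesh

variable (N : ℕ) [NeZero N]

theorem meshSize_pos : 0 < meshSize N := by
  have : (0 : ℝ) < N := by exact_mod_cast Nat.pos_of_ne_zero (NeZero.ne N)
  unfold meshSize
  positivity

theorem meshSize_ne_zero : meshSize N ≠ 0 := (meshSize_pos N).ne'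

theorem natCast_mul_meshSize : N * meshSize N = 2 * π := by
  have : (N : ℝ) ≠ 0 := by exact_mod_cast NeZero.ne N
  unfold meshSize
  field_simp

theorem meshSize_le : meshSize N ≤ 2 * π := by
  have : (1 : ℝ) ≤ N := by exact_mod_cast Nat.pos_of_ne_zero (NeZero.ne N)
  rw [← natCast_mul_meshSize N]
  exact le_mul_of_one_le_left (meshSize_pos N).le this

variable {N}

theorem abs_meshSize_mul_le {ω : ℤ} (hω : |2 * ω| ≤ N) : |meshSize N * ω| ≤ π := by
  have h2ω : 2 * |(ω : ℝ)| ≤ N := by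
    rw [← abs_two, ← abs_mul]
    exact_mod_cast hω
  rw [abs_mul, abs_of_pos (meshSize_pos N)]
  nlinarith [meshSize_pos N, natCast_mul_meshSize N]

theorem exists_node_add_one (j : ZMod N) (b : Fin 2) :
    ∃ q : ℤ, node N (j + 1, b) = node N (j, b) + meshSize N + q * (2 * π) := by
  have hval : (((j + 1).val : ℤ) : ZMod N) = ((j.val + 1 : ℤ) : ZMod N) := by
    push_cast
    rw [ZMod.natCast_zmod_val, ZMod.natCast_zmod_val]
  obtain ⟨q, hq⟩ := (ZMod.intCast_eq_intCast_iff_dvd_sub _ _ _).1 hval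
  have hq' : ((j.val : ℝ) + 1) - (j + 1).val = N * q := by exact_mod_cast hq
  refine ⟨-q, ?_⟩
  simp only [node, ← natCast_mul_meshSize N]
  push_cast
  linear_combination -meshSize N * hq'

end Mesh

section Stencil

/-- The difference quotient that `Q` applies at a left node `x`. Since `δ` is
antisymmetric about cell centres, changing the sign of `h` gives the one at a right node. -/
def blockStencil (c h : ℝ) (w : ℝ → ℂ) (x : ℝ) : ℂ :=
  1 / (3 * (h : ℂ) ^ 2) *
    ((-w (x - h) + 16 * w (x - h / 2) - 30 * w x + 16 * w (x + h / 2) - w (x + h))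
      + c * (w (x - h) - 5 * w (x - h / 2) + 10 * w x - 10 * w (x + h / 2)
        + 5 * w (x + h) - w (x + 3 * h / 2)))

variable {N : ℕ} [NeZero N] {w : ℝ → ℂ}

theorem proj_add_one (hw : Function.Periodic w (2 * π)) (j : ZMod N) (b : Fin 2) :
    proj N w (j + 1, b) = w (node N (j, b) + meshSize N) := by
  obtain ⟨q, hq⟩ := exists_node_add_one j b
  rw [proj, hq]
  exact hw.int_mul q _

theorem proj_sub_one (hw : Function.Periodic w (2 * π)) (j : ZMod N) (b : Fin 2) :
    proj N w (j - 1, b) = w (node N (j, b) - meshSize N) := by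
  obtain ⟨q, hq⟩ := exists_node_add_one (j - 1) b
  rw [sub_add_cancel] at hq
  rw [proj, hq, add_right_comm, add_sub_cancel_right]
  exact (hw.int_mul q _).symm

theorem blockOp_proj_left (c : ℝ) (hw : Function.Periodic w (2 * π)) (j : ZMod N) :
    blockOp c N (proj N w) (j, 0) = blockStencil c (meshSize N) w (node N (j, 0)) := by
  simp only [blockOp, LinearMap.coe_mk, AddHom.coe_mk, if_true, proj_add_one hw, proj_sub_one hw]
  simp only [proj, node_right, blockStencil]
  ring_nf

theorem blockOp_proj_right (c : ℝ) (hw : Function.Periodic w (2 * π)) (j : ZMod N) :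
    blockOp c N (proj N w) (j, 1) = blockStencil c (-meshSize N) w (node N (j, 1)) := by
  simp only [blockOp, LinearMap.coe_mk, AddHom.coe_mk, one_ne_zero, if_false, proj_add_one hw,
    proj_sub_one hw]
  simp only [proj, node_right, blockStencil, Complex.ofReal_neg]
  ring_nf

end Stencil

theorem wave_add (k : ℤ) (x y : ℝ) : wave k (x + y) = wave k x * wave k y := by
  simp only [wave, ← Complex.exp_add]
  push_cast
  ring_nf

theorem wave_add_freq (k l : ℤ) (x : ℝ) : wave (k + l) x = wave k x * wave l x := by
  simp only [wave, ← Complex.exp_add]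
  push_cast
  ring_nf

theorem wave_eq (k : ℤ) (x : ℝ) : wave k x = cos (k * x) + sin (k * x) * I := by
  rw [wave, Complex.ofReal_cos, Complex.ofReal_sin, ← Complex.exp_mul_I]
  push_cast
  ring_nf

theorem norm_wave (k : ℤ) (x : ℝ) : ‖wave k x‖ = 1 := by
  rw [← Complex.norm_exp_ofReal_mul_I (k * x), wave]
  push_cast
  ring_nf

theorem wave_periodic (k : ℤ) : Function.Periodic (wave k) (2 * π) := by
  have hperiod : wave k (2 * π) = 1 := by
    rw [wave, Complex.exp_eq_one_iff]
    exact ⟨k, by push_cast; ring⟩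
  intro x
  rw [wave_add, hperiod, mul_one]

theorem norm_mode (N : ℕ) (k : ℤ) (p : ZMod N × Fin 2) : ‖mode N k p‖ = 1 := norm_wave _ _

theorem wave_add_shift (k : ℤ) (x y : ℝ) :
    wave k (x + y) = wave k x * (cos (k * y) + sin (k * y) * I) := by
  rw [wave_add, wave_eq k y]

theorem wave_sub_shift (k : ℤ) (x y : ℝ) :
    wave k (x - y) = wave k x * (cos (k * y) - sin (k * y) * I) := by
  rw [sub_eq_add_neg, wave_add_shift, mul_neg, Real.cos_neg, Real.sin_neg]
  push_cast
  ring

/-- The real part of the symbol of `3 h² Q` at the phase `φ = k h / 2` between neighbouring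
nodes. -/
def symbolRe (c φ : ℝ) : ℝ :=
  (32 - 15 * c) * cos φ + (6 * c - 2) * cos (2 * φ) - c * cos (3 * φ) + 10 * c - 30

/-- The imaginary part of the symbol of `3 h² Q` at the phase `φ = k h / 2`, divided by `c`; it
enters with opposite signs at left and right nodes. -/
def symbolIm (φ : ℝ) : ℝ := 4 * sin (2 * φ) - 5 * sin φ - sin (3 * φ)

theorem symbolIm_eq (φ : ℝ) : symbolIm φ = -32 * (sin (φ / 2) ^ 5 * cos (φ / 2)) := by
  obtain ⟨x, rfl⟩ : ∃ x, φ = 2 * x := ⟨φ / 2, by ring⟩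
  rw [symbolIm, Real.sin_two_mul (2 * x), Real.sin_three_mul, Real.sin_two_mul x,
    Real.cos_two_mul_eq_one_sub, mul_div_cancel_left₀ x two_ne_zero]
  linear_combination 32 * sin x ^ 3 * cos x * Real.cos_sq' x

section Aliasing

/-- The factor `±1` by which the phase `φ = ω h / 2` is shifted to `φ ∓ π` when `ω` is replaced by
its aliased high frequency. -/
def aliasSign (ω : ℤ) : ℝ := if 0 < ω then 1 else -1

theorem aliasSign_eq_or (ω : ℤ) : aliasSign ω = 1 ∨ aliasSign ω = -1 := by
  unfold aliasSign
  split_ifs <;> simp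

theorem aliasSign_mul_self (ω : ℤ) : aliasSign ω * aliasSign ω = 1 := by
  rcases aliasSign_eq_or ω with h | h <;> norm_num [h]

theorem highFreq_eq (N : ℕ) (ω : ℤ) : (highFreq N ω : ℝ) = ω - aliasSign ω * N := by
  unfold highFreq aliasSign
  split_ifs <;> (push_cast; ring)

theorem symbolRe_sub_aliasSign_mul_pi (c φ : ℝ) (ω : ℤ) :
    symbolRe c (φ - aliasSign ω * π) =
      (15 * c - 32) * cos φ + (6 * c - 2) * cos (2 * φ) + c * cos (3 * φ) + 10 * c - 30 := by
  have hcos : cos (φ - aliasSign ω * π) = -cos φ := by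
    rcases aliasSign_eq_or ω with h | h <;> simp [h, Real.cos_sub_pi, Real.cos_add_pi]
  rw [symbolRe, Real.cos_two_mul, Real.cos_three_mul, hcos, Real.cos_two_mul, Real.cos_three_mul]
  ring

theorem symbolIm_sub_aliasSign_mul_pi (φ : ℝ) (ω : ℤ) :
    symbolIm (φ - aliasSign ω * π) = 32 * (sin (φ / 2) * cos (φ / 2) ^ 5) := by
  rw [symbolIm_eq]
  rcases aliasSign_eq_or ω with h | h <;>
    simp [h, sub_div, add_div, Real.sin_sub_pi_div_two, Real.cos_sub_pi_div_two,
      Real.sin_add_pi_div_two, Real.cos_add_pi_div_two] <;> ring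

theorem diagMul_diagMul {N : ℕ} (a b a' b' : ℂ) (v : Grid N) :
    diagMul a b (diagMul a' b' v) = diagMul (a * a') (b * b') v := by
  ext p
  simp only [diagMul]
  split_ifs <;> ring

theorem diagMul_self {N : ℕ} (a : ℂ) (v : Grid N) : diagMul a a v = a • v := by
  ext p
  simp [diagMul]

variable {N : ℕ} [NeZero N]

theorem wave_natCast_node (j : ZMod N) :
    wave N (node N (j, 0)) = I ∧ wave N (node N (j, 1)) = -I := by
  have hleft : ((N : ℤ) : ℝ) * node N (j, 0) = π / 2 + j.val * (2 * π) := by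
    simp only [node, if_true]
    push_cast
    linear_combination ((j.val : ℝ) + 1 / 4) * natCast_mul_meshSize N
  have hright : ((N : ℤ) : ℝ) * node N (j, 1) = π / 2 + π + j.val * (2 * π) := by
    rw [node_right]
    push_cast at hleft ⊢
    linear_combination hleft + natCast_mul_meshSize N / 2
  rw [wave_eq, wave_eq, hleft, hright, Real.cos_add_nat_mul_two_pi, Real.sin_add_nat_mul_two_pi,
    Real.cos_add_nat_mul_two_pi, Real.sin_add_nat_mul_two_pi, Real.cos_add_pi, Real.sin_add_pi]
  simp

theorem mode_add_natCast (k : ℤ) : mode N (k + N) = diagMul I (-I) (mode N k) := by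
  ext ⟨j, b⟩
  obtain ⟨hleft, hright⟩ := wave_natCast_node j
  fin_cases b <;> simp [mode, proj, diagMul, wave_add_freq, hleft, hright, mul_comm]

theorem diagMul_mode (ω : ℤ) :
    diagMul I (-I) (mode N ω) = -(aliasSign ω : ℂ) • mode N (highFreq N ω) := by
  unfold highFreq aliasSign
  split_ifs with hω
  · conv_lhs => rw [← sub_add_cancel ω (N : ℤ), mode_add_natCast, diagMul_diagMul]
    simp [diagMul_self]
  · simp [mode_add_natCast]

theorem diagMul_mode_highFreq (ω : ℤ) :
    diagMul I (-I) (mode N (highFreq N ω)) = (aliasSign ω : ℂ) • mode N ω := by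
  unfold highFreq aliasSign
  split_ifs with hω
  · rw [← mode_add_natCast, sub_add_cancel]
    simp
  · rw [mode_add_natCast, diagMul_diagMul]
    simp [diagMul_self]

theorem mode_eq_diagMul_highFreq (ω : ℤ) :
    mode N ω = diagMul (aliasSign ω * I) (-(aliasSign ω * I)) (mode N (highFreq N ω)) := by
  have hsq : (aliasSign ω : ℂ) * aliasSign ω = 1 := by exact_mod_cast aliasSign_mul_self ω
  have h := congrArg (fun v => (aliasSign ω : ℂ) • v) (diagMul_mode_highFreq (N := N) ω)
  simp only [smul_smul, hsq, one_smul] at h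
  rw [← h]
  ext p
  simp only [diagMul, Pi.smul_apply, smul_eq_mul]
  split_ifs <;> ring

theorem mode_eq_of_pos {ω : ℤ} (hω : 0 < ω) (j : ZMod N) :
    mode N ω (j, 0) = I * mode N (highFreq N ω) (j, 0) ∧
      mode N ω (j, 1) = -I * mode N (highFreq N ω) (j, 1) := by
  constructor <;> (rw [mode_eq_diagMul_highFreq]; simp [diagMul, aliasSign, hω])

theorem mode_eq_of_nonpos {ω : ℤ} (hω : ω ≤ 0) (j : ZMod N) :
    mode N ω (j, 0) = -I * mode N (highFreq N ω) (j, 0) ∧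
      mode N ω (j, 1) = I * mode N (highFreq N ω) (j, 1) := by
  constructor <;> (rw [mode_eq_diagMul_highFreq]; simp [diagMul, aliasSign, hω.not_gt])

end Aliasing

section Action

variable (c : ℝ) {N : ℕ} [NeZero N]

theorem blockStencil_wave (h : ℝ) (k : ℤ) (x : ℝ) :
    blockStencil c h (wave k) x = 1 / (3 * (h : ℂ) ^ 2) *
      ((symbolRe c (k * (h / 2)) + c * symbolIm (k * (h / 2)) * I) * wave k x) := by
  obtain ⟨φ, hφ⟩ : ∃ φ : ℝ, φ = k * (h / 2) := ⟨_, rfl⟩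
  have hφ₂ : k * h = 2 * φ := by rw [hφ]; ring
  have hφ₃ : k * (3 * h / 2) = 3 * φ := by rw [hφ]; ring
  simp only [blockStencil, symbolRe, symbolIm, wave_add_shift, wave_sub_shift, ← hφ, hφ₂, hφ₃]
  push_cast
  ring

theorem symbolRe_neg (φ : ℝ) : symbolRe c (-φ) = symbolRe c φ := by
  simp only [symbolRe, mul_neg, Real.cos_neg]

theorem symbolIm_neg (φ : ℝ) : symbolIm (-φ) = -symbolIm φ := by
  simp only [symbolIm, mul_neg, Real.sin_neg]
  ring

theorem blockOp_mode (k : ℤ) :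
    blockOp c N (mode N k) = (1 / (3 * (meshSize N : ℂ) ^ 2)) •
      ((symbolRe c (k * (meshSize N / 2)) : ℂ) • mode N k
        + (c * symbolIm (k * (meshSize N / 2)) : ℂ) • diagMul I (-I) (mode N k)) := by
  ext ⟨j, b⟩
  simp only [Pi.add_apply, Pi.smul_apply, smul_eq_mul, diagMul, mode]
  fin_cases b
  · rw [Fin.zero_eta, blockOp_proj_left c (wave_periodic k), blockStencil_wave, if_pos rfl, proj]
    ring
  · rw [Fin.mk_one, blockOp_proj_right c (wave_periodic k), blockStencil_wave,
      if_neg one_ne_zero, proj, neg_div, mul_neg, symbolRe_neg, symbolIm_neg]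
    push_cast
    ring

theorem highFreq_mul_half_meshSize (ω : ℤ) :
    highFreq N ω * (meshSize N / 2) = ω * (meshSize N / 2) - aliasSign ω * π := by
  rw [highFreq_eq]
  linear_combination (-aliasSign ω / 2) * natCast_mul_meshSize N

theorem blockOp_mode_low (ω : ℤ) :
    blockOp c N (mode N ω) =
      diagMul (mu1 c (meshSize N) ω) (mu2 c (meshSize N) ω) (mode N ω) := by
  rw [blockOp_mode, symbolIm_eq, symbolRe]
  ext p
  simp only [diagMul, Pi.add_apply, Pi.smul_apply, smul_eq_mul, mu1, mu2]
  split_ifs <;> (push_cast; ring_nf)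

theorem blockOp_mode_high (ω : ℤ) :
    blockOp c N (mode N (highFreq N ω)) =
      diagMul (sigma1 c (meshSize N) ω) (sigma2 c (meshSize N) ω) (mode N (highFreq N ω)) := by
  rw [blockOp_mode, highFreq_mul_half_meshSize, symbolIm_sub_aliasSign_mul_pi,
    symbolRe_sub_aliasSign_mul_pi]
  ext p
  simp only [diagMul, Pi.add_apply, Pi.smul_apply, smul_eq_mul, sigma1, sigma2]
  split_ifs <;> (push_cast; ring_nf)

end Action

/-- The half-trace `P` of the block of `3 h² Q` spanned by a low mode and its aliased high mode,
as a function of `θ = h ω`. -/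
def blockMean (c θ : ℝ) : ℝ := (6 * c - 2) * cos θ + 10 * c - 30

/-- Half the difference `R` of the diagonal entries of a block of `3 h² Q`. -/
def blockGap (c θ : ℝ) : ℝ := (32 - 15 * c) * cos (θ / 2) - c * cos (3 * θ / 2)

/-- The entry of a block of `3 h² Q` that feeds the high mode from the low one. -/
def blockUp (c θ : ℝ) : ℝ := 32 * c * |sin (θ / 4)| ^ 5 * cos (θ / 4)

/-- The entry of a block of `3 h² Q` that feeds the low mode from the high one. -/
def blockDown (c θ : ℝ) : ℝ := 32 * c * |sin (θ / 4)| * cos (θ / 4) ^ 5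

/-- Half the difference `Δ` of the eigenvalues of a block of `3 h² Q`. -/
def blockRadius (c θ : ℝ) : ℝ := sqrt (blockGap c θ ^ 2 + blockUp c θ * blockDown c θ)

section Blocks

variable (c : ℝ) {N : ℕ} [NeZero N] {ω : ℤ}

theorem aliasSign_mul_sin (hω : |2 * ω| ≤ N) :
    aliasSign ω * sin (meshSize N * ω / 4) = |sin (meshSize N * ω / 4)| := by
  obtain ⟨hlower, hupper⟩ := abs_le.1 (abs_meshSize_mul_le hω)
  have hh := meshSize_pos N
  unfold aliasSign
  split_ifs with hpos
  · have hω₀ : (0 : ℝ) < ω := by exact_mod_cast hpos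
    rw [one_mul, abs_of_nonneg]
    exact Real.sin_nonneg_of_nonneg_of_le_pi
      (div_nonneg (mul_nonneg hh.le hω₀.le) zero_le_four) (by linarith [Real.pi_pos])
  · have hω₀ : (ω : ℝ) ≤ 0 := by exact_mod_cast not_lt.1 hpos
    rw [neg_one_mul, abs_of_nonpos]
    exact Real.sin_nonpos_of_nonpos_of_neg_pi_le (by nlinarith [hω₀]) (by linarith [Real.pi_pos])

theorem blockOp_low (hω : |2 * ω| ≤ N) :
    blockOp c N (mode N ω) =
      (((blockMean c (meshSize N * ω) + blockGap c (meshSize N * ω)) / (3 * meshSize N ^ 2) : ℝ)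
          : ℂ) • mode N ω
        + ((blockUp c (meshSize N * ω) / (3 * meshSize N ^ 2) : ℝ) : ℂ)
          • mode N (highFreq N ω) := by
  have hre : symbolRe c (ω * (meshSize N / 2)) =
      blockMean c (meshSize N * ω) + blockGap c (meshSize N * ω) := by
    simp only [symbolRe, blockMean, blockGap]
    ring_nf
  have him : c * symbolIm (ω * (meshSize N / 2)) * -aliasSign ω =
      blockUp c (meshSize N * ω) := by
    rw [symbolIm_eq, blockUp, ← aliasSign_mul_sin hω,
      show ω * (meshSize N / 2) / 2 = meshSize N * ω / 4 by ring]
    rcases aliasSign_eq_or ω with h | h <;> (rw [h]; ring)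
  rw [blockOp_mode, diagMul_mode, smul_smul, smul_add, smul_smul, smul_smul, hre, ← him]
  congr 2 <;> (push_cast; ring)

theorem blockOp_high (hω : |2 * ω| ≤ N) :
    blockOp c N (mode N (highFreq N ω)) =
      ((blockDown c (meshSize N * ω) / (3 * meshSize N ^ 2) : ℝ) : ℂ) • mode N ω
        + (((blockMean c (meshSize N * ω) - blockGap c (meshSize N * ω)) / (3 * meshSize N ^ 2)
          : ℝ) : ℂ) • mode N (highFreq N ω) := by
  have hre : symbolRe c (ω * (meshSize N / 2) - aliasSign ω * π) =
      blockMean c (meshSize N * ω) - blockGap c (meshSize N * ω) := by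
    rw [symbolRe_sub_aliasSign_mul_pi]
    simp only [blockMean, blockGap]
    ring_nf
  have him : c * symbolIm (ω * (meshSize N / 2) - aliasSign ω * π) * aliasSign ω =
      blockDown c (meshSize N * ω) := by
    rw [symbolIm_sub_aliasSign_mul_pi, blockDown, ← aliasSign_mul_sin hω,
      show ω * (meshSize N / 2) / 2 = meshSize N * ω / 4 by ring]
    ring
  rw [blockOp_mode, diagMul_mode_highFreq, highFreq_mul_half_meshSize, smul_smul, smul_add,
    smul_smul, smul_smul, hre, ← him, add_comm]
  congr 2 <;> (push_cast; ring)

end Blocks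

section Symbols

variable (c θ : ℝ)

theorem blockGap_eq : blockGap c θ = 2 * cos (θ / 2) * (16 - 7 * c - c * cos θ) := by
  obtain ⟨x, rfl⟩ : ∃ x, θ = 2 * x := ⟨θ / 2, by ring⟩
  rw [blockGap, show 3 * (2 * x) / 2 = 3 * x by ring, mul_div_cancel_left₀ x two_ne_zero,
    Real.cos_three_mul, Real.cos_two_mul]
  ring

theorem blockGap_sq : blockGap c θ ^ 2 = 2 * (1 + cos θ) * (16 - 7 * c - c * cos θ) ^ 2 := by
  rw [blockGap_eq, mul_pow, mul_pow, Real.cos_sq, mul_div_cancel₀ θ two_ne_zero]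
  ring

theorem blockUp_mul_blockDown : blockUp c θ * blockDown c θ = 2 * c ^ 2 * (1 - cos θ) ^ 3 := by
  obtain ⟨x, rfl⟩ : ∃ x, θ = 4 * x := ⟨θ / 4, by ring⟩
  have hcos : 1 - cos (4 * x) = 8 * (sin x ^ 2 * cos x ^ 2) := by
    rw [show 4 * x = 2 * (2 * x) by ring, Real.cos_two_mul (2 * x), Real.cos_two_mul x,
      Real.sin_sq]
    ring
  rw [hcos, blockUp, blockDown, mul_div_cancel_left₀ x four_ne_zero, ← sq_abs (sin x)]
  ring

theorem blockUp_mul_blockDown_nonneg : 0 ≤ blockUp c θ * blockDown c θ := by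
  have : 0 ≤ 1 - cos θ := sub_nonneg.2 (Real.cos_le_one θ)
  rw [blockUp_mul_blockDown]
  positivity

theorem blockRadius_nonneg : 0 ≤ blockRadius c θ := Real.sqrt_nonneg _

theorem blockRadius_sq :
    blockRadius c θ ^ 2 = blockGap c θ ^ 2 + blockUp c θ * blockDown c θ :=
  Real.sq_sqrt (add_nonneg (sq_nonneg _) (blockUp_mul_blockDown_nonneg c θ))

theorem blockGap_le_blockRadius : blockGap c θ ≤ blockRadius c θ :=
  Real.le_sqrt_of_sq_le (le_add_of_nonneg_right (blockUp_mul_blockDown_nonneg c θ))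

theorem blockMean_sq_sub_blockRadius_sq :
    blockMean c θ ^ 2 - blockRadius c θ ^ 2 =
      (1 - cos θ) * (192 * (2 - c) + (4 + 40 * c) * (1 - cos θ)) := by
  rw [blockRadius_sq, blockGap_sq, blockUp_mul_blockDown, blockMean]
  ring

@[fun_prop]
theorem continuous_blockMean : Continuous (blockMean c) := by
  unfold blockMean
  fun_prop

@[fun_prop]
theorem continuous_blockGap : Continuous (blockGap c) := by
  unfold blockGap
  fun_prop

@[fun_prop]
theorem continuous_blockUp : Continuous (blockUp c) := by
  unfold blockUp
  fun_prop

@[fun_prop]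
theorem continuous_blockDown : Continuous (blockDown c) := by
  unfold blockDown
  fun_prop

@[fun_prop]
theorem continuous_blockRadius : Continuous (blockRadius c) := by
  unfold blockRadius
  fun_prop

theorem Delta_eq_blockRadius (h ω : ℝ) : Delta c h ω = blockRadius c (h * ω) := by
  rw [Delta, blockRadius, ← Real.sqrt_mul zero_le_two, blockGap_sq, blockUp_mul_blockDown,
    mul_assoc 2 h, Real.cos_two_mul]
  ring_nf

theorem Qhat1_eq (h ω : ℝ) :
    Qhat1 c h ω = (blockMean c (h * ω) + blockRadius c (h * ω)) / (3 * h ^ 2) := by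
  rw [Qhat1, Delta_eq_blockRadius, blockMean]

theorem Qhat2_eq (h ω : ℝ) :
    Qhat2 c h ω = (blockMean c (h * ω) - blockRadius c (h * ω)) / (3 * h ^ 2) := by
  rw [Qhat2, Delta_eq_blockRadius, blockMean]

end Symbols

section SymbolBounds

variable {c θ : ℝ}

theorem blockMean_le (hc : c < 2) (θ : ℝ) : blockMean c θ ≤ -(4 * (2 - c)) := by
  unfold blockMean
  nlinarith [Real.cos_le_one θ, Real.neg_one_le_cos θ]

theorem neg_blockMean_le (hc : c < 2) (θ : ℝ) : -blockMean c θ ≤ 28 * (2 - c) + 20 := by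
  unfold blockMean
  nlinarith [Real.cos_le_one θ, Real.neg_one_le_cos θ]

theorem blockGap_nonneg (hc : c < 2) (hθ : |θ| ≤ π) : 0 ≤ blockGap c θ := by
  obtain ⟨hlower, hupper⟩ := abs_le.1 hθ
  have hcos : 0 ≤ cos (θ / 2) :=
    Real.cos_nonneg_of_neg_pi_div_two_le_of_le (by linarith) (by linarith)
  have hfactor : 0 ≤ 16 - 7 * c - c * cos θ := by
    nlinarith [Real.cos_le_one θ, Real.neg_one_le_cos θ]
  rw [blockGap_eq]
  positivity

theorem le_blockMean_sq_sub_blockRadius_sq (hc : c < 2) (θ : ℝ) :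
    112 * (2 - c) * (1 - cos θ) ≤ blockMean c θ ^ 2 - blockRadius c θ ^ 2 := by
  rw [blockMean_sq_sub_blockRadius_sq, mul_comm]
  refine mul_le_mul_of_nonneg_left ?_ (sub_nonneg.2 (Real.cos_le_one θ))
  nlinarith [Real.cos_le_one θ, Real.neg_one_le_cos θ]

theorem blockRadius_le_neg_blockMean (hc : c < 2) (θ : ℝ) :
    blockRadius c θ ≤ -blockMean c θ := by
  have hdet : 0 ≤ 112 * (2 - c) * (1 - cos θ) :=
    mul_nonneg (by linarith) (sub_nonneg.2 (Real.cos_le_one θ))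
  refine le_of_sq_le_sq ?_ (by linarith [blockMean_le hc θ])
  linarith [le_blockMean_sq_sub_blockRadius_sq hc θ, neg_sq (blockMean c θ)]

-- The product `(P + Δ)(P - Δ)` is the determinant, at least of order `θ²`, and `P - Δ` is bounded.
theorem exists_blockMean_add_blockRadius_le (hc : c < 2) :
    ∃ δ : ℝ, 0 < δ ∧ δ ≤ 1 ∧ ∀ θ : ℝ, |θ| ≤ π →
      blockMean c θ + blockRadius c θ ≤ -(3 * δ * θ ^ 2) := by
  have hc' : 0 < 2 - c := sub_pos.2 hc
  set B : ℝ := 2 * (28 * (2 - c) + 20)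
  set d : ℝ := 112 * (2 - c) * (2 / π ^ 2) / B / 3 with hd
  have hBpos : 0 < B := by positivity
  have hdpos : 0 < d := by positivity
  refine ⟨min 1 d, lt_min one_pos hdpos, min_le_left _ _, fun θ hθ => ?_⟩
  have hcos : 2 / π ^ 2 * θ ^ 2 ≤ 1 - cos θ := by linarith [Real.cos_le_one_sub_mul_cos_sq hθ]
  have hsum := blockRadius_le_neg_blockMean hc θ
  have hdet : 3 * d * θ ^ 2 * B ≤ (-blockMean c θ - blockRadius c θ) * B := by
    calc 3 * d * θ ^ 2 * B = 112 * (2 - c) * (2 / π ^ 2 * θ ^ 2) := by rw [hd]; field_simp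
      _ ≤ 112 * (2 - c) * (1 - cos θ) := by gcongr
      _ ≤ (-blockMean c θ - blockRadius c θ) * (-blockMean c θ + blockRadius c θ) := by
        linarith [le_blockMean_sq_sub_blockRadius_sq hc θ]
      _ ≤ (-blockMean c θ - blockRadius c θ) * B :=
        mul_le_mul_of_nonneg_left (by linarith [neg_blockMean_le hc θ]) (by linarith)
  have hmin : min 1 d * θ ^ 2 ≤ d * θ ^ 2 := by gcongr; exact min_le_right _ _
  linarith [le_of_mul_le_mul_right hdet hBpos]

theorem sin_sq_le_cos_sq_of_abs_le (hθ : |θ| ≤ π) : sin (θ / 4) ^ 2 ≤ cos (θ / 4) ^ 2 := by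
  obtain ⟨hlower, hupper⟩ := abs_le.1 hθ
  have hcos : 0 ≤ cos (2 * (θ / 4)) :=
    Real.cos_nonneg_of_neg_pi_div_two_le_of_le (by linarith) (by linarith)
  rw [Real.cos_two_mul'] at hcos
  linarith

theorem abs_blockUp_le_blockRadius (hθ : |θ| ≤ π) : |blockUp c θ| ≤ blockRadius c θ := by
  have hsin : |sin (θ / 4)| ^ 2 ≤ cos (θ / 4) ^ 2 := by
    rw [sq_abs]
    exact sin_sq_le_cos_sq_of_abs_le hθ
  have hup : blockUp c θ ^ 2 ≤ blockUp c θ * blockDown c θ := by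
    calc blockUp c θ ^ 2
        = 1024 * c ^ 2 * |sin (θ / 4)| ^ 6 * cos (θ / 4) ^ 2 * (|sin (θ / 4)| ^ 2) ^ 2 := by
          unfold blockUp; ring
      _ ≤ 1024 * c ^ 2 * |sin (θ / 4)| ^ 6 * cos (θ / 4) ^ 2 * (cos (θ / 4) ^ 2) ^ 2 := by gcongr
      _ = blockUp c θ * blockDown c θ := by unfold blockUp blockDown; ring
  exact Real.abs_le_sqrt (hup.trans (le_add_of_nonneg_left (sq_nonneg _)))

theorem blockRadius_zero (hc : c < 2) : blockRadius c 0 = 16 * (2 - c) := by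
  have hsq : blockGap c 0 ^ 2 + blockUp c 0 * blockDown c 0 = (16 * (2 - c)) ^ 2 := by
    rw [blockGap_sq, blockUp_mul_blockDown, Real.cos_zero]
    ring
  rw [blockRadius, hsq, Real.sqrt_sq (by linarith)]

theorem blockRadius_pos (hc : c < 2) (hc₀ : c ≠ 0) (θ : ℝ) : 0 < blockRadius c θ := by
  rw [blockRadius, Real.sqrt_pos, blockGap_sq, blockUp_mul_blockDown]
  rcases (Real.cos_le_one θ).eq_or_lt with hcos | hcos
  · have hpos : 0 < 16 - 7 * c - c * 1 := by linarith
    rw [hcos]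
    nlinarith [pow_pos hpos 2]
  · have : 0 < 1 - cos θ := sub_pos.2 hcos
    have : 0 ≤ 1 + cos θ := by linarith [Real.neg_one_le_cos θ]
    positivity

theorem eq_zero_of_blockRadius_eq_zero (hc : c < 2) (hS : blockRadius c θ = 0) :
    c = 0 ∧ blockGap c θ = 0 := by
  have hc₀ : c = 0 := by_contra fun hne => (blockRadius_pos hc hne θ).ne' hS
  refine ⟨hc₀, ?_⟩
  have hsq := blockRadius_sq c θ
  rw [hS] at hsq
  nlinarith [blockUp_mul_blockDown_nonneg c θ]

end SymbolBounds

section Ratios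

variable {c θ : ℝ}

/-- The weight of the `Q̂₂`-eigenvector in the decomposition of a low mode, relative to the low
mode itself. Where the radius vanishes, so do this ratio and the next two, as `x / 0 = 0`. -/
def blockDefect (c θ : ℝ) : ℝ := (blockRadius c θ - blockGap c θ) / (2 * blockRadius c θ)

/-- The high-mode part of the `Q̂₁`-component of a low mode. -/
def upRatio (c θ : ℝ) : ℝ := blockUp c θ / (2 * blockRadius c θ)

/-- The low-mode part of the `Q̂₁`-component of a high mode. -/
def downRatio (c θ : ℝ) : ℝ := blockDown c θ / (2 * blockRadius c θ)

theorem two_mul_blockRadius_mul_blockDefect (hc : c < 2) (θ : ℝ) :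
    2 * blockRadius c θ * blockDefect c θ = blockRadius c θ - blockGap c θ := by
  rcases eq_or_ne (blockRadius c θ) 0 with hS | hS
  · simp [hS, (eq_zero_of_blockRadius_eq_zero hc hS).2]
  · exact mul_div_cancel₀ _ (mul_ne_zero two_ne_zero hS)

theorem two_mul_blockRadius_mul_upRatio (hc : c < 2) (θ : ℝ) :
    2 * blockRadius c θ * upRatio c θ = blockUp c θ := by
  rcases eq_or_ne (blockRadius c θ) 0 with hS | hS
  · obtain ⟨rfl, -⟩ := eq_zero_of_blockRadius_eq_zero hc hS
    simp [upRatio, blockUp]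
  · exact mul_div_cancel₀ _ (mul_ne_zero two_ne_zero hS)

theorem two_mul_blockRadius_mul_downRatio (hc : c < 2) (θ : ℝ) :
    2 * blockRadius c θ * downRatio c θ = blockDown c θ := by
  rcases eq_or_ne (blockRadius c θ) 0 with hS | hS
  · obtain ⟨rfl, -⟩ := eq_zero_of_blockRadius_eq_zero hc hS
    simp [downRatio, blockDown]
  · exact mul_div_cancel₀ _ (mul_ne_zero two_ne_zero hS)

theorem blockDefect_mul_add (c θ : ℝ) :
    blockDefect c θ * (blockRadius c θ + blockGap c θ) = upRatio c θ * blockDown c θ := by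
  rw [blockDefect, upRatio, div_mul_eq_mul_div, div_mul_eq_mul_div]
  congr 1
  linear_combination blockRadius_sq c θ

theorem blockDefect_nonneg (c θ : ℝ) : 0 ≤ blockDefect c θ :=
  div_nonneg (sub_nonneg.2 (blockGap_le_blockRadius c θ))
    (mul_nonneg zero_le_two (blockRadius_nonneg c θ))

theorem blockDefect_le_half (hc : c < 2) (hθ : |θ| ≤ π) : blockDefect c θ ≤ 1 / 2 := by
  have hgap := blockGap_nonneg hc hθ
  have hS := blockRadius_nonneg c θ
  exact div_le_of_le_mul₀ (by positivity) (by norm_num) (by linarith)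

theorem abs_upRatio_le_half (hθ : |θ| ≤ π) : |upRatio c θ| ≤ 1 / 2 := by
  have hS := blockRadius_nonneg c θ
  rw [upRatio, abs_div, abs_of_nonneg (mul_nonneg zero_le_two hS)]
  refine div_le_of_le_mul₀ (by positivity) (by norm_num) ?_
  linarith [abs_blockUp_le_blockRadius (c := c) hθ]

end Ratios

section Asymptotics

theorem exists_abs_le_mul_pow_of_isBigO {F : ℝ → ℝ} {n : ℕ} {B R : ℝ}
    (hB : ∀ θ, |θ| ≤ R → |F θ| ≤ B) (hF : F =O[𝓝 0] fun θ => θ ^ n) :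
    ∃ C : ℝ, 0 ≤ C ∧ ∀ θ, |θ| ≤ R → |F θ| ≤ C * |θ| ^ n := by
  obtain ⟨C, hC⟩ := hF.bound
  obtain ⟨ε, hε, hlocal⟩ := Metric.eventually_nhds_iff.1 hC
  refine ⟨|C| + |B| / ε ^ n, by positivity, fun θ hθ => ?_⟩
  rw [add_mul]
  rcases lt_or_ge |θ| ε with hlt | hge
  · have hbound : |F θ| ≤ C * |θ| ^ n := by simpa using hlocal (y := θ) (by simpa using hlt)
    calc |F θ| ≤ |C| * |θ| ^ n := hbound.trans (by gcongr; exact le_abs_self C)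
      _ ≤ |C| * |θ| ^ n + |B| / ε ^ n * |θ| ^ n := le_add_of_nonneg_right (by positivity)
  · calc |F θ| ≤ |B| := (hB θ hθ).trans (le_abs_self B)
      _ = |B| / ε ^ n * ε ^ n := by field_simp
      _ ≤ |B| / ε ^ n * |θ| ^ n := by gcongr
      _ ≤ |C| * |θ| ^ n + |B| / ε ^ n * |θ| ^ n := le_add_of_nonneg_left (by positivity)

theorem exists_abs_le_of_continuous {F : ℝ → ℝ} (hF : Continuous F) (R : ℝ) :
    ∃ B : ℝ, ∀ θ, |θ| ≤ R → |F θ| ≤ B := by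
  obtain ⟨B, hB⟩ := (isCompact_Icc (a := -R) (b := R)).exists_bound_of_continuousOn
    hF.continuousOn
  exact ⟨B, fun θ hθ => hB θ (abs_le.1 hθ)⟩

theorem isBigO_mul_of_continuousAt {F G p : ℝ → ℝ} (hF : F =O[𝓝 0] G)
    (hp : ContinuousAt p 0) : (fun θ => F θ * p θ) =O[𝓝 0] G := by
  simpa using hF.mul (hp.isBigO_one ℝ)

theorem isBigO_pow_mul {p : ℝ → ℝ} (hp : ContinuousAt p 0) (n : ℕ) :
    (fun θ => θ ^ n * p θ) =O[𝓝 0] fun θ => θ ^ n :=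
  isBigO_mul_of_continuousAt (isBigO_refl _ _) hp

theorem isBigO_pow_of_le {F : ℝ → ℝ} {m n : ℕ} (hF : F =O[𝓝 0] fun θ => θ ^ n) (hmn : m ≤ n) :
    F =O[𝓝 0] fun θ => θ ^ m :=
  hF.trans (by
    simpa [← pow_add, Nat.add_sub_cancel' hmn] using
      isBigO_pow_mul (p := fun θ => θ ^ (n - m)) (by fun_prop) m)

theorem cos_sub_taylor_isBigO :
    (fun θ => cos θ - (1 - θ ^ 2 / 2 + θ ^ 4 / 24 - θ ^ 6 / 720)) =O[𝓝 0] fun θ => θ ^ 8 := by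
  have htendsto : Tendsto (fun θ : ℝ => (θ : ℂ) * I) (𝓝 0) (𝓝 0) :=
    Continuous.tendsto' (by fun_prop) _ _ (by simp)
  have hexp := (Complex.exp_sub_sum_range_isBigO_pow 8).comp_tendsto htendsto
  have hpow : ((fun z : ℂ => z ^ 8) ∘ fun θ : ℝ => (θ : ℂ) * I) =O[𝓝 0] fun θ : ℝ => θ ^ 8 :=
    IsBigO.of_bound 1 (Eventually.of_forall fun θ => by simp)
  refine IsBigO.trans (IsBigO.of_bound 1 (Eventually.of_forall fun θ => ?_)) (hexp.trans hpow)
  have hre : (∑ i ∈ Finset.range 8, ((θ : ℂ) * I) ^ i / (i.factorial : ℂ)).re =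
      1 - θ ^ 2 / 2 + θ ^ 4 / 24 - θ ^ 6 / 720 := by
    have hI (n : ℕ) : I ^ (2 * n) = (-1) ^ n := by rw [pow_mul, Complex.I_sq]
    have hsum : ∑ i ∈ Finset.range 8, ((θ : ℂ) * I) ^ i / (i.factorial : ℂ) =
        ((1 - θ ^ 2 / 2 + θ ^ 4 / 24 - θ ^ 6 / 720 : ℝ) : ℂ)
          + ((θ - θ ^ 3 / 6 + θ ^ 5 / 120 - θ ^ 7 / 5040 : ℝ) : ℂ) * I := by
      simp only [Finset.sum_range_succ, Finset.range_zero, Finset.sum_empty, mul_pow,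
        pow_succ I 6, pow_succ I 4, pow_succ I 2, hI 1, hI 2, hI 3, Nat.factorial]
      push_cast
      ring
    rw [hsum, Complex.add_re, Complex.re_ofReal_mul, Complex.ofReal_re, Complex.I_re, mul_zero,
      add_zero]
  rw [one_mul]
  rw [Function.comp_apply, Real.norm_eq_abs, ← hre, ← Complex.exp_ofReal_mul_I_re,
    ← Complex.sub_re]
  exact Complex.abs_re_le_norm _

theorem one_sub_cos_isBigO : (fun θ => 1 - cos θ) =O[𝓝 0] fun θ => θ ^ 2 := by
  refine IsBigO.of_bound 1 (Eventually.of_forall fun θ => ?_)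
  rw [Real.norm_of_nonneg (sub_nonneg.2 (Real.cos_le_one θ)), norm_pow, Real.norm_eq_abs, sq_abs]
  nlinarith [Real.one_sub_sq_div_two_le_cos (x := θ), sq_nonneg θ]

end Asymptotics

section Expansions

variable {c : ℝ}

/-- The polynomial `-θ² - κ θ⁶` approximating `h² Q̂₁`, with `κ` chosen so that it satisfies the
characteristic equation of a block up to `O(θ⁸)`. -/
def lowTaylor (c θ : ℝ) : ℝ := -θ ^ 2 - (4 + 13 * c) / (2880 * (-2 + c)) * θ ^ 6

@[fun_prop]
theorem continuous_lowTaylor (c : ℝ) : Continuous (lowTaylor c) := by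
  unfold lowTaylor
  fun_prop

theorem charpoly_lowTaylor_isBigO (hc : c ≠ 2) :
    (fun θ => 9 * lowTaylor c θ ^ 2 - 6 * blockMean c θ * lowTaylor c θ
      + (blockMean c θ ^ 2 - blockRadius c θ ^ 2)) =O[𝓝 0] fun θ => θ ^ 8 := by
  obtain ⟨κ, hκ⟩ : ∃ κ, κ = (4 + 13 * c) / (2880 * (-2 + c)) := ⟨_, rfl⟩
  have hκ' : κ * (2880 * (-2 + c)) = 4 + 13 * c := by
    have : -2 + c ≠ 0 := by rw [neg_add_eq_sub]; exact sub_ne_zero.2 hc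
    rw [hκ]
    field_simp
  let T : ℝ → ℝ := fun θ => 1 - θ ^ 2 / 2 + θ ^ 4 / 24 - θ ^ 6 / 720
  let p : ℝ → ℝ := fun θ =>
    18 * κ + 9 * κ ^ 2 * θ ^ 4
      - 6 * (6 * c - 2) * (1 / 720 + κ * (1 / 2 - θ ^ 2 / 24 + θ ^ 4 / 720))
      + (4 + 40 * c) * (1 / 576 + 1 / 720 - θ ^ 2 / 8640 + θ ^ 4 / 518400)
  let q : ℝ → ℝ := fun θ =>
    -6 * (6 * c - 2) * lowTaylor c θ - 192 * (2 - c) - 2 * (4 + 40 * c) * (1 - T θ)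
      + (4 + 40 * c) * (cos θ - T θ)
  have hp : ContinuousAt p 0 := by fun_prop
  have hq : ContinuousAt q 0 := by fun_prop
  refine ((isBigO_pow_mul hp 8).add
    (isBigO_mul_of_continuousAt cos_sub_taylor_isBigO hq)).congr_left fun θ => ?_
  rw [blockMean_sq_sub_blockRadius_sq]
  simp only [p, q, T, lowTaylor, blockMean, ← hκ]
  linear_combination (-θ ^ 6 / 30) * hκ'

theorem blockMean_add_blockRadius_isBigO (hc : c < 2) :
    (fun θ => (blockMean c θ + blockRadius c θ) / 3 - lowTaylor c θ) =O[𝓝 0]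
      fun θ => θ ^ 8 := by
  let d : ℝ → ℝ := fun θ => -3 * blockMean c θ + 3 * blockRadius c θ + 9 * lowTaylor c θ
  have hd₀ : d 0 ≠ 0 := by
    have hmean := blockMean_le hc 0
    have hradius := blockRadius_nonneg c 0
    simp only [d, lowTaylor]
    norm_num
    exact ne_of_gt (by linarith)
  have hd : ContinuousAt d 0 := by fun_prop
  refine ((isBigO_mul_of_continuousAt (charpoly_lowTaylor_isBigO hc.ne)
    (hd.inv₀ hd₀)).neg_left).congr' ?_ EventuallyEq.rfl
  filter_upwards [hd.eventually_ne hd₀] with θ hθ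
  rw [Pi.inv_apply, ← div_eq_mul_inv, neg_eq_iff_eq_neg, div_eq_iff hθ]
  simp only [d]
  ring

theorem exists_low_expansion (hc : c < 2) :
    ∃ C : ℝ, 0 ≤ C ∧ ∀ θ : ℝ, |θ| ≤ π →
      |(blockMean c θ + blockRadius c θ) / 3 - lowTaylor c θ| ≤ C * |θ| ^ 8 := by
  obtain ⟨B, hB⟩ := exists_abs_le_of_continuous
    (F := fun θ => (blockMean c θ + blockRadius c θ) / 3 - lowTaylor c θ) (by fun_prop) π
  exact exists_abs_le_mul_pow_of_isBigO hB (blockMean_add_blockRadius_isBigO hc)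

theorem blockMean_sub_blockRadius_isBigO (hc : c < 2) :
    (fun θ => (blockMean c θ - blockRadius c θ) / 3
      - (32 * (-2 + c) / 3 - (-5 + 6 * c) * θ ^ 2 / 3 + (-1 + 3 * c) * θ ^ 4 / 18)) =O[𝓝 0]
      fun θ => θ ^ 6 := by
  have hcos := isBigO_pow_of_le cos_sub_taylor_isBigO (show 6 ≤ 8 by norm_num)
  have hlow := isBigO_pow_of_le (blockMean_add_blockRadius_isBigO hc) (show 6 ≤ 8 by norm_num)
  let κ : ℝ := (4 + 13 * c) / (2880 * (-2 + c))
  have hpow : (fun θ : ℝ => θ ^ 6 * (κ - (6 * c - 2) / 1080)) =O[𝓝 0] fun θ => θ ^ 6 :=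
    isBigO_pow_mul (by fun_prop) 6
  refine (((hcos.const_mul_left (2 / 3 * (6 * c - 2))).sub hlow).add hpow).congr_left
    fun θ => ?_
  simp only [blockMean, lowTaylor, κ]
  ring

theorem exists_high_expansion (hc : c < 2) :
    ∃ C : ℝ, 0 ≤ C ∧ ∀ θ : ℝ, |θ| ≤ π →
      |(blockMean c θ - blockRadius c θ) / 3
        - (32 * (-2 + c) / 3 - (-5 + 6 * c) * θ ^ 2 / 3 + (-1 + 3 * c) * θ ^ 4 / 18)|
        ≤ C * |θ| ^ 6 := by
  obtain ⟨B, hB⟩ := exists_abs_le_of_continuous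
    (F := fun θ => (blockMean c θ - blockRadius c θ) / 3
      - (32 * (-2 + c) / 3 - (-5 + 6 * c) * θ ^ 2 / 3 + (-1 + 3 * c) * θ ^ 4 / 18))
    (by fun_prop) π
  exact exists_abs_le_mul_pow_of_isBigO hB (blockMean_sub_blockRadius_isBigO hc)

theorem blockRadius_sub_isBigO (hc : c < 2) :
    (fun θ => blockRadius c θ - 16 * (2 - c)) =O[𝓝 0] fun θ => θ ^ 2 := by
  have hlow := isBigO_pow_of_le (blockMean_add_blockRadius_isBigO hc) (show 2 ≤ 8 by norm_num)
  have hpow : (fun θ : ℝ => θ ^ 2 * (-3 * (1 + (4 + 13 * c) / (2880 * (-2 + c)) * θ ^ 4)))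
      =O[𝓝 0] fun θ => θ ^ 2 := isBigO_pow_mul (by fun_prop) 2
  refine (((hlow.const_mul_left 3).add hpow).add
    (one_sub_cos_isBigO.const_mul_left (6 * c - 2))).congr_left fun θ => ?_
  simp only [blockMean, lowTaylor]
  ring

theorem abs_sin_pow_mul_cos_isBigO :
    (fun x => |sin x| ^ 5 * cos x - |x| ^ 5) =O[𝓝 0] fun x => x ^ 7 := by
  have hsin : (fun x => |sin x| - |x|) =O[𝓝 0] fun x => x ^ 3 :=
    IsBigO.of_bound (1 / 6) (Eventually.of_forall fun x => by
      have habs := (abs_abs_sub_abs_le (sin x) x).trans_eq (abs_sub_comm _ _)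
      simpa [div_eq_inv_mul] using habs.trans (Real.abs_sub_sin_le x))
  have hle : (fun x => |sin x|) =O[𝓝 0] fun x => x :=
    IsBigO.of_bound 1 (Eventually.of_forall fun x => by simpa using Real.abs_sin_le_abs)
  have hid : (fun x : ℝ => |x|) =O[𝓝 0] fun x => x := (isBigO_refl _ _).abs_left
  have hsum : (fun x => |sin x| ^ 4 + |sin x| ^ 3 * |x| + |sin x| ^ 2 * |x| ^ 2 + |sin x| * |x| ^ 3
      + |x| ^ 4) =O[𝓝 0] fun x => x ^ 4 := by
    refine ((((hle.pow 4).add ?_).add ?_).add ?_).add (hid.pow 4)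
    · simpa [← pow_succ] using (hle.pow 3).mul hid
    · simpa [← pow_add] using (hle.pow 2).mul (hid.pow 2)
    · simpa [← pow_succ'] using hle.mul (hid.pow 3)
  have hfirst : (fun x => (|sin x| - |x|) * (|sin x| ^ 4 + |sin x| ^ 3 * |x|
      + |sin x| ^ 2 * |x| ^ 2 + |sin x| * |x| ^ 3 + |x| ^ 4) * cos x) =O[𝓝 0] fun x => x ^ 7 :=
    isBigO_mul_of_continuousAt (by simpa [← pow_add] using hsin.mul hsum) (by fun_prop)
  have hsecond : (fun x => |x| ^ 5 * (1 - cos x)) =O[𝓝 0] fun x => x ^ 7 := by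
    simpa [← pow_add] using (hid.pow 5).mul one_sub_cos_isBigO
  exact (hfirst.sub hsecond).congr_left fun x => by ring

theorem blockUp_sub_isBigO (c : ℝ) :
    (fun θ => blockUp c θ - c * |θ| ^ 5 / 32) =O[𝓝 0] fun θ => θ ^ 7 := by
  have htendsto : Tendsto (fun θ : ℝ => θ / 4) (𝓝 0) (𝓝 0) :=
    Continuous.tendsto' (by fun_prop) _ _ (by simp)
  have hscale : (fun θ : ℝ => (θ / 4) ^ 7) =O[𝓝 0] fun θ => θ ^ 7 :=
    (isBigO_pow_mul (p := fun _ => 1 / 4 ^ 7) (by fun_prop) 7).congr_left fun θ => by ring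
  refine (((abs_sin_pow_mul_cos_isBigO.comp_tendsto htendsto).trans hscale).const_mul_left
    (32 * c)).congr_left fun θ => ?_
  simp only [Function.comp_apply, blockUp, abs_div, Nat.abs_ofNat]
  ring

theorem exists_upRatio_expansion (hc : c < 2) :
    ∃ C : ℝ, 0 ≤ C ∧ ∀ θ : ℝ, |θ| ≤ π →
      |upRatio c θ - -(c * |θ| ^ 5 / (1024 * (-2 + c)))|
        ≤ C * |θ| ^ 6 := by
  obtain ⟨B, hB⟩ := exists_abs_le_of_continuous
    (F := fun θ => -(c * |θ| ^ 5 / (1024 * (-2 + c)))) (by fun_prop) π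
  refine exists_abs_le_mul_pow_of_isBigO (B := 1 / 2 + B)
    (fun θ hθ => (abs_sub _ _).trans (add_le_add (abs_upRatio_le_half hθ) (hB θ hθ))) ?_
  have hS₀ : blockRadius c 0 ≠ 0 := by rw [blockRadius_zero hc]; linarith
  have hS : ContinuousAt (blockRadius c) 0 := (continuous_blockRadius c).continuousAt
  have hUp : (fun θ => (blockUp c θ - c * |θ| ^ 5 / 32) * (2 * blockRadius c θ)⁻¹) =O[𝓝 0]
      fun θ => θ ^ 6 :=
    isBigO_mul_of_continuousAt (isBigO_pow_of_le (blockUp_sub_isBigO c) (by norm_num))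
      ((hS.const_mul 2).inv₀ (mul_ne_zero two_ne_zero hS₀))
  have hquintic : (fun θ : ℝ => |θ| ^ 5) =O[𝓝 0] fun θ => θ ^ 4 :=
    ((isBigO_pow_mul (p := fun θ => |θ|) (by fun_prop) 4)).congr_left fun θ => by
      rw [← Even.pow_abs (n := 4) (by decide)]; ring
  have hS' : (fun θ => |θ| ^ 5 * (blockRadius c θ - 16 * (2 - c))
      * (c / (1024 * (-2 + c)) * (blockRadius c θ)⁻¹)) =O[𝓝 0] fun θ => θ ^ 6 :=
    isBigO_mul_of_continuousAt
      ((hquintic.mul (blockRadius_sub_isBigO hc)).congr_right fun θ => by ring)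
      ((hS.inv₀ hS₀).const_mul _)
  refine (hUp.add hS').congr' ?_ EventuallyEq.rfl
  filter_upwards [hS.eventually_ne hS₀] with θ hθ
  have hc' : -2 + c ≠ 0 := by linarith
  rw [upRatio]
  field_simp
  ring

theorem exists_abs_blockDefect_le (hc : c < 2) :
    ∃ C : ℝ, 0 ≤ C ∧ ∀ θ : ℝ, |θ| ≤ π →
      |blockDefect c θ| ≤ C * |θ| ^ 6 := by
  refine exists_abs_le_mul_pow_of_isBigO (B := 1 / 2) (fun θ hθ => ?_) ?_
  · rw [abs_of_nonneg (blockDefect_nonneg c θ)]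
    exact blockDefect_le_half hc hθ
  · let d : ℝ → ℝ := fun θ => 2 * blockRadius c θ * (blockRadius c θ + blockGap c θ)
    have hd : ContinuousAt d 0 := by fun_prop
    have hd₀ : d 0 ≠ 0 := by
      have hS₀ : 0 < blockRadius c 0 := by rw [blockRadius_zero hc]; linarith
      have hgap := blockGap_nonneg hc (θ := 0) (by simpa using Real.pi_pos.le)
      exact ne_of_gt (by positivity)
    have hcube : (fun θ => 2 * c ^ 2 * (1 - cos θ) ^ 3) =O[𝓝 0] fun θ => θ ^ 6 :=
      ((one_sub_cos_isBigO.pow 3).const_mul_left _).congr_right fun θ => by ring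
    refine (isBigO_mul_of_continuousAt hcube (hd.inv₀ hd₀)).congr' ?_ EventuallyEq.rfl
    filter_upwards [hd.eventually_ne hd₀] with θ hθ
    rw [Pi.inv_apply, ← div_eq_mul_inv, blockDefect, div_eq_div_iff hθ (left_ne_zero_of_mul hθ)]
    simp only [d]
    linear_combination (-2 * blockRadius c θ) *
      (blockRadius_sq c θ + blockUp_mul_blockDown c θ)

theorem exists_abs_downRatio_le (hc : c < 2) :
    ∃ K : ℝ, ∀ θ : ℝ, |θ| ≤ π → |downRatio c θ| ≤ K := by
  rcases eq_or_ne c 0 with rfl | hc₀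
  · exact ⟨0, fun θ _ => by simp [downRatio, blockDown]⟩
  · exact exists_abs_le_of_continuous ((continuous_blockDown c).div (by fun_prop)
      fun θ => (mul_pos two_pos (blockRadius_pos hc hc₀ θ)).ne') π

end Expansions

section Solutions

variable {c : ℝ} {N : ℕ} [NeZero N] {v₀ : Grid N} {v : ℝ → Grid N} {t : ℝ}

theorem IsSemidiscreteSolution.eqOn {w : ℝ → Grid N} (hw : IsSemidiscreteSolution c N v₀ w)
    (hv : IsSemidiscreteSolution c N v₀ v) : Set.EqOn w v (Set.Ici 0) := by
  intro t ht
  let Q := LinearMap.toContinuousLinearMap (blockOp c N)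
  have hcont {u : ℝ → Grid N} (hu : IsSemidiscreteSolution c N v₀ u) : ContinuousOn u (Icc 0 t) :=
    fun s hs => (hu.2 s hs.1).continuousWithinAt.mono Icc_subset_Ici_self
  have hderiv {u : ℝ → Grid N} (hu : IsSemidiscreteSolution c N v₀ u) :
      ∀ s ∈ Ico 0 t, HasDerivWithinAt u (Q (u s)) (Ici s) s :=
    fun s hs => (hu.2 s hs.1).mono (Ici_subset_Ici.2 hs.1)
  exact ODE_solution_unique (v := fun _ => Q) (fun _ => Q.lipschitz) (hcont hw) (hderiv hw)
    (hcont hv) (hderiv hv) (hw.1.trans hv.1.symm) (right_mem_Icc.2 ht)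

variable (c N) in
/-- The semigroup `exp (t Q)`. -/
def semigroup (t : ℝ) : Grid N →L[ℂ] Grid N :=
  NormedSpace.exp ((t : ℂ) • LinearMap.toContinuousLinearMap (blockOp c N))

theorem isSemidiscreteSolution_semigroup (v₀ : Grid N) :
    IsSemidiscreteSolution c N v₀ fun t => semigroup c N t v₀ := by
  let Q := LinearMap.toContinuousLinearMap (blockOp c N)
  refine ⟨?_, fun t _ => ?_⟩
  · have hQ : ((0 : ℝ) : ℂ) • Q = 0 := by
      ext
      simp
    exact congrArg (· v₀) ((congrArg NormedSpace.exp hQ).trans NormedSpace.exp_zero)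
  · have hexp := ((hasDerivAt_exp_smul_const' (𝕂 := ℂ) Q (t : ℂ)).clm_apply
      (hasDerivAt_const (t : ℂ) v₀)).scomp t Complex.ofRealCLM.hasDerivAt
    simp only [map_zero, add_zero, Complex.ofRealCLM_apply, Complex.ofReal_one, one_smul] at hexp
    exact hexp.hasDerivWithinAt

theorem existsUnique_semidiscreteSolution (v₀ : Grid N) :
    ∃ v, IsSemidiscreteSolution c N v₀ v ∧
      ∀ w, IsSemidiscreteSolution c N v₀ w → Set.EqOn w v (Set.Ici 0) :=
  ⟨_, isSemidiscreteSolution_semigroup v₀,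
    fun _ hw => hw.eqOn (isSemidiscreteSolution_semigroup v₀)⟩

theorem IsSemidiscreteSolution.eq_semigroup (hv : IsSemidiscreteSolution c N v₀ v)
    (ht : 0 ≤ t) : v t = semigroup c N t v₀ :=
  hv.eqOn (isSemidiscreteSolution_semigroup v₀) ht

theorem semigroup_apply_of_blockOp_eq_smul {q : ℝ} {e : Grid N}
    (he : blockOp c N e = (q : ℂ) • e) (ht : 0 ≤ t) :
    semigroup c N t e = (exp (q * t) : ℂ) • e := by
  refine (IsSemidiscreteSolution.eq_semigroup (v := fun t => (exp (q * t) : ℂ) • e)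
    ⟨by simp, fun t _ => ?_⟩ ht).symm
  have hexp : HasDerivAt (fun t => exp (q * t)) (exp (q * t) * q) t := by
    simpa using ((hasDerivAt_id t).const_mul q).exp
  refine (hexp.ofReal_comp.smul_const e).hasDerivWithinAt.congr_deriv ?_
  rw [map_smul, he, smul_smul]
  push_cast
  rfl

end Solutions

section Amplitudes

variable (c h ω t : ℝ)

/-- The amplitude of the low mode in the solution started from the low mode. -/
def ampLowLow : ℝ :=
  exp (Qhat1 c h ω * t)
    - blockDefect c (h * ω) * (exp (Qhat1 c h ω * t) - exp (Qhat2 c h ω * t))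

/-- The amplitude of the high mode in the solution started from the low mode. -/
def ampLowHigh : ℝ := upRatio c (h * ω) * (exp (Qhat1 c h ω * t) - exp (Qhat2 c h ω * t))

/-- The amplitude of the low mode in the solution started from the high mode. -/
def ampHighLow : ℝ := downRatio c (h * ω) * (exp (Qhat1 c h ω * t) - exp (Qhat2 c h ω * t))

/-- The amplitude of the high mode in the solution started from the high mode. -/
def ampHighHigh : ℝ :=
  exp (Qhat2 c h ω * t)
    + blockDefect c (h * ω) * (exp (Qhat1 c h ω * t) - exp (Qhat2 c h ω * t))

end Amplitudes

section FourierSolutions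

variable {c : ℝ} {N : ℕ} [NeZero N] {ω : ℤ} {t : ℝ}

theorem blockOp_combination (hω : |2 * ω| ≤ N) {a b : ℂ} {s : ℝ}
    (hlow : a * blockGap c (meshSize N * ω) + b * blockDown c (meshSize N * ω) = s * a)
    (hhigh : a * blockUp c (meshSize N * ω) - b * blockGap c (meshSize N * ω) = s * b) :
    blockOp c N (a • mode N ω + b • mode N (highFreq N ω)) =
      (((blockMean c (meshSize N * ω) + s) / (3 * meshSize N ^ 2) : ℝ) : ℂ) •
        (a • mode N ω + b • mode N (highFreq N ω)) := by
  rw [map_add, map_smul, map_smul, blockOp_low c hω, blockOp_high c hω]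
  ext p
  simp only [Pi.add_apply, Pi.smul_apply, smul_eq_mul]
  push_cast
  linear_combination (3 * (meshSize N : ℂ) ^ 2)⁻¹ *
    (mode N ω p * hlow + mode N (highFreq N ω) p * hhigh)

theorem blockOp_combination_Qhat1 (hω : |2 * ω| ≤ N) {a b : ℂ}
    (hlow : a * blockGap c (meshSize N * ω) + b * blockDown c (meshSize N * ω) =
      blockRadius c (meshSize N * ω) * a)
    (hhigh : a * blockUp c (meshSize N * ω) - b * blockGap c (meshSize N * ω) =
      blockRadius c (meshSize N * ω) * b) :
    blockOp c N (a • mode N ω + b • mode N (highFreq N ω)) =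
      (Qhat1 c (meshSize N) ω : ℂ) • (a • mode N ω + b • mode N (highFreq N ω)) := by
  rw [blockOp_combination hω hlow hhigh, Qhat1_eq]

theorem blockOp_combination_Qhat2 (hω : |2 * ω| ≤ N) {a b : ℂ}
    (hlow : a * blockGap c (meshSize N * ω) + b * blockDown c (meshSize N * ω) =
      -blockRadius c (meshSize N * ω) * a)
    (hhigh : a * blockUp c (meshSize N * ω) - b * blockGap c (meshSize N * ω) =
      -blockRadius c (meshSize N * ω) * b) :
    blockOp c N (a • mode N ω + b • mode N (highFreq N ω)) =
      (Qhat2 c (meshSize N) ω : ℂ) • (a • mode N ω + b • mode N (highFreq N ω)) := by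
  rw [← Complex.ofReal_neg] at hlow hhigh
  rw [blockOp_combination hω hlow hhigh, Qhat2_eq, sub_eq_add_neg]

theorem semigroup_mode_low (hc : c < 2) (hω : |2 * ω| ≤ N) (ht : 0 ≤ t) :
    semigroup c N t (mode N ω) =
      (ampLowLow c (meshSize N) ω t : ℂ) • mode N ω
        + (ampLowHigh c (meshSize N) ω t : ℂ) • mode N (highFreq N ω) := by
  let θ := meshSize N * ω
  have hκ : 2 * blockRadius c θ * blockDefect c θ = (blockRadius c θ - blockGap c θ : ℂ) :=
    mod_cast two_mul_blockRadius_mul_blockDefect hc θ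
  have hup : 2 * blockRadius c θ * upRatio c θ = (blockUp c θ : ℂ) :=
    mod_cast two_mul_blockRadius_mul_upRatio hc θ
  have hmul : blockDefect c θ * (blockRadius c θ + blockGap c θ) =
      (upRatio c θ * blockDown c θ : ℂ) := mod_cast blockDefect_mul_add c θ
  have hfirst := semigroup_apply_of_blockOp_eq_smul (blockOp_combination_Qhat1 (c := c) hω
    (a := 1 - blockDefect c θ) (b := upRatio c θ) (by linear_combination hκ - hmul)
    (by linear_combination (blockDefect c θ - 1 : ℂ) * hup - upRatio c θ * hκ)) ht
  have hsecond := semigroup_apply_of_blockOp_eq_smul (blockOp_combination_Qhat2 (c := c) hω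
    (a := blockDefect c θ) (b := -upRatio c θ) (by linear_combination hmul)
    (by linear_combination (-blockDefect c θ : ℂ) * hup + upRatio c θ * hκ)) ht
  have hsplit : mode N ω =
      ((1 - blockDefect c θ : ℂ) • mode N ω + (upRatio c θ : ℂ) • mode N (highFreq N ω))
        + ((blockDefect c θ : ℂ) • mode N ω + (-upRatio c θ : ℂ) • mode N (highFreq N ω)) := by
    module
  conv_lhs => rw [hsplit, map_add, hfirst, hsecond]
  simp only [ampLowLow, ampLowHigh]
  push_cast
  module

theorem semigroup_mode_high (hc : c < 2) (hω : |2 * ω| ≤ N) (ht : 0 ≤ t) :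
    semigroup c N t (mode N (highFreq N ω)) =
      (ampHighLow c (meshSize N) ω t : ℂ) • mode N ω
        + (ampHighHigh c (meshSize N) ω t : ℂ) • mode N (highFreq N ω) := by
  let θ := meshSize N * ω
  have hκ : 2 * blockRadius c θ * blockDefect c θ = (blockRadius c θ - blockGap c θ : ℂ) :=
    mod_cast two_mul_blockRadius_mul_blockDefect hc θ
  have hup : 2 * blockRadius c θ * upRatio c θ = (blockUp c θ : ℂ) :=
    mod_cast two_mul_blockRadius_mul_upRatio hc θ
  have hdown : 2 * blockRadius c θ * downRatio c θ = (blockDown c θ : ℂ) :=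
    mod_cast two_mul_blockRadius_mul_downRatio hc θ
  have hmul : blockDefect c θ * (blockRadius c θ + blockGap c θ) =
      (downRatio c θ * blockUp c θ : ℂ) := by
    have hmul' : blockDefect c θ * (blockRadius c θ + blockGap c θ) =
      (upRatio c θ * blockDown c θ : ℂ) := mod_cast blockDefect_mul_add c θ
    linear_combination hmul' - upRatio c θ * hdown + downRatio c θ * hup
  have hfirst := semigroup_apply_of_blockOp_eq_smul (blockOp_combination_Qhat1 (c := c) hω
    (a := downRatio c θ) (b := blockDefect c θ)
    (by linear_combination (-blockDefect c θ : ℂ) * hdown + downRatio c θ * hκ)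
    (by linear_combination -hmul)) ht
  have hsecond := semigroup_apply_of_blockOp_eq_smul (blockOp_combination_Qhat2 (c := c) hω
    (a := -downRatio c θ) (b := 1 - blockDefect c θ)
    (by linear_combination (blockDefect c θ - 1 : ℂ) * hdown - downRatio c θ * hκ)
    (by linear_combination hmul - hκ)) ht
  have hsplit : mode N (highFreq N ω) =
      ((downRatio c θ : ℂ) • mode N ω + (blockDefect c θ : ℂ) • mode N (highFreq N ω))
        + ((-downRatio c θ : ℂ) • mode N ω
          + (1 - blockDefect c θ : ℂ) • mode N (highFreq N ω)) := by
    module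
  conv_lhs => rw [hsplit, map_add, hfirst, hsecond]
  simp only [ampHighLow, ampHighHigh]
  push_cast
  module

end FourierSolutions

/-! ### Decay of the amplitudes -/

section Exponential

theorem exp_sub_exp_le (x y : ℝ) : exp x - exp y ≤ (x - y) * exp x := by
  have hxy : exp y = exp (y - x) * exp x := by rw [← Real.exp_add, sub_add_cancel]
  rw [hxy]
  nlinarith [Real.exp_pos x, Real.add_one_le_exp (y - x)]

theorem abs_exp_sub_exp_le {x y M : ℝ} (hx : x ≤ M) (hy : y ≤ M) :
    |exp x - exp y| ≤ |x - y| * exp M := by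
  wlog hyx : y ≤ x generalizing x y
  · rw [abs_sub_comm, abs_sub_comm x]
    exact this hy hx (le_of_not_ge hyx)
  rw [abs_of_nonneg (sub_nonneg.2 (Real.exp_le_exp.2 hyx)), abs_of_nonneg (sub_nonneg.2 hyx)]
  exact (exp_sub_exp_le x y).trans
    (mul_le_mul_of_nonneg_left (Real.exp_le_exp.2 hx) (sub_nonneg.2 hyx))

theorem abs_exp_sub_exp_sub_mul_exp_le {x y M : ℝ} (hx : x ≤ M) (hy : y ≤ M) :
    |exp x - exp y - (x - y) * exp y| ≤ (x - y) ^ 2 * exp M := by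
  rw [abs_of_nonneg (by linarith [exp_sub_exp_le y x])]
  calc exp x - exp y - (x - y) * exp y
      ≤ (x - y) * (exp x - exp y) := by linarith [exp_sub_exp_le x y]
    _ ≤ |x - y| * |exp x - exp y| := (le_abs_self _).trans_eq (abs_mul _ _)
    _ ≤ |x - y| * (|x - y| * exp M) := by gcongr; exact abs_exp_sub_exp_le hx hy
    _ = (x - y) ^ 2 * exp M := by rw [← mul_assoc, ← pow_two, sq_abs]

theorem abs_exp_sub_exp_mul_one_add_le {x y M : ℝ} (hx : x ≤ M) (hy : y ≤ M) (z : ℝ) :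
    |exp x - exp y * (1 + z)| ≤ ((x - y) ^ 2 + |x - y - z|) * exp M := by
  calc |exp x - exp y * (1 + z)|
      = |(exp x - exp y - (x - y) * exp y) + (x - y - z) * exp y| := by congr 1; ring
    _ ≤ |exp x - exp y - (x - y) * exp y| + |x - y - z| * exp y :=
        (abs_add_le _ _).trans_eq (by rw [abs_mul (x - y - z), Real.abs_exp])
    _ ≤ (x - y) ^ 2 * exp M + |x - y - z| * exp M := by
        gcongr
        exact abs_exp_sub_exp_sub_mul_exp_le hx hy
    _ = _ := (add_mul _ _ _).symm

theorem mul_exp_neg_le {δ : ℝ} (hδ : 0 < δ) (τ : ℝ) : τ * exp (-(δ * τ)) ≤ 1 / δ := by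
  rw [Real.exp_neg, ← div_eq_mul_inv, div_le_div_iff₀ (Real.exp_pos _) hδ]
  linarith [Real.add_one_le_exp (δ * τ)]

theorem sq_mul_exp_neg_le {δ τ : ℝ} (hδ : 0 < δ) (hτ : 0 ≤ τ) :
    τ ^ 2 * exp (-(δ * τ)) ≤ 4 / δ ^ 2 := by
  calc τ ^ 2 * exp (-(δ * τ)) = (τ * exp (-(δ / 2 * τ))) ^ 2 := by
        rw [mul_pow, ← Real.exp_nat_mul]
        push_cast
        ring_nf
    _ ≤ (1 / (δ / 2)) ^ 2 := by
        gcongr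
        exact mul_exp_neg_le (half_pos hδ) τ
    _ = 4 / δ ^ 2 := by
        field_simp
        norm_num

theorem pow_add_le_mul_pow {x R : ℝ} (hx : 0 ≤ x) (hxR : x ≤ R) (m k : ℕ) :
    x ^ (m + k) ≤ R ^ k * x ^ m := by
  rw [pow_add, mul_comm]
  gcongr

end Exponential

section Eigenvalues

variable {c : ℝ}

theorem Qhat1_nonpos (hc : c < 2) (h ω : ℝ) : Qhat1 c h ω ≤ 0 := by
  rw [Qhat1_eq]
  exact div_nonpos_of_nonpos_of_nonneg (by linarith [blockRadius_le_neg_blockMean hc (h * ω)])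
    (by positivity)

theorem Qhat2_le_Qhat1 (c h ω : ℝ) : Qhat2 c h ω ≤ Qhat1 c h ω := by
  rw [Qhat1_eq, Qhat2_eq]
  gcongr
  linarith [blockRadius_nonneg c (h * ω)]

theorem Qhat2_le (hc : c < 2) (h ω : ℝ) : Qhat2 c h ω ≤ -(4 * (2 - c)) / (3 * h ^ 2) := by
  rw [Qhat2_eq]
  gcongr
  linarith [blockRadius_nonneg c (h * ω), blockMean_le hc (h * ω)]

theorem exists_Qhat1_le (hc : c < 2) :
    ∃ δ : ℝ, 0 < δ ∧ δ ≤ 1 ∧ ∀ h ω : ℝ, 0 < h → |h * ω| ≤ π → Qhat1 c h ω ≤ -(δ * ω ^ 2) := by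
  obtain ⟨δ, hδ₀, hδ₁, hδ⟩ := exists_blockMean_add_blockRadius_le hc
  refine ⟨δ, hδ₀, hδ₁, fun h ω hh hθ => ?_⟩
  rw [Qhat1_eq, div_le_iff₀ (by positivity)]
  linarith [hδ _ hθ]

theorem exists_Qhat1_expansion (hc : c < 2) :
    ∃ C : ℝ, 0 ≤ C ∧ ∀ h ω : ℝ, 0 < h → |h * ω| ≤ π →
      |Qhat1 c h ω - (-ω ^ 2 - (4 + 13 * c) * ω ^ 6 * h ^ 4 / (2880 * (-2 + c)))|
        ≤ C * ω ^ 8 * h ^ 6 := by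
  obtain ⟨C, hC₀, hC⟩ := exists_low_expansion hc
  refine ⟨C, hC₀, fun h ω hh hθ => ?_⟩
  have hscale : Qhat1 c h ω - (-ω ^ 2 - (4 + 13 * c) * ω ^ 6 * h ^ 4 / (2880 * (-2 + c)))
      = ((blockMean c (h * ω) + blockRadius c (h * ω)) / 3 - lowTaylor c (h * ω)) / h ^ 2 := by
    have : -2 + c ≠ 0 := by linarith
    rw [Qhat1_eq, lowTaylor]
    field_simp
  rw [hscale, abs_div, abs_of_pos (pow_pos hh 2), div_le_iff₀ (pow_pos hh 2)]
  refine (hC _ hθ).trans_eq ?_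
  rw [Even.pow_abs (by decide)]
  ring

theorem exists_Qhat2_expansion (hc : c < 2) :
    ∃ C : ℝ, 0 ≤ C ∧ ∀ h ω : ℝ, 0 < h → |h * ω| ≤ π →
      |Qhat2 c h ω - (32 * (-2 + c) / (3 * h ^ 2) - (-5 + 6 * c) * ω ^ 2 / 3
            + (-1 + 3 * c) * ω ^ 4 * h ^ 2 / 18)| ≤ C * ω ^ 6 * h ^ 4 := by
  obtain ⟨C, hC₀, hC⟩ := exists_high_expansion hc
  refine ⟨C, hC₀, fun h ω hh hθ => ?_⟩
  have hscale : Qhat2 c h ω - (32 * (-2 + c) / (3 * h ^ 2) - (-5 + 6 * c) * ω ^ 2 / 3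
            + (-1 + 3 * c) * ω ^ 4 * h ^ 2 / 18)
      = ((blockMean c (h * ω) - blockRadius c (h * ω)) / 3
        - (32 * (-2 + c) / 3 - (-5 + 6 * c) * (h * ω) ^ 2 / 3
          + (-1 + 3 * c) * (h * ω) ^ 4 / 18)) / h ^ 2 := by
    rw [Qhat2_eq]
    field_simp
  rw [hscale, abs_div, abs_of_pos (pow_pos hh 2), div_le_iff₀ (pow_pos hh 2)]
  refine (hC _ hθ).trans_eq ?_
  rw [Even.pow_abs (by decide)]
  ring

theorem exists_Qhat_expansion (hc : c < 2) :
    ∃ C : ℝ, ∀ (N : ℕ) [NeZero N] (ω : ℤ), |2 * ω| ≤ N →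
      |Qhat1 c (meshSize N) ω
          - (-(ω : ℝ) ^ 2 - (4 + 13 * c) * (ω : ℝ) ^ 6 * meshSize N ^ 4 / (2880 * (-2 + c)))|
        ≤ C * (ω : ℝ) ^ 8 * meshSize N ^ 6 ∧
      |Qhat2 c (meshSize N) ω
          - (32 * (-2 + c) / (3 * meshSize N ^ 2) - (-5 + 6 * c) * (ω : ℝ) ^ 2 / 3
            + (-1 + 3 * c) * (ω : ℝ) ^ 4 * meshSize N ^ 2 / 18)|
        ≤ C * (ω : ℝ) ^ 6 * meshSize N ^ 4 := by
  obtain ⟨C₁, -, hC₁⟩ := exists_Qhat1_expansion hc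
  obtain ⟨C₂, -, hC₂⟩ := exists_Qhat2_expansion hc
  refine ⟨max C₁ C₂, fun N _ ω hω => ?_⟩
  have hθ := abs_meshSize_mul_le hω
  have hpos := meshSize_pos N
  refine ⟨(hC₁ _ ω hpos hθ).trans ?_, (hC₂ _ ω hpos hθ).trans ?_⟩ <;> gcongr
  exacts [le_max_left _ _, le_max_right _ _]

theorem exists_abs_Qhat1_add_sq_le (hc : c < 2) :
    ∃ K : ℝ, 0 ≤ K ∧ ∀ h ω : ℝ, 0 < h → |h * ω| ≤ π →
      |Qhat1 c h ω + ω ^ 2| ≤ K * (h * ω) ^ 4 * ω ^ 2 := by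
  obtain ⟨C, hC₀, hC⟩ := exists_Qhat1_expansion hc
  let κ := (4 + 13 * c) / (2880 * (-2 + c))
  refine ⟨|κ| + C * π ^ 2, by positivity, fun h ω hh hθ => ?_⟩
  have hθ₂ : (h * ω) ^ 2 ≤ π ^ 2 := sq_le_sq' (neg_le_of_abs_le hθ) (le_of_abs_le hθ)
  calc |Qhat1 c h ω + ω ^ 2|
      = |(Qhat1 c h ω - (-ω ^ 2 - (4 + 13 * c) * ω ^ 6 * h ^ 4 / (2880 * (-2 + c))))
          - κ * ((h * ω) ^ 4 * ω ^ 2)| := by congr 1; ring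
    _ ≤ C * ω ^ 8 * h ^ 6 + |κ| * ((h * ω) ^ 4 * ω ^ 2) := by
        refine (abs_sub _ _).trans (add_le_add (hC h ω hh hθ) ?_)
        rw [abs_mul, abs_of_nonneg (by positivity : 0 ≤ (h * ω) ^ 4 * ω ^ 2)]
    _ = (|κ| + C * (h * ω) ^ 2) * (h * ω) ^ 4 * ω ^ 2 := by ring
    _ ≤ _ := by gcongr

theorem exists_exp_Qhat1_expansion (hc : c < 2) :
    ∃ C : ℝ, 0 ≤ C ∧ ∀ h ω t : ℝ, 0 < h → |h * ω| ≤ π → 0 ≤ t →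
      |exp (Qhat1 c h ω * t) - exp (-ω ^ 2 * t)
          * (1 - (4 + 13 * c) * ω ^ 6 * t * h ^ 4 / (2880 * (-2 + c)))|
        ≤ C * |h * ω| ^ 6 := by
  obtain ⟨δ, hδ₀, hδ₁, hδ⟩ := exists_Qhat1_le hc
  obtain ⟨C, hC₀, hC⟩ := exists_Qhat1_expansion hc
  obtain ⟨K, -, hK⟩ := exists_abs_Qhat1_add_sq_le hc
  refine ⟨K ^ 2 * π ^ 2 * (4 / δ ^ 2) + C * (1 / δ), by positivity, fun h ω t hh hθ ht => ?_⟩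
  let τ := ω ^ 2 * t
  let z := -((4 + 13 * c) * ω ^ 6 * t * h ^ 4 / (2880 * (-2 + c)))
  have hτ : 0 ≤ τ := by positivity
  have hθ₂ : (h * ω) ^ 2 ≤ π ^ 2 := sq_le_sq' (neg_le_of_abs_le hθ) (le_of_abs_le hθ)
  have hx : Qhat1 c h ω * t ≤ -(δ * τ) :=
    (mul_le_mul_of_nonneg_right (hδ h ω hh hθ) ht).trans_eq (by ring)
  have hy : -ω ^ 2 * t ≤ -(δ * τ) := by
    linarith [mul_le_mul_of_nonneg_right hδ₁ hτ]
  have hdist : (Qhat1 c h ω * t - -ω ^ 2 * t) ^ 2 ≤ (K * (h * ω) ^ 4 * τ) ^ 2 := by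
    refine sq_le_sq.2 (le_trans ?_ (le_abs_self _))
    rw [← sub_mul, abs_mul, abs_of_nonneg ht, sub_neg_eq_add, ← mul_assoc]
    exact mul_le_mul_of_nonneg_right (hK h ω hh hθ) ht
  have hlinear : |Qhat1 c h ω * t - -ω ^ 2 * t - z| ≤ C * (h * ω) ^ 6 * τ := by
    rw [show Qhat1 c h ω * t - -ω ^ 2 * t - z =
      (Qhat1 c h ω - (-ω ^ 2 - (4 + 13 * c) * ω ^ 6 * h ^ 4 / (2880 * (-2 + c)))) * t by ring,
      abs_mul, abs_of_nonneg ht]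
    exact (mul_le_mul_of_nonneg_right (hC h ω hh hθ) ht).trans_eq (by ring)
  rw [sub_eq_add_neg (1 : ℝ), Even.pow_abs (by decide)]
  calc |exp (Qhat1 c h ω * t) - exp (-ω ^ 2 * t) * (1 + z)|
      ≤ ((K * (h * ω) ^ 4 * τ) ^ 2 + C * (h * ω) ^ 6 * τ) * exp (-(δ * τ)) :=
        (abs_exp_sub_exp_mul_one_add_le hx hy z).trans (by gcongr)
    _ = K ^ 2 * (h * ω) ^ 2 * (τ ^ 2 * exp (-(δ * τ))) * (h * ω) ^ 6
          + C * (τ * exp (-(δ * τ))) * (h * ω) ^ 6 := by ring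
    _ ≤ K ^ 2 * π ^ 2 * (4 / δ ^ 2) * (h * ω) ^ 6 + C * (1 / δ) * (h * ω) ^ 6 := by
        gcongr
        exacts [sq_mul_exp_neg_le hδ₀ hτ, mul_exp_neg_le hδ₀ τ]
    _ = _ := (add_mul _ _ _).symm

theorem exists_abs_exp_Qhat1_sub_le (hc : c < 2) :
    ∃ C : ℝ, 0 ≤ C ∧ ∀ h ω t : ℝ, 0 < h → |h * ω| ≤ π → 0 ≤ t →
      |exp (Qhat1 c h ω * t) - exp (-ω ^ 2 * t)| ≤ C * |h * ω| ^ 4 := by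
  obtain ⟨δ, hδ₀, hδ₁, hδ⟩ := exists_Qhat1_le hc
  obtain ⟨K, hK₀, hK⟩ := exists_abs_Qhat1_add_sq_le hc
  refine ⟨K * (1 / δ), by positivity, fun h ω t hh hθ ht => ?_⟩
  have hx : Qhat1 c h ω * t ≤ -(δ * (ω ^ 2 * t)) :=
    (mul_le_mul_of_nonneg_right (hδ h ω hh hθ) ht).trans_eq (by ring)
  have hy : -ω ^ 2 * t ≤ -(δ * (ω ^ 2 * t)) := by
    linarith [mul_le_mul_of_nonneg_right hδ₁ (by positivity : 0 ≤ ω ^ 2 * t)]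
  rw [Even.pow_abs (by decide)]
  calc |exp (Qhat1 c h ω * t) - exp (-ω ^ 2 * t)|
      ≤ |Qhat1 c h ω * t - -ω ^ 2 * t| * exp (-(δ * (ω ^ 2 * t))) := abs_exp_sub_exp_le hx hy
    _ = |Qhat1 c h ω + ω ^ 2| * t * exp (-(δ * (ω ^ 2 * t))) := by
        rw [← sub_mul, abs_mul, abs_of_nonneg ht, sub_neg_eq_add]
    _ ≤ K * (h * ω) ^ 4 * ω ^ 2 * t * exp (-(δ * (ω ^ 2 * t))) := by
        gcongr
        exact hK h ω hh hθ
    _ = K * (ω ^ 2 * t * exp (-(δ * (ω ^ 2 * t)))) * (h * ω) ^ 4 := by ring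
    _ ≤ K * (1 / δ) * (h * ω) ^ 4 := by
        gcongr
        exact mul_exp_neg_le hδ₀ _

end Eigenvalues

section AmplitudeBounds

variable {c : ℝ}

theorem abs_exp_Qhat1_sub_exp_Qhat2_le_one (hc : c < 2) (h ω : ℝ) {t : ℝ} (ht : 0 ≤ t) :
    |exp (Qhat1 c h ω * t) - exp (Qhat2 c h ω * t)| ≤ 1 := by
  have hle : exp (Qhat2 c h ω * t) ≤ exp (Qhat1 c h ω * t) :=
    Real.exp_le_exp.2 (mul_le_mul_of_nonneg_right (Qhat2_le_Qhat1 c h ω) ht)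
  have hone : exp (Qhat1 c h ω * t) ≤ 1 :=
    Real.exp_le_one_iff.2 (mul_nonpos_of_nonpos_of_nonneg (Qhat1_nonpos hc h ω) ht)
  rw [abs_of_nonneg (sub_nonneg.2 hle)]
  linarith [Real.exp_pos (Qhat2 c h ω * t)]

theorem abs_mul_exp_Qhat1_sub_exp_Qhat2_le (hc : c < 2) (h ω : ℝ) {t x B : ℝ} (ht : 0 ≤ t)
    (hx : |x| ≤ B) : |x * (exp (Qhat1 c h ω * t) - exp (Qhat2 c h ω * t))| ≤ B := by
  rw [abs_mul]
  exact (mul_le_of_le_one_right (abs_nonneg x)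
    (abs_exp_Qhat1_sub_exp_Qhat2_le_one hc h ω ht)).trans hx

theorem exists_abs_upRatio_le (hc : c < 2) :
    ∃ C : ℝ, 0 ≤ C ∧ ∀ θ : ℝ, |θ| ≤ π → |upRatio c θ| ≤ C * |θ| ^ 5 := by
  obtain ⟨C, hC₀, hC⟩ := exists_upRatio_expansion hc
  refine ⟨C * π + |c / (1024 * (-2 + c))|, by positivity, fun θ hθ => ?_⟩
  calc |upRatio c θ|
      = |(upRatio c θ - -(c * |θ| ^ 5 / (1024 * (-2 + c))))
          - c / (1024 * (-2 + c)) * |θ| ^ 5| := by congr 1; ring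
    _ ≤ C * |θ| ^ (5 + 1) + |c / (1024 * (-2 + c))| * |θ| ^ 5 := by
        refine (abs_sub _ _).trans (add_le_add (hC θ hθ) ?_)
        rw [abs_mul, abs_pow, abs_abs]
    _ ≤ C * (π ^ 1 * |θ| ^ 5) + |c / (1024 * (-2 + c))| * |θ| ^ 5 := by
        gcongr
        exact pow_add_le_mul_pow (abs_nonneg θ) hθ 5 1
    _ = _ := by ring

theorem exists_ampLowLow_expansion (hc : c < 2) :
    ∃ C : ℝ, 0 ≤ C ∧ ∀ h ω t : ℝ, 0 < h → |h * ω| ≤ π → 0 ≤ t →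
      |ampLowLow c h ω t - exp (-ω ^ 2 * t)
          * (1 - (4 + 13 * c) * ω ^ 6 * t * h ^ 4 / (2880 * (-2 + c)))|
        ≤ C * |h * ω| ^ 6 := by
  obtain ⟨C₁, hC₁₀, hexp⟩ := exists_exp_Qhat1_expansion hc
  obtain ⟨C₂, hC₂₀, hdefect⟩ := exists_abs_blockDefect_le hc
  refine ⟨C₁ + C₂, by positivity, fun h ω t hh hθ ht => ?_⟩
  rw [ampLowLow, sub_right_comm, add_mul C₁ C₂]
  exact (abs_sub _ _).trans (add_le_add (hexp h ω t hh hθ ht)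
    (abs_mul_exp_Qhat1_sub_exp_Qhat2_le hc h ω ht (hdefect _ hθ)))

theorem exists_ampLowHigh_expansion (hc : c < 2) :
    ∃ C : ℝ, 0 ≤ C ∧ ∀ h ω t : ℝ, 0 < h → |h * ω| ≤ π → 0 ≤ t →
      |ampLowHigh c h ω t - -(c * |h * ω| ^ 5 / (1024 * (-2 + c)))
          * (exp (-ω ^ 2 * t) - exp (Qhat2 c h ω * t))|
        ≤ C * |h * ω| ^ 6 := by
  obtain ⟨C₁, hC₁₀, hexp⟩ := exists_abs_exp_Qhat1_sub_le hc
  obtain ⟨C₂, hC₂₀, hup⟩ := exists_upRatio_expansion hc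
  let ρ := -(c / (1024 * (-2 + c)))
  refine ⟨C₂ + |ρ| * C₁ * π ^ 3, by positivity, fun h ω t hh hθ ht => ?_⟩
  calc |ampLowHigh c h ω t - -(c * |h * ω| ^ 5 / (1024 * (-2 + c)))
          * (exp (-ω ^ 2 * t) - exp (Qhat2 c h ω * t))|
      = |(upRatio c (h * ω) - -(c * |h * ω| ^ 5 / (1024 * (-2 + c))))
            * (exp (Qhat1 c h ω * t) - exp (Qhat2 c h ω * t))
          + ρ * (|h * ω| ^ 5 * (exp (Qhat1 c h ω * t) - exp (-ω ^ 2 * t)))| := by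
        rw [ampLowHigh]
        congr 1
        ring
    _ ≤ C₂ * |h * ω| ^ 6 + |ρ| * (|h * ω| ^ 5 * (C₁ * |h * ω| ^ 4)) := by
        refine (abs_add_le _ _).trans (add_le_add
          (abs_mul_exp_Qhat1_sub_exp_Qhat2_le hc h ω ht (hup _ hθ)) ?_)
        rw [abs_mul, abs_mul, abs_pow, abs_abs]
        gcongr
        exact hexp h ω t hh hθ ht
    _ = C₂ * |h * ω| ^ 6 + |ρ| * C₁ * |h * ω| ^ (6 + 3) := by ring
    _ ≤ C₂ * |h * ω| ^ 6 + |ρ| * C₁ * (π ^ 3 * |h * ω| ^ 6) := by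
        gcongr
        exact pow_add_le_mul_pow (abs_nonneg _) hθ 6 3
    _ = _ := by ring

/-- The solution started from a low mode `exp (iωx)` differs from the exact heat flow
`exp (-ω² t) exp (iωx)` by amplitudes of order `(|ω| h)ⁿ`, uniformly in time. -/
def HasAmplitudeOrder (c : ℝ) (n : ℕ) : Prop :=
  ∃ C : ℝ, 0 ≤ C ∧ ∀ h ω t : ℝ, 0 < h → |h * ω| ≤ π → 0 ≤ t →
    |exp (-ω ^ 2 * t) - ampLowLow c h ω t| + |ampLowHigh c h ω t| ≤ C * |h * ω| ^ n

theorem hasAmplitudeOrder_four (hc : c < 2) : HasAmplitudeOrder c 4 := by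
  obtain ⟨C₁, hC₁₀, hexp⟩ := exists_abs_exp_Qhat1_sub_le hc
  obtain ⟨C₂, hC₂₀, hdefect⟩ := exists_abs_blockDefect_le hc
  obtain ⟨C₃, hC₃₀, hup⟩ := exists_abs_upRatio_le hc
  refine ⟨C₁ + C₂ * π ^ 2 + C₃ * π ^ 1, by positivity, fun h ω t hh hθ ht => ?_⟩
  have hlow : |exp (-ω ^ 2 * t) - ampLowLow c h ω t| ≤
      C₁ * |h * ω| ^ 4 + C₂ * |h * ω| ^ (4 + 2) := by
    rw [ampLowLow, abs_sub_comm, sub_right_comm]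
    exact (abs_sub _ _).trans (add_le_add (hexp h ω t hh hθ ht)
      (abs_mul_exp_Qhat1_sub_exp_Qhat2_le hc h ω ht (hdefect _ hθ)))
  have hhigh : |ampLowHigh c h ω t| ≤ C₃ * |h * ω| ^ (4 + 1) :=
    abs_mul_exp_Qhat1_sub_exp_Qhat2_le hc h ω ht (hup _ hθ)
  have hsix := mul_le_mul_of_nonneg_left (pow_add_le_mul_pow (abs_nonneg (h * ω)) hθ 4 2) hC₂₀
  have hfive := mul_le_mul_of_nonneg_left (pow_add_le_mul_pow (abs_nonneg (h * ω)) hθ 4 1) hC₃₀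
  linarith

theorem hasAmplitudeOrder_five (hc : c = -4 / 13) : HasAmplitudeOrder c 5 := by
  have hc₂ : c < 2 := hc.trans_lt (by norm_num)
  obtain ⟨C₁, hC₁₀, hlow⟩ := exists_ampLowLow_expansion hc₂
  obtain ⟨C₂, hC₂₀, hup⟩ := exists_abs_upRatio_le hc₂
  refine ⟨C₁ * π ^ 1 + C₂, by positivity, fun h ω t hh hθ ht => ?_⟩
  have hlow' : |exp (-ω ^ 2 * t) - ampLowLow c h ω t| ≤ C₁ * |h * ω| ^ (5 + 1) := by
    have hzero : 4 + 13 * c = 0 := by rw [hc]; norm_num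
    simpa only [hzero, zero_mul, zero_div, sub_zero, mul_one, abs_sub_comm] using
      hlow h ω t hh hθ ht
  have hhigh : |ampLowHigh c h ω t| ≤ C₂ * |h * ω| ^ 5 :=
    abs_mul_exp_Qhat1_sub_exp_Qhat2_le hc₂ h ω ht (hup _ hθ)
  have hsix := mul_le_mul_of_nonneg_left (pow_add_le_mul_pow (abs_nonneg (h * ω)) hθ 5 1) hC₁₀
  linarith

theorem abs_exp_Qhat1_le_one (hc : c < 2) (h ω : ℝ) {t : ℝ} (ht : 0 ≤ t) :
    |exp (Qhat1 c h ω * t)| ≤ 1 := by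
  rw [Real.abs_exp]
  exact Real.exp_le_one_iff.2 (mul_nonpos_of_nonpos_of_nonneg (Qhat1_nonpos hc h ω) ht)

theorem abs_blockDefect_le_half (hc : c < 2) {θ : ℝ} (hθ : |θ| ≤ π) :
    |blockDefect c θ| ≤ 1 / 2 := by
  rw [abs_of_nonneg (blockDefect_nonneg c θ)]
  exact blockDefect_le_half hc hθ

theorem exists_amp_bound (hc : c < 2) :
    ∃ K : ℝ, ∀ h ω t : ℝ, |h * ω| ≤ π → 0 ≤ t →
      |ampLowLow c h ω t| + |ampLowHigh c h ω t| ≤ K ∧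
      |ampHighLow c h ω t| + |ampHighHigh c h ω t| ≤ K := by
  obtain ⟨K, hK⟩ := exists_abs_downRatio_le hc
  refine ⟨2 + |K|, fun h ω t hθ ht => ?_⟩
  have hdiff {x B : ℝ} := abs_mul_exp_Qhat1_sub_exp_Qhat2_le hc h ω (x := x) (B := B) ht
  have hfirst := abs_exp_Qhat1_le_one hc h ω ht
  have hsecond : |exp (Qhat2 c h ω * t)| ≤ 1 := by
    rw [Real.abs_exp] at hfirst ⊢
    exact (Real.exp_le_exp.2
      (mul_le_mul_of_nonneg_right (Qhat2_le_Qhat1 c h ω) ht)).trans hfirst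
  have hdefect := hdiff (abs_blockDefect_le_half hc hθ)
  constructor
  · have hhigh : |ampLowHigh c h ω t| ≤ 1 / 2 := hdiff (abs_upRatio_le_half hθ)
    have hlow := (abs_sub _ _).trans (add_le_add hfirst hdefect)
    rw [ampLowLow]
    linarith [abs_nonneg K]
  · have hlow : |ampHighLow c h ω t| ≤ |K| := hdiff ((hK _ hθ).trans (le_abs_self K))
    have hhigh := (abs_add_le _ _).trans (add_le_add hsecond hdefect)
    rw [ampHighHigh]
    linarith

end AmplitudeBounds

/-! ### The explicit eigenvectors -/

section EigenSystem

variable (c h ω : ℝ)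

/-- The constant coefficient of the quadratic equation `D ρ² + 2 R ρ = A` whose roots are
`r₁ / i` and `r₂ / i`; its leading coefficient `D` is `rDen`. -/
def rConst : ℝ := 32 * c * sin (ω * h / 4) ^ 5 * cos (ω * h / 4)

theorem Omega_eq_blockGap : Omega c h ω = -blockGap c (h * ω) / rDen c h ω := by
  rw [Omega, blockGap_eq, mul_comm ω h]
  ring

theorem r1_eq_blockRadius :
    r1 c h ω = (((blockRadius c (h * ω) - blockGap c (h * ω)) / rDen c h ω : ℝ) : ℂ) * I := by
  rw [r1, Omega_eq_blockGap, Delta_eq_blockRadius, ← add_div, neg_add_eq_sub]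

theorem r2_eq_blockRadius :
    r2 c h ω = (((-blockRadius c (h * ω) - blockGap c (h * ω)) / rDen c h ω : ℝ) : ℂ) * I := by
  rw [r2, Omega_eq_blockGap, Delta_eq_blockRadius, ← sub_div, neg_sub_comm]

theorem blockRadius_sq_eq_rConst_mul_rDen :
    blockRadius c (h * ω) ^ 2 = blockGap c (h * ω) ^ 2 + rConst c h ω * rDen c h ω := by
  have habs : |sin (h * ω / 4)| ^ 6 = sin (h * ω / 4) ^ 6 := Even.pow_abs ⟨3, rfl⟩ _
  rw [blockRadius_sq, blockUp, blockDown, rConst, rDen, mul_comm ω h]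
  linear_combination 1024 * c ^ 2 * cos (h * ω / 4) ^ 6 * habs

theorem mu1_eq_block : mu1 c h ω = 1 / (3 * (h : ℂ) ^ 2) *
    (blockMean c (h * ω) + blockGap c (h * ω) - rConst c h ω * I) := by
  rw [mu1, blockMean, blockGap, rConst, mul_comm ω h, mul_assoc 3 h ω]
  push_cast
  ring

theorem mu2_eq_block : mu2 c h ω = 1 / (3 * (h : ℂ) ^ 2) *
    (blockMean c (h * ω) + blockGap c (h * ω) + rConst c h ω * I) := by
  rw [mu2, blockMean, blockGap, rConst, mul_comm ω h, mul_assoc 3 h ω]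
  push_cast
  ring

theorem sigma1_eq_block : sigma1 c h ω = 1 / (3 * (h : ℂ) ^ 2) *
    (blockMean c (h * ω) - blockGap c (h * ω) + rDen c h ω * I) := by
  rw [sigma1, blockMean, blockGap, rDen, mul_comm ω h, mul_assoc 3 h ω]
  push_cast
  ring

theorem sigma2_eq_block : sigma2 c h ω = 1 / (3 * (h : ℂ) ^ 2) *
    (blockMean c (h * ω) - blockGap c (h * ω) - rDen c h ω * I) := by
  rw [sigma2, blockMean, blockGap, rDen, mul_comm ω h, mul_assoc 3 h ω]
  push_cast
  ring

variable {c h ω}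

theorem rConst_eq_mul_div (hD : rDen c h ω ≠ 0) {s : ℝ} (hs : s ^ 2 = blockRadius c (h * ω) ^ 2) :
    rConst c h ω = (blockGap c (h * ω) + s) * ((s - blockGap c (h * ω)) / rDen c h ω) := by
  rw [blockRadius_sq_eq_rConst_mul_rDen] at hs
  rw [← mul_div_assoc, eq_div_iff hD]
  linear_combination -hs

theorem symbol_eigen_system (hD : rDen c h ω ≠ 0) {s : ℝ}
    (hs : s ^ 2 = blockRadius c (h * ω) ^ 2) {r : ℂ}
    (hr : r = (((s - blockGap c (h * ω)) / rDen c h ω : ℝ) : ℂ) * I) :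
    mu1 c h ω - sigma1 c h ω * r
        = (((blockMean c (h * ω) + s) / (3 * h ^ 2) : ℝ) : ℂ) * (1 - r) ∧
      mu2 c h ω + sigma2 c h ω * r
        = (((blockMean c (h * ω) + s) / (3 * h ^ 2) : ℝ) : ℂ) * (1 + r) := by
  let ρ : ℝ := (s - blockGap c (h * ω)) / rDen c h ω
  have hρ : (ρ : ℂ) * rDen c h ω = s - blockGap c (h * ω) := by
    exact_mod_cast div_mul_cancel₀ _ hD
  have hconst : (rConst c h ω : ℂ) = (blockGap c (h * ω) + s) * ρ := by
    exact_mod_cast rConst_eq_mul_div hD hs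
  obtain rfl : r = ρ * I := hr
  rw [mu1_eq_block, mu2_eq_block, sigma1_eq_block, sigma2_eq_block, hconst]
  push_cast
  constructor <;>
  linear_combination (1 / (3 * (h : ℂ) ^ 2)) * hρ
    - (1 / (3 * (h : ℂ) ^ 2)) * rDen c h ω * ρ * Complex.I_mul_I

end EigenSystem

section Eigenvectors

variable {c : ℝ} {N : ℕ} [NeZero N] {ω : ℤ}

theorem rDen_ne_zero (hc₀ : c ≠ 0) (hω : |2 * ω| ≤ N) (hω₀ : ω ≠ 0) :
    rDen c (meshSize N) ω ≠ 0 := by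
  obtain ⟨hlow, hhigh⟩ := abs_le.1 (abs_meshSize_mul_le hω)
  have hθ₀ : (ω : ℝ) * meshSize N / 4 ≠ 0 :=
    div_ne_zero (mul_ne_zero (Int.cast_ne_zero.2 hω₀) (meshSize_ne_zero N)) four_ne_zero
  have hsin : sin (ω * meshSize N / 4) ≠ 0 := fun hsin =>
    hθ₀ ((Real.sin_eq_zero_iff_of_lt_of_lt (by linarith [Real.pi_pos])
      (by linarith [Real.pi_pos])).1 hsin)
  have hcos : cos (ω * meshSize N / 4) ≠ 0 := (Real.cos_pos_of_mem_Ioo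
    ⟨by linarith [Real.pi_pos], by linarith [Real.pi_pos]⟩).ne'
  exact mul_ne_zero (mul_ne_zero (mul_ne_zero (by norm_num) hc₀) hsin) (pow_ne_zero 5 hcos)

theorem r_eigen_system (hc₀ : c ≠ 0) (hω : |2 * ω| ≤ N) (hω₀ : ω ≠ 0) :
    ∀ rq ∈ ({(r1 c (meshSize N) ω, Qhat1 c (meshSize N) ω),
        (r2 c (meshSize N) ω, Qhat2 c (meshSize N) ω)} : Set (ℂ × ℝ)),
      mu1 c (meshSize N) ω - sigma1 c (meshSize N) ω * rq.1 = (rq.2 : ℂ) * (1 - rq.1) ∧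
      mu2 c (meshSize N) ω + sigma2 c (meshSize N) ω * rq.1 = (rq.2 : ℂ) * (1 + rq.1) := by
  have hD := rDen_ne_zero hc₀ hω hω₀
  rintro _ (rfl | rfl)
  · rw [Qhat1_eq]
    exact symbol_eigen_system hD rfl (r1_eq_blockRadius _ _ _)
  · rw [Qhat2_eq, sub_eq_add_neg]
    exact symbol_eigen_system hD (neg_sq _) (r2_eq_blockRadius _ _ _)

theorem r2_ne_zero (hc : c < 2) (hc₀ : c ≠ 0) (hω : |2 * ω| ≤ N) (hω₀ : ω ≠ 0) :
    r2 c (meshSize N) ω ≠ 0 := by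
  have hradius := blockRadius_pos hc hc₀ (meshSize N * ω)
  have hgap := blockGap_nonneg hc (abs_meshSize_mul_le hω)
  rw [r2_eq_blockRadius]
  exact mul_ne_zero
    (Complex.ofReal_ne_zero.2 (div_ne_zero (by linarith) (rDen_ne_zero hc₀ hω hω₀)))
    Complex.I_ne_zero

theorem r1_ne_r2 (hc : c < 2) (hc₀ : c ≠ 0) (hω : |2 * ω| ≤ N) (hω₀ : ω ≠ 0) :
    r1 c (meshSize N) ω ≠ r2 c (meshSize N) ω := by
  have hradius := blockRadius_pos hc hc₀ (meshSize N * ω)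
  rw [r1_eq_blockRadius, r2_eq_blockRadius, Ne, mul_left_inj' Complex.I_ne_zero,
    Complex.ofReal_inj, div_left_inj' (rDen_ne_zero hc₀ hω hω₀)]
  linarith

theorem sign_eq_aliasSign (hω₀ : ω ≠ 0) : (ω.sign : ℝ) = aliasSign ω := by
  rcases lt_or_gt_of_ne hω₀ with hneg | hpos
  · simp [aliasSign, Int.sign_eq_neg_one_of_neg hneg, hneg.not_gt]
  · simp [aliasSign, Int.sign_eq_one_of_pos hpos, hpos]

theorem norm_sign (hω₀ : ω ≠ 0) : ‖(ω.sign : ℂ)‖ = 1 := by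
  rw [Complex.norm_intCast, sign_eq_aliasSign hω₀]
  rcases aliasSign_eq_or ω with hsign | hsign <;> simp [hsign]

theorem blockDown_eq_aliasSign_mul_rDen (c : ℝ) (hω : |2 * ω| ≤ N) :
    blockDown c (meshSize N * ω) = aliasSign ω * rDen c (meshSize N) ω := by
  rw [blockDown, rDen, ← aliasSign_mul_sin hω, mul_comm (ω : ℝ)]
  ring

theorem blockUp_eq_aliasSign_mul_rConst (c : ℝ) (hω : |2 * ω| ≤ N) :
    blockUp c (meshSize N * ω) = aliasSign ω * rConst c (meshSize N) ω := by
  rw [blockUp, rConst, ← aliasSign_mul_sin hω, mul_comm (ω : ℝ)]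
  linear_combination 32 * c * sin (meshSize N * ω / 4) ^ 5 * cos (meshSize N * ω / 4)
    * (aliasSign ω ^ 3 + aliasSign ω) * aliasSign_mul_self ω

theorem block_eigenvector_equations (hD : rDen c (meshSize N) ω ≠ 0) (hω : |2 * ω| ≤ N)
    (hω₀ : ω ≠ 0) {s : ℝ} (hs : s ^ 2 = blockRadius c (meshSize N * ω) ^ 2) {r a b : ℂ}
    (hr : r = (((s - blockGap c (meshSize N * ω)) / rDen c (meshSize N) ω : ℝ) : ℂ) * I)
    (hb : b = -I * ω.sign * r * a) :
    a * blockGap c (meshSize N * ω) + b * blockDown c (meshSize N * ω) = s * a ∧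
      a * blockUp c (meshSize N * ω) - b * blockGap c (meshSize N * ω) = s * b := by
  let ρ : ℝ := (s - blockGap c (meshSize N * ω)) / rDen c (meshSize N) ω
  have hρ : (ρ : ℂ) * rDen c (meshSize N) ω = s - blockGap c (meshSize N * ω) := by
    exact_mod_cast div_mul_cancel₀ _ hD
  have hconst : (rConst c (meshSize N) ω : ℂ) = (blockGap c (meshSize N * ω) + s) * ρ := by
    exact_mod_cast rConst_eq_mul_div hD hs
  have hsign : (ω.sign : ℂ) = aliasSign ω := by exact_mod_cast sign_eq_aliasSign hω₀
  have hsq : (aliasSign ω : ℂ) * aliasSign ω = 1 := by exact_mod_cast aliasSign_mul_self ω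
  obtain rfl : r = ρ * I := hr
  obtain rfl : b = aliasSign ω * ρ * a := by
    rw [hb, hsign]
    linear_combination (-aliasSign ω * ρ * a : ℂ) * Complex.I_mul_I
  rw [blockDown_eq_aliasSign_mul_rDen c hω, blockUp_eq_aliasSign_mul_rConst c hω]
  push_cast
  constructor
  · linear_combination (ρ * a * rDen c (meshSize N) ω : ℂ) * hsq + a * hρ
  · linear_combination (a * aliasSign ω : ℂ) * hconst

section Coefficients

variable {h : ℝ}

theorem ofReal_sqrt_one_add_norm_sq_ne_zero (r : ℂ) : (sqrt (1 + ‖r‖ ^ 2) : ℂ) ≠ 0 :=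
  Complex.ofReal_ne_zero.2 (Real.sqrt_ne_zero'.2 (by positivity))

theorem coeff1_fst_ne_zero (hcoupled : ¬(c = 0 ∨ ω = 0)) : (coeff1 c h ω).1 ≠ 0 := by
  rw [coeff1, if_neg hcoupled]
  exact one_div_ne_zero (ofReal_sqrt_one_add_norm_sq_ne_zero _)

theorem coeff2_fst_ne_zero (hcoupled : ¬(c = 0 ∨ ω = 0)) (hr : r2 c h ω ≠ 0) :
    (coeff2 c h ω).1 ≠ 0 := by
  rw [coeff2, if_neg hcoupled]
  exact div_ne_zero (div_ne_zero (Complex.ofReal_ne_zero.2 (norm_ne_zero_iff.2 hr)) hr)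
    (ofReal_sqrt_one_add_norm_sq_ne_zero _)

theorem coeff1_snd (hcoupled : ¬(c = 0 ∨ ω = 0)) :
    (coeff1 c h ω).2 = -I * ω.sign * r1 c h ω * (coeff1 c h ω).1 := by
  rw [coeff1, if_neg hcoupled]
  ring

theorem coeff2_snd (hcoupled : ¬(c = 0 ∨ ω = 0)) (hr : r2 c h ω ≠ 0) :
    (coeff2 c h ω).2 = -I * ω.sign * r2 c h ω * (coeff2 c h ω).1 := by
  rw [coeff2, if_neg hcoupled]
  field_simp

theorem norm_sq_coeff1 (c h : ℝ) (ω : ℤ) :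
    ‖(coeff1 c h ω).1‖ ^ 2 + ‖(coeff1 c h ω).2‖ ^ 2 = 1 := by
  unfold coeff1
  split_ifs with hcoupled
  · simp
  · have hpos : 0 < 1 + ‖r1 c h ω‖ ^ 2 := by positivity
    simp only [norm_div, norm_mul, norm_neg, Complex.norm_I, norm_one,
      norm_sign (not_or.1 hcoupled).2, Complex.norm_real, Real.norm_eq_abs,
      abs_of_nonneg (Real.sqrt_nonneg _), div_pow, one_mul, one_pow, Real.sq_sqrt hpos.le]
    rw [← add_div, div_self hpos.ne']

end Coefficients

theorem norm_sq_coeff2 (hc : c < 2) (hω : |2 * ω| ≤ N) :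
    ‖(coeff2 c (meshSize N) ω).1‖ ^ 2 + ‖(coeff2 c (meshSize N) ω).2‖ ^ 2 = 1 := by
  unfold coeff2
  split_ifs with hcoupled
  · simp
  · obtain ⟨hc₀, hω₀⟩ := not_or.1 hcoupled
    have hr := norm_ne_zero_iff.2 (r2_ne_zero hc hc₀ hω hω₀)
    have hpos : 0 < 1 + ‖r2 c (meshSize N) ω‖ ^ 2 := by positivity
    simp only [norm_div, norm_mul, norm_neg, Complex.norm_I, norm_sign hω₀, Complex.norm_real,
      Real.norm_eq_abs, abs_of_nonneg (Real.sqrt_nonneg _), div_pow, one_mul,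
      Real.sq_sqrt hpos.le, abs_norm]
    rw [← add_div, div_self (pow_ne_zero 2 hr), div_self hpos.ne']

theorem coeff_det_ne_zero (hc : c < 2) (hω : |2 * ω| ≤ N) :
    (coeff1 c (meshSize N) ω).1 * (coeff2 c (meshSize N) ω).2
      - (coeff2 c (meshSize N) ω).1 * (coeff1 c (meshSize N) ω).2 ≠ 0 := by
  by_cases hcoupled : c = 0 ∨ ω = 0
  · simp [coeff1, coeff2, hcoupled]
  · obtain ⟨hc₀, hω₀⟩ := not_or.1 hcoupled
    have hr₂ := r2_ne_zero hc hc₀ hω hω₀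
    have hsign : (ω.sign : ℂ) ≠ 0 := norm_ne_zero_iff.1 (by rw [norm_sign hω₀]; exact one_ne_zero)
    rw [coeff1_snd hcoupled, coeff2_snd hcoupled hr₂]
    convert mul_ne_zero
      (mul_ne_zero (coeff1_fst_ne_zero (h := meshSize N) hcoupled)
        (coeff2_fst_ne_zero hcoupled hr₂))
      (mul_ne_zero (mul_ne_zero Complex.I_ne_zero hsign)
        (sub_ne_zero.2 (r1_ne_r2 hc hc₀ hω hω₀))) using 1
    ring

theorem blockOp_psi_of_coupled (hc : c < 2) (hω : |2 * ω| ≤ N) (hcoupled : ¬(c = 0 ∨ ω = 0))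
    (k : Fin 2) : blockOp c N (psi c N ω k) = (Qhat c N ω k : ℂ) • psi c N ω k := by
  obtain ⟨hc₀, hω₀⟩ := not_or.1 hcoupled
  have hD := rDen_ne_zero hc₀ hω hω₀
  fin_cases k
  · obtain ⟨hlow, hhigh⟩ := block_eigenvector_equations hD hω hω₀ rfl (r1_eq_blockRadius _ _ _)
      (a := (coeff1 c (meshSize N) ω).1 / sqrt (2 * π))
      (b := (coeff1 c (meshSize N) ω).2 / sqrt (2 * π)) (by rw [coeff1_snd hcoupled]; ring)
    exact blockOp_combination_Qhat1 hω hlow hhigh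
  · obtain ⟨hlow, hhigh⟩ := block_eigenvector_equations hD hω hω₀
      (neg_sq (blockRadius c (meshSize N * ω))) (r2_eq_blockRadius _ _ _)
      (a := (coeff2 c (meshSize N) ω).1 / sqrt (2 * π))
      (b := (coeff2 c (meshSize N) ω).2 / sqrt (2 * π))
      (by rw [coeff2_snd hcoupled (r2_ne_zero hc hc₀ hω hω₀)]; ring)
    rw [Complex.ofReal_neg] at hlow hhigh
    exact blockOp_combination_Qhat2 hω hlow hhigh

theorem blockOp_psi_of_decoupled (hc : c < 2) (hω : |2 * ω| ≤ N) (hdecoupled : c = 0 ∨ ω = 0)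
    (k : Fin 2) : blockOp c N (psi c N ω k) = (Qhat c N ω k : ℂ) • psi c N ω k := by
  have hup : blockUp c (meshSize N * ω) = 0 := by
    rcases hdecoupled with hzero | hzero <;> simp [blockUp, hzero]
  have hdown : blockDown c (meshSize N * ω) = 0 := by
    rcases hdecoupled with hzero | hzero <;> simp [blockDown, hzero]
  have hradius : blockRadius c (meshSize N * ω) = blockGap c (meshSize N * ω) := by
    rw [blockRadius, hup, zero_mul, add_zero,
      Real.sqrt_sq (blockGap_nonneg hc (abs_meshSize_mul_le hω))]
  fin_cases k
  · simp only [psi, Qhat, coeff1, if_pos hdecoupled, if_true, Fin.zero_eta, combo]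
    exact blockOp_combination_Qhat1 hω (by rw [hdown, hradius]; push_cast; ring)
      (by rw [hup]; simp)
  · simp only [psi, Qhat, coeff2, if_pos hdecoupled, one_ne_zero, if_false, Fin.mk_one, combo]
    exact blockOp_combination_Qhat2 hω (by rw [hdown]; simp)
      (by rw [hup, hradius]; push_cast; ring)

theorem blockOp_psi (hc : c < 2) (hω : |2 * ω| ≤ N) (k : Fin 2) :
    blockOp c N (psi c N ω k) = (Qhat c N ω k : ℂ) • psi c N ω k := by
  by_cases hdecoupled : c = 0 ∨ ω = 0
  exacts [blockOp_psi_of_decoupled hc hω hdecoupled k, blockOp_psi_of_coupled hc hω hdecoupled k]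

end Eigenvectors

section Basis

theorem mem_and_mem_of_combinations_mem {K V : Type*} [Field K] [AddCommGroup V] [Module K V]
    (W : Submodule K V) {x y : V} {a₁ b₁ a₂ b₂ : K} (hdet : a₁ * b₂ - a₂ * b₁ ≠ 0)
    (h₁ : a₁ • x + b₁ • y ∈ W) (h₂ : a₂ • x + b₂ • y ∈ W) : x ∈ W ∧ y ∈ W := by
  rw [← W.smul_mem_iff hdet, ← W.smul_mem_iff hdet (x := y)]
  constructor
  · convert W.sub_mem (W.smul_mem b₂ h₁) (W.smul_mem b₁ h₂) using 1
    module
  · convert W.sub_mem (W.smul_mem a₁ h₂) (W.smul_mem a₂ h₁) using 1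
    module

variable {N : ℕ}

/-- The cyclic successor of a node. -/
def nextNode (p : ZMod N × Fin 2) : ZMod N × Fin 2 := if p.2 = 0 then (p.1, 1) else (p.1 + 1, 0)

/-- The frequencies resolved by the grid: each low frequency with its high frequency. -/
def gridFreq (p : LowFreq N × Fin 2) : ℤ := if p.2 = 0 then p.1 else highFreq N p.1

theorem gridFreq_injective : Function.Injective (gridFreq : LowFreq N × Fin 2 → ℤ) := by
  rintro ⟨⟨ω, hlow, hhigh⟩, k⟩ ⟨⟨ω', hlow', hhigh'⟩, k'⟩ heq
  fin_cases k <;> fin_cases k' <;>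
    simp only [gridFreq, highFreq, Fin.zero_eta, Fin.mk_one, if_true, one_ne_zero, if_false,
      Prod.mk.injEq, Subtype.mk.injEq, and_true, zero_ne_one, and_false] at heq ⊢ <;>
    grind

theorem abs_gridFreq_sub_lt (p q : LowFreq N × Fin 2) : |gridFreq p - gridFreq q| < 2 * N := by
  obtain ⟨⟨ω, hlow, hhigh⟩, k⟩ := p
  obtain ⟨⟨ω', hlow', hhigh'⟩, k'⟩ := q
  simp only [abs_lt, gridFreq, highFreq]
  split_ifs <;> omega

variable [NeZero N]

theorem mode_comp_nextNode (k : ℤ) :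
    LinearMap.funLeft ℂ ℂ nextNode (mode N k) = wave k (meshSize N / 2) • mode N k := by
  ext ⟨j, b⟩
  fin_cases b
  · simp [LinearMap.funLeft_apply, nextNode, mode, proj, node_right, wave_add, mul_comm]
  · simp only [LinearMap.funLeft_apply, nextNode, Fin.mk_one, one_ne_zero, if_false, mode,
      Pi.smul_apply, smul_eq_mul]
    rw [proj_add_one (wave_periodic k), proj, node_right, ← wave_add]
    ring_nf

theorem eq_of_wave_half_meshSize_eq {k l : ℤ} (hkl : |k - l| < 2 * N)
    (heq : wave k (meshSize N / 2) = wave l (meshSize N / 2)) : k = l := by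
  obtain ⟨n, hn⟩ := Complex.exp_eq_exp_iff_exists_int.1 heq
  have hangle : (k : ℝ) * (meshSize N / 2) = l * (meshSize N / 2) + n * (2 * π) := by
    have hcomplex : (k : ℂ) * (meshSize N / 2) = l * (meshSize N / 2) + n * (2 * π) := by
      apply mul_left_cancel₀ Complex.I_ne_zero
      push_cast at hn
      linear_combination hn
    exact_mod_cast hcomplex
  have hmul : k - l = n * (2 * N) := by
    have hreal : (k : ℝ) - l = n * (2 * N) := by
      apply mul_right_cancel₀ (meshSize_ne_zero N)
      linear_combination 2 * hangle - 2 * n * natCast_mul_meshSize N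
    exact_mod_cast hreal
  exact sub_eq_zero.1 (Int.eq_zero_of_abs_lt_dvd (Dvd.intro_left n hmul.symm) hkl)

theorem linearIndependent_mode_gridFreq :
    LinearIndependent ℂ fun p : LowFreq N × Fin 2 => mode N (gridFreq p) := by
  refine Module.End.eigenvectors_linearIndependent' (LinearMap.funLeft ℂ ℂ nextNode)
    (fun p => wave (gridFreq p) (meshSize N / 2))
    (fun p q heq => gridFreq_injective (eq_of_wave_half_meshSize_eq (abs_gridFreq_sub_lt p q) heq))
    _ fun p => Module.End.hasEigenvector_iff.2
      ⟨Module.End.mem_eigenspace_iff.2 (mode_comp_nextNode _), fun hzero => ?_⟩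
  simpa [hzero] using norm_mode N (gridFreq p) (0, 0)

variable (N) in
/-- The low frequencies as representatives of the residues modulo `N`, used to count them. -/
def lowFreqEquiv : ZMod N ≃ LowFreq N where
  toFun x := ⟨x.valMinAbs, by
    obtain ⟨hlow, hhigh⟩ := x.valMinAbs_mem_Ioc
    constructor <;> linarith⟩
  invFun ω := (ω.1 : ZMod N)
  left_inv x := x.coe_valMinAbs
  right_inv ω := Subtype.ext
    ((ZMod.valMinAbs_spec _ _).2 ⟨rfl, by constructor <;> linarith [ω.2.1, ω.2.2]⟩)

instance : Fintype (LowFreq N) := Fintype.ofEquiv _ (lowFreqEquiv N)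

theorem card_lowFreq_prod : Fintype.card (LowFreq N × Fin 2) = Module.finrank ℂ (Grid N) := by
  rw [Module.finrank_fintype_fun_eq_card, Fintype.card_prod, Fintype.card_prod,
    Fintype.card_congr (lowFreqEquiv N)]

variable {c : ℝ}

theorem span_psi_eq_top (hc : c < 2) :
    Submodule.span ℂ (Set.range fun p : LowFreq N × Fin 2 => psi c N p.1 p.2) = ⊤ := by
  rw [eq_top_iff,
    ← linearIndependent_mode_gridFreq.span_eq_top_of_card_eq_finrank' card_lowFreq_prod,
    Submodule.span_le]
  rintro _ ⟨⟨ω, k⟩, rfl⟩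
  have hω : |2 * ω.1| ≤ N := abs_le.2 ⟨ω.2.1.le, ω.2.2⟩
  have hpi : (sqrt (2 * π) : ℂ) ≠ 0 :=
    Complex.ofReal_ne_zero.2 (Real.sqrt_ne_zero'.2 Real.two_pi_pos)
  have hpsi (k : Fin 2) := Submodule.subset_span (R := ℂ)
    (Set.mem_range_self (f := fun p : LowFreq N × Fin 2 => psi c N p.1 p.2) (ω, k))
  obtain ⟨hlow, hhigh⟩ := mem_and_mem_of_combinations_mem _
    (by rw [div_mul_div_comm, div_mul_div_comm, ← sub_div]
        exact div_ne_zero (coeff_det_ne_zero hc hω) (mul_ne_zero hpi hpi)) (hpsi 0) (hpsi 1)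
  fin_cases k
  exacts [hlow, hhigh]

theorem linearIndependent_psi (hc : c < 2) :
    LinearIndependent ℂ fun p : LowFreq N × Fin 2 => psi c N p.1 p.2 :=
  linearIndependent_of_top_le_span_of_card_eq_finrank (span_psi_eq_top hc).ge card_lowFreq_prod

end Basis

section Norm

variable {N : ℕ} [NeZero N]

theorem gridNorm_eq_norm_toLp (v : Grid N) :
    gridNorm N v =
      sqrt (meshSize N / 2) * ‖(WithLp.toLp 2 v : EuclideanSpace ℂ (ZMod N × Fin 2))‖ := by
  rw [EuclideanSpace.norm_eq, gridNorm, Real.sqrt_mul (half_pos (meshSize_pos N)).le]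

theorem abs_gridNorm_sub_le (u v : Grid N) :
    |gridNorm N u - gridNorm N v| ≤ gridNorm N (u - v) := by
  rw [gridNorm_eq_norm_toLp, gridNorm_eq_norm_toLp, gridNorm_eq_norm_toLp, ← mul_sub, abs_mul,
    abs_of_nonneg (Real.sqrt_nonneg _), WithLp.toLp_sub]
  exact mul_le_mul_of_nonneg_left (abs_norm_sub_norm_le _ _) (Real.sqrt_nonneg _)

theorem gridNorm_mono {u v : Grid N} (h : ∀ p, ‖u p‖ ≤ ‖v p‖) : gridNorm N u ≤ gridNorm N v := by
  have := meshSize_pos N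
  unfold gridNorm
  gcongr with p
  exact h p

theorem gridNorm_of_norm_eq {v : Grid N} {B : ℝ} (hB : 0 ≤ B) (h : ∀ p, ‖v p‖ = B) :
    gridNorm N v = sqrt (2 * π) * B := by
  have hsum : meshSize N / 2 * ∑ p, ‖v p‖ ^ 2 = 2 * π * B ^ 2 := by
    simp only [h, Finset.sum_const, Finset.card_univ, Fintype.card_prod, ZMod.card,
      Fintype.card_fin, nsmul_eq_mul]
    push_cast
    linear_combination B ^ 2 * natCast_mul_meshSize N
  rw [gridNorm, hsum, Real.sqrt_mul Real.two_pi_pos.le, Real.sqrt_sq hB]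

theorem gridNorm_le {v : Grid N} {B : ℝ} (hB : 0 ≤ B) (h : ∀ p, ‖v p‖ ≤ B) :
    gridNorm N v ≤ sqrt (2 * π) * B := by
  have hconst : ∀ p : ZMod N × Fin 2, ‖(fun _ => (B : ℂ) : Grid N) p‖ = B := fun _ => by
    rw [Complex.norm_real, Real.norm_of_nonneg hB]
  rw [← gridNorm_of_norm_eq hB hconst]
  exact gridNorm_mono fun p => (h p).trans_eq (hconst p).symm

end Norm

section Taylor

variable {E : Type*} [NormedAddCommGroup E] [NormedSpace ℝ E] [CompleteSpace E]

theorem norm_sub_sum_taylor_le {f : ℝ → E} {n : ℕ} {M : ℝ} (hf : ContDiff ℝ (n + 1 : ℕ) f)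
    (hM : ∀ x, ‖iteratedDeriv (n + 1) f x‖ ≤ M) (x s : ℝ) :
    ‖f (x + s) - ∑ k ∈ Finset.range (n + 1), (s ^ k / k.factorial) • iteratedDeriv k f x‖ ≤
      M * |s| ^ (n + 1) := by
  rcases eq_or_ne s 0 with rfl | hs
  · simp [Finset.sum_range_succ']
  have huniq : UniqueDiffOn ℝ (uIcc x (x + s)) := uniqueDiffOn_uIcc (by simpa using hs)
  have hderiv : ∀ k ≤ n + 1, ∀ t ∈ uIcc x (x + s),
      iteratedDerivWithin k f (uIcc x (x + s)) t = iteratedDeriv k f t := fun k hk t ht =>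
    iteratedDerivWithin_eq_iteratedDeriv huniq (hf.contDiffAt.of_le (by exact_mod_cast hk)) ht
  have htaylor : taylorWithinEval f n (uIcc x (x + s)) x (x + s) =
      ∑ k ∈ Finset.range (n + 1), (s ^ k / k.factorial) • iteratedDeriv k f x := by
    rw [taylor_within_apply]
    refine Finset.sum_congr rfl fun k hk => ?_
    rw [hderiv k (Finset.mem_range.1 hk).le x left_mem_uIcc, add_sub_cancel_left, inv_mul_eq_div]
  have hintegrand : ∀ t ∈ uIoc x (x + s), ‖((x + s - t) ^ n / n.factorial) •
      iteratedDerivWithin (n + 1) f (uIcc x (x + s)) t‖ ≤ |s| ^ n * M := fun t ht => by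
    have hdist : |x + s - t| ≤ |s| := by
      simpa using abs_sub_right_of_mem_uIcc (uIoc_subset_uIcc ht)
    have hfactorial : (1 : ℝ) ≤ n.factorial := by exact_mod_cast n.factorial_pos
    rw [hderiv _ le_rfl t (uIoc_subset_uIcc ht), norm_smul, norm_div, norm_pow, Real.norm_natCast,
      Real.norm_eq_abs]
    gcongr
    · exact (div_le_self (by positivity) hfactorial).trans (by gcongr)
    · exact hM t
  have hremainder := intervalIntegral.norm_integral_le_of_norm_le_const hintegrand
  rw [← taylor_integral_remainder hf.contDiffOn, htaylor, add_sub_cancel_left] at hremainder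
  exact hremainder.trans_eq (by ring)

end Taylor

section Truncation

variable {w : ℝ → ℂ}

theorem periodic_iteratedDeriv {F : Type*} [NormedAddCommGroup F] [NormedSpace ℝ F] {f : ℝ → F}
    {T : ℝ} (hf : Function.Periodic f T) (n : ℕ) : Function.Periodic (iteratedDeriv n f) T := by
  intro x
  rw [← congrFun (iteratedDeriv_comp_add_const n f T) x, funext hf]

theorem exists_norm_iteratedDeriv_le {F : Type*} [NormedAddCommGroup F] [NormedSpace ℝ F]
    {f : ℝ → F} {n : ℕ} {T : ℝ} (hf : ContDiff ℝ n f) (hT : T ≠ 0) (hp : Function.Periodic f T) :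
    ∃ M, 0 ≤ M ∧ ∀ x, ‖iteratedDeriv n f x‖ ≤ M := by
  have hbounded := (periodic_iteratedDeriv hp n).isBounded_of_continuous hT
    (hf.continuous_iteratedDeriv n le_rfl)
  obtain ⟨M, hM⟩ := hbounded.exists_norm_le
  exact ⟨M, (norm_nonneg _).trans (hM _ (mem_range_self 0)), fun x => hM _ (mem_range_self x)⟩

theorem blockStencil_add (c h : ℝ) (v w : ℝ → ℂ) (x : ℝ) :
    blockStencil c h (v + w) x = blockStencil c h v x + blockStencil c h w x := by
  simp only [blockStencil, Pi.add_apply]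
  ring

theorem blockStencil_taylor (c : ℝ) {h : ℝ} (hh : h ≠ 0) (a : ℕ → ℂ) (x : ℝ) :
    blockStencil c h (fun y => ∑ k ∈ Finset.range 6, ((y - x) ^ k / k.factorial) • a k) x =
      a 2 - ((c * h ^ 3 / 96 : ℝ) : ℂ) * a 5 := by
  have hh' : (h : ℂ) ≠ 0 := by exact_mod_cast hh
  simp only [blockStencil, sub_sub_cancel_left, add_sub_cancel_left, sub_self,
    Finset.sum_range_succ, Finset.sum_range_zero, Nat.factorial, Complex.real_smul]
  push_cast
  field_simp
  ring

theorem norm_blockStencil_le (c : ℝ) {h B : ℝ} {r : ℝ → ℂ} {x : ℝ}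
    (hr : ∀ y, |y - x| ≤ 3 / 2 * |h| → ‖r y‖ ≤ B) :
    ‖blockStencil c h r x‖ ≤ (64 + 32 * |c|) * B / (3 * h ^ 2) := by
  have bound (y s : ℝ) (hy : y = x + s * h) (hs : |s| ≤ 3 / 2) : ‖r y‖ ≤ B :=
    hr y (by rw [hy, add_sub_cancel_left, abs_mul]; gcongr)
  have coeff (a : ℕ) [a.AtLeastTwo] {z : ℂ} (hz : ‖z‖ ≤ B) : ‖ofNat(a) * z‖ ≤ ofNat(a) * B :=
    norm_mul_le_of_le (Complex.norm_ofNat a).le hz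
  have hleft₂ := bound (x - h) (-1) (by ring) (by norm_num [abs_le])
  have hleft₁ := bound (x - h / 2) (-1 / 2) (by ring) (by norm_num [abs_le])
  have hcentre := bound x 0 (by ring) (by norm_num)
  have hright₁ := bound (x + h / 2) (1 / 2) (by ring) (by norm_num [abs_le])
  have hright₂ := bound (x + h) 1 (by ring) (by norm_num)
  have hright₃ := bound (x + 3 * h / 2) (3 / 2) (by ring) (by norm_num [abs_le])
  have hsecond := norm_sub_le_of_le (norm_add_le_of_le (norm_sub_le_of_le (norm_add_le_of_le
    ((norm_neg _).trans_le hleft₂) (coeff 16 hleft₁)) (coeff 30 hcentre)) (coeff 16 hright₁))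
    hright₂
  have hfifth := norm_sub_le_of_le (norm_add_le_of_le (norm_sub_le_of_le (norm_add_le_of_le
    (norm_sub_le_of_le hleft₂ (coeff 5 hleft₁)) (coeff 10 hcentre)) (coeff 10 hright₁))
    (coeff 5 hright₂)) hright₃
  have hc : ‖(c : ℂ)‖ = |c| := Complex.norm_real c
  have hfactor : ‖1 / (3 * (h : ℂ) ^ 2)‖ = 1 / (3 * h ^ 2) := by
    simp [Complex.norm_real]
  refine (norm_mul_le_of_le hfactor.le
    (norm_add_le_of_le hsecond (norm_mul_le_of_le hc.le hfifth))).trans_eq ?_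
  ring

theorem norm_iteratedDeriv_two_sub_blockStencil_le (c : ℝ) {h M : ℝ} (hh : h ≠ 0)
    (hw : ContDiff ℝ 6 w) (hM : ∀ x, ‖iteratedDeriv 6 w x‖ ≤ M) (x : ℝ) :
    ‖iteratedDeriv 2 w x - blockStencil c h w x -
        ((c * h ^ 3 / 96 : ℝ) : ℂ) * iteratedDeriv 5 w x‖ ≤
      (64 + 32 * |c|) * (M * (3 / 2) ^ 6) / 3 * h ^ 4 := by
  let P : ℝ → ℂ := fun y =>
    ∑ k ∈ Finset.range 6, ((y - x) ^ k / k.factorial) • iteratedDeriv k w x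
  have hremainder : ∀ y, |y - x| ≤ 3 / 2 * |h| → ‖(w - P) y‖ ≤ M * (3 / 2 * |h|) ^ 6 :=
    fun y hy => by
      have htaylor := norm_sub_sum_taylor_le (n := 5) hw hM x (y - x)
      rw [add_sub_cancel] at htaylor
      have hM₀ : 0 ≤ M := (norm_nonneg _).trans (hM x)
      exact htaylor.trans (by gcongr)
  have hsplit : iteratedDeriv 2 w x - blockStencil c h w x -
      ((c * h ^ 3 / 96 : ℝ) : ℂ) * iteratedDeriv 5 w x = -blockStencil c h (w - P) x := by
    rw [← sub_add_cancel w P, blockStencil_add, blockStencil_taylor c hh, sub_add_cancel]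
    ring
  rw [hsplit, norm_neg]
  refine (norm_blockStencil_le c hremainder).trans_eq ?_
  rw [mul_pow, Even.pow_abs ⟨3, rfl⟩]
  field_simp

/-- The sign of the leading truncation error at the node with the given index in its cell. -/
def nodeSign (b : Fin 2) : ℝ := if b = 0 then 1 else -1

theorem abs_nodeSign (b : Fin 2) : |nodeSign b| = 1 := by
  unfold nodeSign
  split_ifs <;> norm_num

theorem truncError_apply (c : ℝ) (hp : Function.Periodic w (2 * π)) {N : ℕ} [NeZero N]
    (p : ZMod N × Fin 2) :
    truncError c N w p = iteratedDeriv 2 w (node N p) -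
      blockStencil c (nodeSign p.2 * meshSize N) w (node N p) := by
  obtain ⟨j, b⟩ := p
  rw [truncError, Pi.sub_apply, proj]
  fin_cases b
  · simp [nodeSign, blockOp_proj_left c hp]
  · simp [nodeSign, blockOp_proj_right c hp]

theorem exists_truncError_expansion (c : ℝ) (hw : ContDiff ℝ 6 w)
    (hp : Function.Periodic w (2 * π)) :
    ∃ C, 0 ≤ C ∧ ∀ (N : ℕ) [NeZero N] (p : ZMod N × Fin 2),
      ‖truncError c N w p -
          ((nodeSign p.2 * (c * meshSize N ^ 3 / 96) : ℝ) : ℂ) * iteratedDeriv 5 w (node N p)‖ ≤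
        C * meshSize N ^ 4 := by
  obtain ⟨M, hM₀, hM⟩ := exists_norm_iteratedDeriv_le (n := 6) hw Real.two_pi_pos.ne' hp
  refine ⟨(64 + 32 * |c|) * (M * (3 / 2) ^ 6) / 3, by positivity, fun N _ p => ?_⟩
  have hsign : nodeSign p.2 ^ 2 = 1 := by rw [← sq_abs, abs_nodeSign, one_pow]
  have hne : nodeSign p.2 * meshSize N ≠ 0 :=
    mul_ne_zero (pow_ne_zero_iff two_ne_zero |>.1 (hsign ▸ one_ne_zero)) (meshSize_ne_zero N)
  have hstencil := norm_iteratedDeriv_two_sub_blockStencil_le c hne hw hM (node N p)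
  have hlead : c * (nodeSign p.2 * meshSize N) ^ 3 / 96 =
      nodeSign p.2 * (c * meshSize N ^ 3 / 96) := by
    linear_combination nodeSign p.2 * (c * meshSize N ^ 3 / 96) * hsign
  have hfour : (nodeSign p.2 * meshSize N) ^ 4 = meshSize N ^ 4 := by
    linear_combination (nodeSign p.2 ^ 2 + 1) * meshSize N ^ 4 * hsign
  rwa [← truncError_apply c hp, hlead, hfour] at hstencil

theorem norm_truncError_lead (c : ℝ) {N : ℕ} [NeZero N] (b : Fin 2) (z : ℂ) :
    ‖((nodeSign b * (c * meshSize N ^ 3 / 96) : ℝ) : ℂ) * z‖ =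
      |c| * ‖z‖ / 96 * meshSize N ^ 3 := by
  rw [norm_mul, Complex.norm_real, Real.norm_eq_abs, abs_mul, abs_nodeSign, one_mul, abs_div,
    abs_mul, abs_of_pos (pow_pos (meshSize_pos N) 3), abs_of_pos (by norm_num : (0 : ℝ) < 96)]
  ring

theorem exists_gridNorm_truncError_le (c : ℝ) (hw : ContDiff ℝ 6 w)
    (hp : Function.Periodic w (2 * π)) :
    ∃ C, ∀ (N : ℕ) [NeZero N], gridNorm N (truncError c N w) ≤ C * meshSize N ^ 3 := by
  obtain ⟨C, hC₀, hC⟩ := exists_truncError_expansion c hw hp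
  obtain ⟨M, hM₀, hM⟩ := exists_norm_iteratedDeriv_le (n := 5)
    (hw.of_le (by norm_num)) Real.two_pi_pos.ne' hp
  refine ⟨sqrt (2 * π) * (C * (2 * π) + |c| * M / 96), fun N _ => ?_⟩
  have hpos := meshSize_pos N
  rw [mul_assoc]
  refine gridNorm_le (by positivity) fun p => ?_
  have hremainder : C * meshSize N ^ 4 ≤ C * (2 * π) * meshSize N ^ 3 := by
    rw [pow_succ' (meshSize N) 3, ← mul_assoc]
    gcongr
    exact meshSize_le N
  have hlead : ‖((nodeSign p.2 * (c * meshSize N ^ 3 / 96) : ℝ) : ℂ) *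
      iteratedDeriv 5 w (node N p)‖ ≤ |c| * M / 96 * meshSize N ^ 3 := by
    rw [norm_truncError_lead]
    gcongr
    exact hM _
  rw [add_mul]
  exact norm_le_norm_sub_add _ _ |>.trans (add_le_add ((hC N p).trans hremainder) hlead)

theorem exists_truncError_bounds (c : ℝ) (hw : ContDiff ℝ 6 w)
    (hp : Function.Periodic w (2 * π)) :
    ∃ C : ℝ, ∀ (N : ℕ) [NeZero N],
      gridNorm N (truncError c N w) ≤ C * meshSize N ^ 3 ∧
      ∀ j : ZMod N,
        ‖truncError c N w (j, 0) - ((c * meshSize N ^ 3 / 96 : ℝ) : ℂ) *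
            iteratedDeriv 5 w (node N (j, 0))‖ ≤ C * meshSize N ^ 4 ∧
        ‖truncError c N w (j, 1) + ((c * meshSize N ^ 3 / 96 : ℝ) : ℂ) *
            iteratedDeriv 5 w (node N (j, 1))‖ ≤ C * meshSize N ^ 4 := by
  obtain ⟨C₁, hC₁⟩ := exists_gridNorm_truncError_le c hw hp
  obtain ⟨C₂, -, hC₂⟩ := exists_truncError_expansion c hw hp
  refine ⟨max C₁ C₂, fun N _ => ?_⟩
  have hpos := meshSize_pos N
  have hmax : C₂ * meshSize N ^ 4 ≤ max C₁ C₂ * meshSize N ^ 4 := by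
    gcongr
    exact le_max_right _ _
  refine ⟨(hC₁ N).trans (by gcongr; exact le_max_left _ _), fun j => ⟨?_, ?_⟩⟩
  · refine le_trans (le_of_eq ?_) ((hC₂ N (j, 0)).trans hmax)
    simp [nodeSign]
  · refine le_trans (le_of_eq ?_) ((hC₂ N (j, 1)).trans hmax)
    simp [nodeSign]

theorem contDiff_wave (k : ℤ) {n : WithTop ℕ∞} : ContDiff ℝ n (wave k) :=
  (contDiff_const.mul Complex.ofRealCLM.contDiff).cexp

theorem hasDerivAt_wave (k : ℤ) (x : ℝ) : HasDerivAt (wave k) (I * k * wave k x) x := by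
  refine ((Complex.ofRealCLM.hasDerivAt (x := x)).const_mul (I * k)).cexp.congr_deriv ?_
  simp [wave, mul_comm]

theorem iteratedDeriv_wave (k : ℤ) (n : ℕ) :
    iteratedDeriv n (wave k) = fun x => (I * k) ^ n * wave k x := by
  induction n with
  | zero => simp
  | succ n ih =>
    ext x
    rw [iteratedDeriv_succ, ih, ((hasDerivAt_wave k x).const_mul _).deriv]
    ring

theorem norm_iteratedDeriv_wave (k : ℤ) (n : ℕ) (x : ℝ) :
    ‖iteratedDeriv n (wave k) x‖ = |(k : ℝ)| ^ n := by
  rw [iteratedDeriv_wave, norm_mul, norm_pow, norm_mul, norm_wave, Complex.norm_I,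
    Complex.norm_intCast, one_mul, mul_one]

theorem exists_gridNorm_truncError_wave (c : ℝ) (ω : ℤ) :
    ∃ C : ℝ, ∀ (N : ℕ) [NeZero N],
      |gridNorm N (truncError c N (wave ω)) -
          sqrt (2 * π) * (|c| * |(ω : ℝ)| ^ 5 / 96) * meshSize N ^ 3| ≤ C * meshSize N ^ 4 := by
  obtain ⟨C, hC₀, hC⟩ := exists_truncError_expansion c (contDiff_wave ω) (wave_periodic ω)
  refine ⟨sqrt (2 * π) * C, fun N _ => ?_⟩
  have hpos := meshSize_pos N
  let lead : Grid N := fun p => ((nodeSign p.2 * (c * meshSize N ^ 3 / 96) : ℝ) : ℂ) *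
    iteratedDeriv 5 (wave ω) (node N p)
  have hlead : gridNorm N lead = sqrt (2 * π) * (|c| * |(ω : ℝ)| ^ 5 / 96) * meshSize N ^ 3 := by
    rw [mul_assoc]
    exact gridNorm_of_norm_eq (by positivity) fun p => by
      rw [norm_truncError_lead, norm_iteratedDeriv_wave]
  rw [← hlead, mul_assoc]
  exact (abs_gridNorm_sub_le _ _).trans (gridNorm_le (by positivity) (hC N))

end Truncation

section FourierCoefficients

/-- The `k`-th Fourier coefficient of a `2π`-periodic function, computed on `[0, 2π]`. -/
def waveCoeff (w : ℝ → ℂ) (k : ℤ) : ℂ := fourierCoeffOn Real.two_pi_pos w k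

theorem fourier_coe_two_pi (k : ℤ) (x : ℝ) :
    fourier k (x : AddCircle (2 * π)) = wave k x := by
  have hpi : (π : ℂ) ≠ 0 := by exact_mod_cast Real.pi_ne_zero
  rw [fourier_coe_apply, wave]
  congr 1
  push_cast
  field_simp

theorem waveCoeff_eq_integral (w : ℝ → ℂ) (k : ℤ) :
    waveCoeff w k = (1 / (2 * π)) • ∫ x in (0 : ℝ)..2 * π, wave (-k) x * w x := by
  rw [waveCoeff, fourierCoeffOn_eq_integral, sub_zero]
  simp only [fourier_coe_two_pi, smul_eq_mul]

theorem continuous_wave (k : ℤ) : Continuous (wave k) := (contDiff_wave k (n := 0)).continuous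

theorem wave_two_pi (k : ℤ) : wave k (2 * π) = wave k 0 := by
  rw [← wave_periodic k 0, zero_add]

theorem waveCoeff_deriv {w w' : ℝ → ℂ} (hw : ∀ x, HasDerivAt w (w' x) x) (hw' : Continuous w')
    (hp : w (2 * π) = w 0) (k : ℤ) : waveCoeff w' k = I * k * waveCoeff w k := by
  rw [waveCoeff_eq_integral, waveCoeff_eq_integral,
    intervalIntegral.integral_mul_deriv_eq_deriv_mul (fun x _ => hasDerivAt_wave (-k) x)
    (fun x _ => hw x) ((continuous_const.mul (continuous_wave _)).intervalIntegrable _ _)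
    (hw'.intervalIntegrable _ _), hp, wave_two_pi, sub_self, zero_sub,
    ← intervalIntegral.integral_neg, mul_smul_comm, ← intervalIntegral.integral_const_mul]
  congr 2
  ext x
  push_cast
  ring

theorem waveCoeff_iteratedDeriv {w : ℝ → ℂ} {n : ℕ} (hw : ContDiff ℝ n w)
    (hp : Function.Periodic w (2 * π)) (k : ℤ) :
    waveCoeff (iteratedDeriv n w) k = (I * k) ^ n * waveCoeff w k := by
  induction n with
  | zero => simp
  | succ n ih =>
    have hderiv : ∀ x, HasDerivAt (iteratedDeriv n w) (iteratedDeriv (n + 1) w x) x := fun x => by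
      rw [iteratedDeriv_succ]
      exact (hw.differentiable_iteratedDeriv n (by exact_mod_cast n.lt_succ_self) x).hasDerivAt
    have hends : iteratedDeriv n w (2 * π) = iteratedDeriv n w 0 := by
      rw [← periodic_iteratedDeriv hp n 0, zero_add]
    rw [waveCoeff_deriv hderiv (hw.continuous_iteratedDeriv (n + 1) le_rfl) hends,
      ih (hw.of_le (by exact_mod_cast n.le_succ))]
    ring

theorem norm_waveCoeff_le {w : ℝ → ℂ} {M : ℝ} (hM : ∀ x, ‖w x‖ ≤ M) (k : ℤ) :
    ‖waveCoeff w k‖ ≤ M := by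
  have hintegral := intervalIntegral.norm_integral_le_of_norm_le_const (a := (0 : ℝ))
    (b := 2 * π) (f := fun x => wave (-k) x * w x) (C := M)
    fun x _ => by rw [norm_mul, norm_wave, one_mul]; exact hM x
  rw [sub_zero, abs_of_pos Real.two_pi_pos] at hintegral
  rw [waveCoeff_eq_integral, norm_smul, Real.norm_of_nonneg (by positivity), one_div,
    inv_mul_le_iff₀ Real.two_pi_pos]
  exact hintegral.trans_eq (mul_comm _ _)

theorem exists_pow_mul_norm_waveCoeff_le {w : ℝ → ℂ} {n : ℕ} (hw : ContDiff ℝ n w)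
    (hp : Function.Periodic w (2 * π)) :
    ∃ K : ℝ, ∀ k : ℤ, |(k : ℝ)| ^ n * ‖waveCoeff w k‖ ≤ K := by
  obtain ⟨M, -, hM⟩ := exists_norm_iteratedDeriv_le hw Real.two_pi_pos.ne' hp
  refine ⟨M, fun k => ?_⟩
  have hcoeff := norm_waveCoeff_le hM k
  rwa [waveCoeff_iteratedDeriv hw hp, norm_mul, norm_pow, norm_mul, Complex.norm_I, one_mul,
    Complex.norm_intCast] at hcoeff

theorem summable_pow_mul_norm_waveCoeff {w : ℝ → ℂ} {n : ℕ} (hw : ContDiff ℝ (n + 2 : ℕ) w)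
    (hp : Function.Periodic w (2 * π)) :
    Summable fun k : ℤ => |(k : ℝ)| ^ n * ‖waveCoeff w k‖ := by
  obtain ⟨K, hK⟩ := exists_pow_mul_norm_waveCoeff_le hw hp
  refine Summable.of_norm_bounded_eventually
    ((Real.summable_one_div_int_pow.2 one_lt_two).mul_left K) ?_
  filter_upwards [(finite_singleton (0 : ℤ)).compl_mem_cofinite] with k hk
  have hk₀ : (k : ℝ) ≠ 0 := by exact_mod_cast hk
  rw [Real.norm_of_nonneg (by positivity), mul_one_div, le_div_iff₀ (by positivity)]
  refine le_trans (le_of_eq ?_) (hK k)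
  rw [← sq_abs (k : ℝ)]
  ring

theorem hasSum_waveCoeff {w : ℝ → ℂ} (hw : Continuous w) (hp : Function.Periodic w (2 * π))
    (hs : Summable (waveCoeff w)) (x : ℝ) :
    HasSum (fun k : ℤ => waveCoeff w k * wave k x) (w x) := by
  have : Fact (0 < 2 * π) := ⟨Real.two_pi_pos⟩
  let W : C(AddCircle (2 * π), ℂ) := ⟨hp.lift, continuous_coinduced_dom.2 hw⟩
  have hW : ∀ y : ℝ, W y = w y := fun y => hp.lift_coe y
  have hcoeff : fourierCoeff W = waveCoeff w := by
    ext k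
    rw [fourierCoeff_eq_intervalIntegral W k 0, zero_add, waveCoeff_eq_integral]
    simp only [fourier_coe_two_pi, hW, smul_eq_mul]
  have hsum := has_pointwise_sum_fourier_series_of_summable (hcoeff ▸ hs) (x : AddCircle (2 * π))
  simpa only [hcoeff, fourier_coe_two_pi, hW, smul_eq_mul] using hsum

end FourierCoefficients

namespace IsHeatSolution

variable {f : ℝ → ℂ} {u : ℝ → ℝ → ℂ}

theorem continuous_slice (hu : IsHeatSolution f u) {t : ℝ} (ht : 0 ≤ t) :
    Continuous fun x => u x t :=
  hu.continuousOn.comp_continuous (f := fun x : ℝ => (x, t)) (by fun_prop)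
    fun _ => ⟨mem_univ _, ht⟩

theorem periodic_initial (hu : IsHeatSolution f u) : Function.Periodic f (2 * π) := by
  simpa only [hu.initial] using hu.periodic 0 le_rfl

theorem hasDerivAt_waveCoeff (hu : IsHeatSolution f u) {t : ℝ} (ht : 0 < t) (k : ℤ) :
    HasDerivAt (fun s => waveCoeff (fun x => u x s) k)
      (-(k : ℂ) ^ 2 * waveCoeff (fun x => u x t) k) t := by
  have hxx : waveCoeff (iteratedDeriv 2 fun x => u x t) k =
      -(k : ℂ) ^ 2 * waveCoeff (fun x => u x t) k := by
    rw [waveCoeff_iteratedDeriv (hu.contDiff t ht) (hu.periodic t ht.le), mul_pow, Complex.I_sq,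
      neg_one_mul]
  rw [← hxx]
  simp only [waveCoeff_eq_integral]
  have hcompact : IsCompact (Icc (0 : ℝ) (2 * π) ×ˢ Icc (t / 2) (2 * t)) :=
    isCompact_Icc.prod isCompact_Icc
  obtain ⟨M, hM⟩ := hcompact.exists_bound_of_continuousOn (hu.continuousOn_xx.mono
    fun p hp => ⟨mem_univ _, (half_pos ht).trans_le hp.2.1⟩)
  have hnhds : Ioo (t / 2) (2 * t) ∈ 𝓝 t := Ioo_mem_nhds (by linarith) (by linarith)
  have hpos : ∀ s ∈ Ioo (t / 2) (2 * t), 0 < s := fun s hs => (half_pos ht).trans hs.1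
  refine HasDerivAt.const_smul (1 / (2 * π))
    (intervalIntegral.hasDerivAt_integral_of_dominated_loc_of_deriv_le
    (F' := fun s x => wave (-k) x * iteratedDeriv 2 (fun y => u y s) x)
    (bound := fun _ => M) hnhds ?_ ?_ ?_ ?_ intervalIntegrable_const ?_).2
  · filter_upwards [hnhds] with s hs
    exact ((continuous_wave _).mul
      (hu.continuous_slice (hpos s hs).le)).aestronglyMeasurable
  · exact ((continuous_wave _).mul (hu.continuous_slice ht.le)).intervalIntegrable _ _
  · exact ((continuous_wave _).mul ((hu.contDiff t ht).continuous_iteratedDeriv 2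
      le_rfl)).aestronglyMeasurable
  · refine .of_forall fun x hx s hs => ?_
    rw [uIoc_of_le Real.two_pi_pos.le] at hx
    rw [norm_mul, norm_wave, one_mul]
    exact hM (x, s) ⟨Ioc_subset_Icc_self hx, Ioo_subset_Icc_self hs⟩
  · exact .of_forall fun x _ s hs => (hu.heat s (hpos s hs) x).const_mul _

theorem continuousOn_waveCoeff (hu : IsHeatSolution f u) (k : ℤ) :
    ContinuousOn (fun s => waveCoeff (fun x => u x s) k) (Ici 0) := by
  have hextended : Continuous fun s => waveCoeff (fun x => u x (max s 0)) k := by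
    simp only [waveCoeff_eq_integral]
    refine Continuous.const_smul
      (intervalIntegral.continuous_parametric_intervalIntegral_of_continuous'
        (μ := MeasureTheory.volume) (f := fun s x => wave (-k) x * u x (max s 0)) ?_ 0 (2 * π))
      (1 / (2 * π))
    refine ((continuous_wave _).comp continuous_snd).mul ?_
    exact hu.continuousOn.comp_continuous (f := fun p : ℝ × ℝ => (p.2, max p.1 0)) (by fun_prop)
      fun p => ⟨mem_univ _, le_max_right p.1 0⟩
  exact hextended.continuousOn.congr fun s hs => by simp only [max_eq_left (mem_Ici.1 hs)]

theorem waveCoeff_eq (hu : IsHeatSolution f u) {t : ℝ} (ht : 0 ≤ t) (k : ℤ) :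
    waveCoeff (fun x => u x t) k = exp (-(k : ℝ) ^ 2 * t) * waveCoeff f k := by
  let G : ℝ → ℂ := fun s => (exp ((k : ℝ) ^ 2 * s) : ℂ) * waveCoeff (fun x => u x s) k
  have hG : ContinuousOn G (Ici 0) :=
    (Complex.continuous_ofReal.comp (by fun_prop)).continuousOn.mul (hu.continuousOn_waveCoeff k)
  have hderiv : ∀ s ∈ Ioi (0 : ℝ), HasDerivAt G 0 s := fun s hs => by
    have hexp := ((hasDerivAt_id s).const_mul ((k : ℝ) ^ 2)).exp.ofReal_comp
    refine (hexp.mul (hu.hasDerivAt_waveCoeff hs k)).congr_deriv ?_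
    simp only [id_eq]
    push_cast
    ring
  have hconst : EqOn G (fun _ => G 1) (Ioi 0) := fun s hs =>
    isOpen_Ioi.is_const_of_deriv_eq_zero isPreconnected_Ioi
      (fun r hr => (hderiv r hr).differentiableAt.differentiableWithinAt)
      (fun r hr => (hderiv r hr).deriv) hs (mem_Ioi.2 one_pos)
  have hconst' : EqOn G (fun _ => G 1) (Ici 0) := hconst.of_subset_closure hG continuousOn_const
    Ioi_subset_Ici_self (closure_Ioi (0 : ℝ)).ge
  have hinitial : G t = waveCoeff f k :=
    (hconst' ht).trans ((hconst' self_mem_Ici).symm.trans (by simp [G, hu.initial]))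
  rw [← hinitial, ← mul_assoc, ← Complex.ofReal_mul, ← Real.exp_add, neg_mul, neg_add_cancel]
  simp

theorem hasSum_waveSol (hu : IsHeatSolution f u) (hf : ContDiff ℝ 2 f) {t : ℝ} (ht : 0 ≤ t)
    (x : ℝ) : HasSum (fun k : ℤ => waveCoeff f k * waveSol k x t) (u x t) := by
  have hs : Summable (waveCoeff fun x => u x t) := by
    refine .of_norm_bounded
      (summable_pow_mul_norm_waveCoeff (n := 0) hf hu.periodic_initial) fun k => ?_
    rw [hu.waveCoeff_eq ht, norm_mul, Complex.norm_real, Real.norm_of_nonneg (Real.exp_pos _).le,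
      pow_zero]
    gcongr
    exact Real.exp_le_one_iff.2 (by nlinarith [sq_nonneg (k : ℝ)])
  refine (hasSum_waveCoeff (hu.continuous_slice ht) (hu.periodic t ht) hs x).congr_fun fun k => ?_
  rw [hu.waveCoeff_eq ht, waveSol]
  ring

end IsHeatSolution

section ModeErrors

variable {c : ℝ} {N : ℕ}

theorem norm_smul_mode_add_smul_mode_le (a b : ℝ) (k l : ℤ) (p : ZMod N × Fin 2) :
    ‖((a : ℂ) • mode N k + (b : ℂ) • mode N l) p‖ ≤ |a| + |b| := by
  refine (norm_add_le _ _).trans_eq ?_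
  simp only [Pi.smul_apply, norm_smul, norm_mode, mul_one, Complex.norm_real, Real.norm_eq_abs]

theorem globalError_waveSol {v : ℝ → Grid N} {t a b : ℝ} {k l : ℤ}
    (hv : v t = (a : ℂ) • mode N k + (b : ℂ) • mode N l) :
    globalError N (waveSol k) v t =
      ((exp (-(k : ℝ) ^ 2 * t) - a : ℝ) : ℂ) • mode N k + ((-b : ℝ) : ℂ) • mode N l := by
  rw [globalError, hv]
  ext p
  simp only [proj, mode, waveSol, Pi.sub_apply, Pi.add_apply, Pi.smul_apply, smul_eq_mul,
    Complex.ofReal_sub, Complex.ofReal_neg]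
  ring

variable [NeZero N]

theorem mode_add_two_mul_natCast (k : ℤ) : mode N (k + 2 * N) = -mode N k := by
  rw [two_mul, ← add_assoc, mode_add_natCast, mode_add_natCast, diagMul_diagMul, neg_mul_neg,
    Complex.I_mul_I, diagMul_self, neg_one_smul]

theorem exists_eq_or_eq_highFreq {k : ℤ} (hk : k ∈ Ioc (-N : ℤ) (-N + 2 * N)) :
    ∃ ω : ℤ, |2 * ω| ≤ N ∧ (k = ω ∨ k = highFreq N ω) := by
  have hN := NeZero.pos N
  obtain ⟨hlower, hupper⟩ := hk
  simp only [highFreq, abs_le]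
  by_cases hlow : |2 * k| ≤ N
  · exact ⟨k, abs_le.1 hlow, .inl rfl⟩
  · rw [abs_le] at hlow
    rcases lt_or_ge 0 k with hk | hk
    · exact ⟨k - N, ⟨by omega, by omega⟩, .inr (by rw [if_neg (by omega)]; ring)⟩
    · exact ⟨k + N, ⟨by omega, by omega⟩, .inr (by rw [if_pos (by omega)]; ring)⟩

theorem periodic_norm_semigroup_mode (t : ℝ) (p : ZMod N × Fin 2) :
    Function.Periodic (fun k : ℤ => ‖semigroup c N t (mode N k) p‖) (2 * N) := fun k => by
  simp only [mode_add_two_mul_natCast, map_neg, Pi.neg_apply, norm_neg]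

theorem exists_norm_semigroup_mode_le (hc : c < 2) :
    ∃ K : ℝ, ∀ (N : ℕ) [NeZero N] (k : ℤ) (t : ℝ), 0 ≤ t → ∀ p,
      ‖semigroup c N t (mode N k) p‖ ≤ K := by
  obtain ⟨K, hK⟩ := exists_amp_bound hc
  refine ⟨K, fun N _ k t ht p => ?_⟩
  have hN : (0 : ℤ) < 2 * N := by have := NeZero.pos N; omega
  obtain ⟨l, hl, hkl⟩ := (periodic_norm_semigroup_mode t p).exists_mem_Ioc hN k (-N)
  obtain ⟨ω, hω, rfl | rfl⟩ := exists_eq_or_eq_highFreq hl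
  · obtain ⟨hlow, -⟩ := hK (meshSize N) l t (abs_meshSize_mul_le hω) ht
    rw [hkl, semigroup_mode_low hc hω ht]
    exact (norm_smul_mode_add_smul_mode_le _ _ _ _ p).trans hlow
  · obtain ⟨-, hhigh⟩ := hK (meshSize N) ω t (abs_meshSize_mul_le hω) ht
    rw [hkl, semigroup_mode_high hc hω ht]
    exact (norm_smul_mode_add_smul_mode_le _ _ _ _ p).trans hhigh

theorem norm_waveSol_le_one (k : ℤ) (x : ℝ) {t : ℝ} (ht : 0 ≤ t) : ‖waveSol k x t‖ ≤ 1 := by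
  rw [waveSol, norm_mul, norm_wave, mul_one, Complex.norm_real, Real.norm_eq_abs, Real.abs_exp]
  exact Real.exp_le_one_iff.2 (mul_nonpos_of_nonpos_of_nonneg (by simp [sq_nonneg]) ht)

theorem one_le_abs_mul_meshSize {k : ℤ} (hk : ¬|2 * k| ≤ N) : 1 ≤ |(k : ℝ)| * meshSize N := by
  have hlarge : (N : ℝ) ≤ 2 * |(k : ℝ)| := by
    rw [← abs_two, ← abs_mul]
    exact_mod_cast (not_le.1 hk).le
  nlinarith [meshSize_pos N, natCast_mul_meshSize N, Real.pi_gt_three]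

theorem abs_mul_meshSize (k : ℤ) : |(k : ℝ)| * meshSize N = |meshSize N * k| := by
  rw [abs_mul, abs_of_pos (meshSize_pos N), mul_comm]

theorem HasAmplitudeOrder.exists_norm_globalError_waveSol_le {n : ℕ} (hn : HasAmplitudeOrder c n)
    (hc : c < 2) :
    ∃ C : ℝ, 0 ≤ C ∧ ∀ (N : ℕ) [NeZero N] (k : ℤ) (v : ℝ → Grid N),
      IsSemidiscreteSolution c N (mode N k) v → ∀ t : ℝ, 0 ≤ t → ∀ p,
        ‖globalError N (waveSol k) v t p‖ ≤ C * (|(k : ℝ)| * meshSize N) ^ n := by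
  obtain ⟨C, hC₀, hC⟩ := hn
  obtain ⟨K, hK⟩ := exists_norm_semigroup_mode_le hc
  refine ⟨max C (1 + K), le_max_of_le_left hC₀, fun N _ k v hv t ht p => ?_⟩
  by_cases hk : |2 * k| ≤ N
  · calc ‖globalError N (waveSol k) v t p‖
        ≤ |exp (-(k : ℝ) ^ 2 * t) - ampLowLow c (meshSize N) k t| +
            |ampLowHigh c (meshSize N) k t| := by
          rw [globalError_waveSol ((hv.eq_semigroup ht).trans (semigroup_mode_low hc hk ht)),
            ← abs_neg (ampLowHigh _ _ _ _)]
          exact norm_smul_mode_add_smul_mode_le _ _ _ _ p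
      _ ≤ C * (|(k : ℝ)| * meshSize N) ^ n := by
          rw [abs_mul_meshSize]
          exact hC _ _ _ (meshSize_pos N) (abs_meshSize_mul_le hk) ht
      _ ≤ _ := by
          have := meshSize_pos N
          gcongr
          exact le_max_left _ _
  · have hbound : ‖globalError N (waveSol k) v t p‖ ≤ 1 + K := by
      rw [globalError, hv.eq_semigroup ht]
      exact (norm_sub_le _ _).trans (add_le_add (norm_waveSol_le_one k _ ht) (hK N k t ht p))
    exact (hbound.trans (le_max_right C _)).trans
      (le_mul_of_one_le_right (le_max_of_le_left hC₀) (one_le_pow₀ (one_le_abs_mul_meshSize hk)))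

end ModeErrors

section SmoothData

variable {c : ℝ} {f : ℝ → ℂ} {u : ℝ → ℝ → ℂ}

theorem hasSum_globalError (hf : ContDiff ℝ 2 f) (hu : IsHeatSolution f u) {N : ℕ} [NeZero N]
    {v : ℝ → Grid N} (hv : IsSemidiscreteSolution c N (proj N f) v) {t : ℝ} (ht : 0 ≤ t)
    (p : ZMod N × Fin 2) :
    HasSum (fun k : ℤ => waveCoeff f k *
        globalError N (waveSol k) (fun s => semigroup c N s (mode N k)) t p)
      (globalError N u v t p) := by
  have hinitial : HasSum (fun k : ℤ => waveCoeff f k • mode N k) (proj N f) :=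
    Pi.hasSum.2 fun q => by
      simpa [waveSol, hu.initial, mode, proj] using hu.hasSum_waveSol hf le_rfl (node N q)
  have hdiscrete := (semigroup c N t).hasSum hinitial
  rw [← hv.eq_semigroup ht] at hdiscrete
  refine ((hu.hasSum_waveSol hf ht (node N p)).sub (Pi.hasSum.1 hdiscrete p)).congr_fun
    fun k => ?_
  simp only [globalError, proj, map_smul, Pi.sub_apply, Pi.smul_apply, smul_eq_mul, mul_sub]

theorem HasAmplitudeOrder.exists_gridNorm_globalError_le {n : ℕ} (hn : HasAmplitudeOrder c n)
    (hc : c < 2) (hf : ContDiff ℝ (n + 2 : ℕ) f) (hu : IsHeatSolution f u) :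
    ∃ C : ℝ, ∀ (N : ℕ) [NeZero N] (v : ℝ → Grid N), IsSemidiscreteSolution c N (proj N f) v →
      ∀ t : ℝ, 0 ≤ t → gridNorm N (globalError N u v t) ≤ C * meshSize N ^ n := by
  obtain ⟨C, hC₀, hC⟩ := hn.exists_norm_globalError_waveSol_le hc
  have hsummable := summable_pow_mul_norm_waveCoeff hf hu.periodic_initial
  have hf₂ : ContDiff ℝ 2 f := hf.of_le (by exact_mod_cast Nat.le_add_left 2 n)
  let A := ∑' k : ℤ, |(k : ℝ)| ^ n * ‖waveCoeff f k‖
  have : 0 ≤ A := tsum_nonneg fun k => by positivity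
  refine ⟨sqrt (2 * π) * (C * A), fun N _ v hv t ht => ?_⟩
  have hpos := meshSize_pos N
  rw [mul_assoc]
  refine gridNorm_le (by positivity) fun p => ?_
  refine ((hasSum_globalError hf₂ hu hv ht p).norm_le_of_bounded
    (hsummable.hasSum.mul_left (C * meshSize N ^ n)) fun k => ?_).trans_eq (by ring)
  rw [norm_mul]
  calc ‖waveCoeff f k‖ * ‖globalError N (waveSol k) (fun s => semigroup c N s (mode N k)) t p‖
      ≤ ‖waveCoeff f k‖ * (C * (|(k : ℝ)| * meshSize N) ^ n) := by
        gcongr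
        exact hC N k _ (isSemidiscreteSolution_semigroup _) t ht p
    _ = C * meshSize N ^ n * (|(k : ℝ)| ^ n * ‖waveCoeff f k‖) := by ring

theorem exists_gridNorm_globalError_le (hc : c < 2) (hf : ContDiff ℝ 7 f)
    (hu : IsHeatSolution f u) :
    ∃ C : ℝ, ∀ (N : ℕ) [NeZero N] (v : ℝ → Grid N), IsSemidiscreteSolution c N (proj N f) v →
      ∀ t : ℝ, 0 ≤ t →
        gridNorm N (globalError N u v t) ≤ C * meshSize N ^ 4 ∧
        (c = -4 / 13 → gridNorm N (globalError N u v t) ≤ C * meshSize N ^ 5) := by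
  obtain ⟨C₁, hC₁⟩ := (hasAmplitudeOrder_four hc).exists_gridNorm_globalError_le hc
    (hf.of_le (by norm_num)) hu
  by_cases h : c = -4 / 13
  · obtain ⟨C₂, hC₂⟩ := (hasAmplitudeOrder_five h).exists_gridNorm_globalError_le hc hf hu
    refine ⟨max C₁ C₂, fun N _ v hv t ht => ?_⟩
    have hpos := meshSize_pos N
    refine ⟨(hC₁ N v hv t ht).trans ?_, fun _ => (hC₂ N v hv t ht).trans ?_⟩ <;> gcongr
    exacts [le_max_left _ _, le_max_right _ _]
  · exact ⟨C₁, fun N _ v hv t ht => ⟨hC₁ N v hv t ht, fun h' => absurd h' h⟩⟩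

end SmoothData

section FourierData

variable {c : ℝ}

theorem exists_waveSolution_expansion (hc : c < 2) :
    ∃ C : ℝ, ∀ (N : ℕ) [NeZero N] (ω : ℤ), |2 * ω| ≤ N →
      ∀ v, IsSemidiscreteSolution c N (mode N ω) v → ∀ t : ℝ, 0 ≤ t →
        ∃ a b : ℝ,
          v t = (a : ℂ) • mode N ω + (b : ℂ) • mode N (highFreq N ω) ∧
          |a - exp (-(ω : ℝ) ^ 2 * t)
              * (1 - (4 + 13 * c) * (ω : ℝ) ^ 6 * t * meshSize N ^ 4 / (2880 * (-2 + c)))|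
            ≤ C * (|(ω : ℝ)| * meshSize N) ^ 6 ∧
          |b - -(c * (|(ω : ℝ)| * meshSize N) ^ 5 / (1024 * (-2 + c)))
              * (exp (-(ω : ℝ) ^ 2 * t) - exp (Qhat2 c (meshSize N) ω * t))|
            ≤ C * (|(ω : ℝ)| * meshSize N) ^ 6 := by
  obtain ⟨C₁, -, hlow⟩ := exists_ampLowLow_expansion hc
  obtain ⟨C₂, -, hhigh⟩ := exists_ampLowHigh_expansion hc
  refine ⟨max C₁ C₂, fun N _ ω hω v hv t ht => ?_⟩
  have hpos := meshSize_pos N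
  have hθ := abs_meshSize_mul_le hω
  refine ⟨_, _, (hv.eq_semigroup ht).trans (semigroup_mode_low hc hω ht), ?_, ?_⟩
  all_goals rw [abs_mul_meshSize]
  · refine (hlow _ ω t hpos hθ ht).trans ?_
    gcongr
    exact le_max_left _ _
  · refine (hhigh _ ω t hpos hθ ht).trans ?_
    gcongr
    exact le_max_right _ _

theorem exists_exp_Qhat2_le (hc : c < 2) {t : ℝ} (ht : 0 < t) :
    ∃ K : ℝ, 0 ≤ K ∧ ∀ (N : ℕ) [NeZero N] (ω : ℝ),
      exp (Qhat2 c (meshSize N) ω * t) ≤ K * meshSize N := by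
  have : 0 < 2 - c := sub_pos.2 hc
  refine ⟨3 * (2 * π) / (4 * (2 - c) * t), by positivity, fun N _ ω => ?_⟩
  have hpos := meshSize_pos N
  let x := 4 * (2 - c) * t / (3 * meshSize N ^ 2)
  have hx : 0 < x := by positivity
  have hle : Qhat2 c (meshSize N) ω * t ≤ -x :=
    (mul_le_mul_of_nonneg_right (Qhat2_le hc (meshSize N) ω) ht.le).trans_eq (by ring)
  have hexp : exp (-x) ≤ 1 / x := by
    rw [le_div_iff₀ hx, mul_comm]
    simpa using mul_exp_neg_le one_pos x
  calc exp (Qhat2 c (meshSize N) ω * t) ≤ 1 / x := (Real.exp_le_exp.2 hle).trans hexp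
    _ = 3 * meshSize N / (4 * (2 - c) * t) * meshSize N := by
        simp only [x]
        field_simp
    _ ≤ 3 * (2 * π) / (4 * (2 - c) * t) * meshSize N := by
        gcongr
        exact meshSize_le N

theorem exists_waveSolution_expansion_of_pos (hc : c < 2) (ω : ℤ) {t : ℝ} (ht : 0 < t) :
    ∃ C : ℝ, ∀ (N : ℕ) [NeZero N], |2 * ω| ≤ N →
      ∀ v, IsSemidiscreteSolution c N (mode N ω) v →
        ∃ a b : ℝ,
          v t = (a : ℂ) • mode N ω + (b : ℂ) • mode N (highFreq N ω) ∧
          |a - exp (-(ω : ℝ) ^ 2 * t)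
              * (1 - (4 + 13 * c) * (ω : ℝ) ^ 6 * t * meshSize N ^ 4 / (2880 * (-2 + c)))|
            ≤ C * meshSize N ^ 6 ∧
          |b - -(c * (|(ω : ℝ)| * meshSize N) ^ 5 / (1024 * (-2 + c))) * exp (-(ω : ℝ) ^ 2 * t)|
            ≤ C * meshSize N ^ 6 := by
  obtain ⟨C, hC⟩ := exists_waveSolution_expansion hc
  obtain ⟨K, hK₀, hK⟩ := exists_exp_Qhat2_le hc ht
  let ρ := -(c * |(ω : ℝ)| ^ 5 / (1024 * (-2 + c)))
  refine ⟨C * |(ω : ℝ)| ^ 6 + |ρ| * K, fun N _ hω v hv => ?_⟩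
  obtain ⟨a, b, hv, ha, hb⟩ := hC N ω hω v hv t ht.le
  have hpos := meshSize_pos N
  have hfast : |ρ * meshSize N ^ 5 * exp (Qhat2 c (meshSize N) ω * t)| ≤
      |ρ| * K * meshSize N ^ 6 := by
    rw [abs_mul, abs_mul, abs_of_pos (pow_pos hpos 5), Real.abs_exp]
    calc |ρ| * meshSize N ^ 5 * exp (Qhat2 c (meshSize N) ω * t)
        ≤ |ρ| * meshSize N ^ 5 * (K * meshSize N) := by
          gcongr
          exact hK N ω
      _ = |ρ| * K * meshSize N ^ 6 := by ring
  have hC₆ : C * (|(ω : ℝ)| * meshSize N) ^ 6 = C * |(ω : ℝ)| ^ 6 * meshSize N ^ 6 := by ring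
  rw [hC₆] at ha hb
  refine ⟨a, b, hv, ha.trans ?_, ?_⟩
  · rw [add_mul]
    exact le_add_of_nonneg_right (by positivity)
  · rw [add_mul]
    refine le_trans (le_of_eq ?_) ((abs_sub _ _).trans (add_le_add hb hfast))
    congr 1
    ring

theorem abs_gridNorm_add_sub_le {N : ℕ} [NeZero N] (a b X : ℝ) (k l : ℤ) :
    |gridNorm N ((a : ℂ) • mode N k + (b : ℂ) • mode N l) - sqrt (2 * π) * X| ≤
      sqrt (2 * π) * (|b| + |(|a|) - X|) := by
  have hmode (a : ℝ) (k : ℤ) : gridNorm N ((a : ℂ) • mode N k) = sqrt (2 * π) * |a| :=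
    gridNorm_of_norm_eq (abs_nonneg a) fun p => by
      rw [Pi.smul_apply, norm_smul, norm_mode, mul_one, Complex.norm_real, Real.norm_eq_abs]
  have hdrop := abs_gridNorm_sub_le ((a : ℂ) • mode N k + (b : ℂ) • mode N l) ((a : ℂ) • mode N k)
  rw [add_sub_cancel_left, hmode, hmode] at hdrop
  refine (abs_sub_le _ (sqrt (2 * π) * |a|) _).trans ?_
  rw [← mul_sub, abs_mul, abs_of_nonneg (Real.sqrt_nonneg (2 * π)), mul_add]
  exact add_le_add_left hdrop _

theorem exists_globalError_waveSol_expansion (hc : c < 2) (ω : ℤ) {t : ℝ} (ht : 0 < t) :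
    ∃ C : ℝ, 0 ≤ C ∧ ∀ (N : ℕ) [NeZero N], |2 * ω| ≤ N →
      ∀ v, IsSemidiscreteSolution c N (mode N ω) v →
        ∃ a b : ℝ,
          globalError N (waveSol ω) v t = (a : ℂ) • mode N ω + (b : ℂ) • mode N (highFreq N ω) ∧
          |(|a|) - |4 + 13 * c| * (ω : ℝ) ^ 6 * t / (2880 * (2 - c))
            * exp (-(ω : ℝ) ^ 2 * t) * meshSize N ^ 4| ≤ C * meshSize N ^ 6 ∧
          |(|b|) - |c| * |(ω : ℝ)| ^ 5 / (1024 * (2 - c))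
            * exp (-(ω : ℝ) ^ 2 * t) * meshSize N ^ 5| ≤ C * meshSize N ^ 6 := by
  obtain ⟨C, hC⟩ := exists_waveSolution_expansion_of_pos hc ω ht
  refine ⟨|C|, abs_nonneg C, fun N _ hω v hv => ?_⟩
  obtain ⟨a, b, hv, ha, hb⟩ := hC N hω v hv
  have hpos := meshSize_pos N
  have hc₂ : |-2 + c| = 2 - c := by rw [abs_of_neg (by linarith)]; ring
  have hω₆ : |(ω : ℝ)| ^ 6 = (ω : ℝ) ^ 6 := Even.pow_abs (by decide) _
  have hbound : C * meshSize N ^ 6 ≤ |C| * meshSize N ^ 6 := by gcongr; exact le_abs_self C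
  refine ⟨_, _, globalError_waveSol hv, le_trans ?_ (ha.trans hbound),
    le_trans ?_ (hb.trans hbound)⟩
  · have hlead : |4 + 13 * c| * (ω : ℝ) ^ 6 * t / (2880 * (2 - c)) * exp (-(ω : ℝ) ^ 2 * t)
          * meshSize N ^ 4 = |(4 + 13 * c) * (ω : ℝ) ^ 6 * t * meshSize N ^ 4
            / (2880 * (-2 + c)) * exp (-(ω : ℝ) ^ 2 * t)| := by
      simp only [abs_mul, abs_div, abs_pow, hc₂, hω₆, abs_of_pos ht, abs_of_pos hpos,
        Real.abs_exp, Nat.abs_ofNat]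
      ring
    rw [hlead, abs_sub_comm a]
    refine (abs_abs_sub_abs_le _ _).trans_eq ?_
    congr 1
    ring
  · have hlead : |c| * |(ω : ℝ)| ^ 5 / (1024 * (2 - c)) * exp (-(ω : ℝ) ^ 2 * t)
          * meshSize N ^ 5 = |-(c * (|(ω : ℝ)| * meshSize N) ^ 5 / (1024 * (-2 + c)))
            * exp (-(ω : ℝ) ^ 2 * t)| := by
      simp only [abs_mul, abs_div, abs_neg, abs_pow, abs_abs, hc₂, abs_of_pos hpos,
        Real.abs_exp, Nat.abs_ofNat]
      ring
    rw [hlead, abs_neg b]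
    exact abs_abs_sub_abs_le _ _

theorem exists_gridNorm_globalError_waveSol (hc : c < 2) (ω : ℤ) {t : ℝ} (ht : 0 < t) :
    ∃ C : ℝ, ∀ (N : ℕ) [NeZero N], |2 * ω| ≤ N →
      ∀ v, IsSemidiscreteSolution c N (mode N ω) v →
        |gridNorm N (globalError N (waveSol ω) v t)
            - sqrt (2 * π) * (|4 + 13 * c| * (ω : ℝ) ^ 6 * t / (2880 * (2 - c)))
              * exp (-(ω : ℝ) ^ 2 * t) * meshSize N ^ 4| ≤ C * meshSize N ^ 5 ∧
        (c = -4 / 13 →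
          |gridNorm N (globalError N (waveSol ω) v t)
              - sqrt (2 * π) * (|c| * |(ω : ℝ)| ^ 5 / (1024 * (2 - c)))
                * exp (-(ω : ℝ) ^ 2 * t) * meshSize N ^ 5| ≤ C * meshSize N ^ 6) := by
  obtain ⟨C, hC₀, hC⟩ := exists_globalError_waveSol_expansion hc ω ht
  have : 0 < 2 - c := sub_pos.2 hc
  let B := |c| * |(ω : ℝ)| ^ 5 / (1024 * (2 - c)) * exp (-(ω : ℝ) ^ 2 * t)
  have : 0 ≤ B := by positivity
  refine ⟨sqrt (2 * π) * (B + 4 * π * C + 2 * C), fun N _ hω v hv => ?_⟩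
  obtain ⟨a, b, hE, ha, hb⟩ := hC N hω v hv
  have hpos := meshSize_pos N
  have hC₆ : C * meshSize N ^ 6 ≤ 2 * π * C * meshSize N ^ 5 := by
    rw [pow_succ', ← mul_assoc, mul_comm C]
    gcongr
    exact meshSize_le N
  rw [hE]
  simp only [mul_assoc (sqrt (2 * π))]
  refine ⟨(abs_gridNorm_add_sub_le _ _ _ _ _).trans ?_, fun h => ?_⟩
  · gcongr
    have hb' : |b| ≤ B * meshSize N ^ 5 + C * meshSize N ^ 6 :=
      sub_le_iff_le_add'.1 ((le_abs_self _).trans hb)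
    have : 0 ≤ C * meshSize N ^ 5 := by positivity
    linarith
  · have ha' : |a| ≤ C * meshSize N ^ 6 := by
      have hzero : 4 + 13 * c = 0 := by rw [h]; norm_num
      simpa [hzero] using ha
    rw [add_comm ((a : ℂ) • _)]
    refine (abs_gridNorm_add_sub_le _ _ _ _ _).trans ?_
    gcongr
    have : 0 ≤ (B + 4 * π * C) * meshSize N ^ 6 := by positivity
    linarith

end FourierData

end BFD

end

theorem mainTheorem2 (c : ℝ) (hc : c < 2) :
    -- aliasing of each low mode with its high mode
    (∀ (N : ℕ) [NeZero N] (ω : ℤ), |2 * ω| ≤ N → ∀ j : ZMod N,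
      (0 < ω →
        BFD.mode N ω (j, 0) = Complex.I * BFD.mode N (BFD.highFreq N ω) (j, 0) ∧
        BFD.mode N ω (j, 1) = -Complex.I * BFD.mode N (BFD.highFreq N ω) (j, 1)) ∧
      (ω < 0 →
        BFD.mode N ω (j, 0) = -Complex.I * BFD.mode N (BFD.highFreq N ω) (j, 0) ∧
        BFD.mode N ω (j, 1) = Complex.I * BFD.mode N (BFD.highFreq N ω) (j, 1))) ∧
    -- action of the operator on the low and on the high mode
    (∀ (N : ℕ) [NeZero N] (ω : ℤ), |2 * ω| ≤ N →
      BFD.blockOp c N (BFD.mode N ω) =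
        BFD.diagMul (BFD.mu1 c (BFD.meshSize N) ω) (BFD.mu2 c (BFD.meshSize N) ω)
          (BFD.mode N ω) ∧
      BFD.blockOp c N (BFD.mode N (BFD.highFreq N ω)) =
        BFD.diagMul (BFD.sigma1 c (BFD.meshSize N) ω) (BFD.sigma2 c (BFD.meshSize N) ω)
          (BFD.mode N (BFD.highFreq N ω))) ∧
    -- the `2 × 2` eigenvalue system of each block, with explicit solutions
    (c ≠ 0 → ∀ (N : ℕ) [NeZero N] (ω : ℤ), |2 * ω| ≤ N → ω ≠ 0 →
      ∀ rq ∈ ({(BFD.r1 c (BFD.meshSize N) ω, BFD.Qhat1 c (BFD.meshSize N) ω),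
          (BFD.r2 c (BFD.meshSize N) ω, BFD.Qhat2 c (BFD.meshSize N) ω)} : Set (ℂ × ℝ)),
        BFD.mu1 c (BFD.meshSize N) ω - BFD.sigma1 c (BFD.meshSize N) ω * rq.1
          = (rq.2 : ℂ) * (1 - rq.1) ∧
        BFD.mu2 c (BFD.meshSize N) ω + BFD.sigma2 c (BFD.meshSize N) ω * rq.1
          = (rq.2 : ℂ) * (1 + rq.1)) ∧
    -- normalized eigenvectors inside each block
    (∀ (N : ℕ) [NeZero N] (ω : ℤ), |2 * ω| ≤ N →
      ‖(BFD.coeff1 c (BFD.meshSize N) ω).1‖ ^ 2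
        + ‖(BFD.coeff1 c (BFD.meshSize N) ω).2‖ ^ 2 = 1 ∧
      ‖(BFD.coeff2 c (BFD.meshSize N) ω).1‖ ^ 2
        + ‖(BFD.coeff2 c (BFD.meshSize N) ω).2‖ ^ 2 = 1 ∧
      ∀ k : Fin 2, BFD.blockOp c N (BFD.psi c N ω k)
        = (BFD.Qhat c N ω k : ℂ) • BFD.psi c N ω k) ∧
    -- they diagonalize the operator
    (∀ (N : ℕ) [NeZero N],
      LinearIndependent ℂ (fun p : BFD.LowFreq N × Fin 2 => BFD.psi c N p.1 p.2) ∧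
      Submodule.span ℂ
        (Set.range fun p : BFD.LowFreq N × Fin 2 => BFD.psi c N p.1 p.2) = ⊤) ∧
    -- expansion of the eigenvalues
    (∃ C : ℝ, ∀ (N : ℕ) [NeZero N] (ω : ℤ), |2 * ω| ≤ N →
      |BFD.Qhat1 c (BFD.meshSize N) ω
          - (-(ω : ℝ) ^ 2
            - (4 + 13 * c) * (ω : ℝ) ^ 6 * BFD.meshSize N ^ 4 / (2880 * (-2 + c)))|
        ≤ C * (ω : ℝ) ^ 8 * BFD.meshSize N ^ 6 ∧
      |BFD.Qhat2 c (BFD.meshSize N) ω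
          - (32 * (-2 + c) / (3 * BFD.meshSize N ^ 2) - (-5 + 6 * c) * (ω : ℝ) ^ 2 / 3
            + (-1 + 3 * c) * (ω : ℝ) ^ 4 * BFD.meshSize N ^ 2 / 18)|
        ≤ C * (ω : ℝ) ^ 6 * BFD.meshSize N ^ 4) ∧
    -- the semi-discrete problem is uniquely solvable
    (∀ (N : ℕ) [NeZero N] (v₀ : BFD.Grid N),
      ∃ v, BFD.IsSemidiscreteSolution c N v₀ v ∧
        ∀ w, BFD.IsSemidiscreteSolution c N v₀ w → Set.EqOn w v (Set.Ici 0)) ∧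
    -- the semi-discrete solution for Fourier data, uniformly in time and frequency
    (∃ C : ℝ, ∀ (N : ℕ) [NeZero N] (ω : ℤ), |2 * ω| ≤ N →
      ∀ v, BFD.IsSemidiscreteSolution c N (BFD.mode N ω) v → ∀ t : ℝ, 0 ≤ t →
        ∃ a b : ℝ,
          v t = (a : ℂ) • BFD.mode N ω + (b : ℂ) • BFD.mode N (BFD.highFreq N ω) ∧
          |a - Real.exp (-(ω : ℝ) ^ 2 * t)
              * (1 - (4 + 13 * c) * (ω : ℝ) ^ 6 * t * BFD.meshSize N ^ 4
                / (2880 * (-2 + c)))|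
            ≤ C * (|(ω : ℝ)| * BFD.meshSize N) ^ 6 ∧
          |b - -(c * (|(ω : ℝ)| * BFD.meshSize N) ^ 5 / (1024 * (-2 + c)))
              * (Real.exp (-(ω : ℝ) ^ 2 * t)
                - Real.exp (BFD.Qhat2 c (BFD.meshSize N) ω * t))|
            ≤ C * (|(ω : ℝ)| * BFD.meshSize N) ^ 6) ∧
    -- the same at a fixed positive time
    (∀ (ω : ℤ) (t : ℝ), 0 < t → ∃ C : ℝ, ∀ (N : ℕ) [NeZero N], |2 * ω| ≤ N →
      ∀ v, BFD.IsSemidiscreteSolution c N (BFD.mode N ω) v →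
        ∃ a b : ℝ,
          v t = (a : ℂ) • BFD.mode N ω + (b : ℂ) • BFD.mode N (BFD.highFreq N ω) ∧
          |a - Real.exp (-(ω : ℝ) ^ 2 * t)
              * (1 - (4 + 13 * c) * (ω : ℝ) ^ 6 * t * BFD.meshSize N ^ 4
                / (2880 * (-2 + c)))|
            ≤ C * BFD.meshSize N ^ 6 ∧
          |b - -(c * (|(ω : ℝ)| * BFD.meshSize N) ^ 5 / (1024 * (-2 + c)))
              * Real.exp (-(ω : ℝ) ^ 2 * t)|
            ≤ C * BFD.meshSize N ^ 6) ∧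
    -- exact order of the global error for Fourier data
    (∀ (ω : ℤ) (t : ℝ), 0 < t → ∃ C : ℝ, ∀ (N : ℕ) [NeZero N], |2 * ω| ≤ N →
      ∀ v, BFD.IsSemidiscreteSolution c N (BFD.mode N ω) v →
        |BFD.gridNorm N (BFD.globalError N (BFD.waveSol ω) v t)
            - Real.sqrt (2 * Real.pi)
              * (|4 + 13 * c| * (ω : ℝ) ^ 6 * t / (2880 * (2 - c)))
              * Real.exp (-(ω : ℝ) ^ 2 * t) * BFD.meshSize N ^ 4|
          ≤ C * BFD.meshSize N ^ 5 ∧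
        (c = -4 / 13 →
          |BFD.gridNorm N (BFD.globalError N (BFD.waveSol ω) v t)
              - Real.sqrt (2 * Real.pi) * (|c| * |(ω : ℝ)| ^ 5 / (1024 * (2 - c)))
                * Real.exp (-(ω : ℝ) ^ 2 * t) * BFD.meshSize N ^ 5|
            ≤ C * BFD.meshSize N ^ 6)) ∧
    -- order of the global error for smooth data
    (∀ (f : ℝ → ℂ) (u : ℝ → ℝ → ℂ), ContDiff ℝ ((⊤ : ℕ∞) : WithTop ℕ∞) f → BFD.IsHeatSolution f u →
      ∃ C : ℝ, ∀ (N : ℕ) [NeZero N] (v : ℝ → BFD.Grid N),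
        BFD.IsSemidiscreteSolution c N (BFD.proj N f) v → ∀ t : ℝ, 0 ≤ t →
          BFD.gridNorm N (BFD.globalError N u v t) ≤ C * BFD.meshSize N ^ 4 ∧
          (c = -4 / 13 →
            BFD.gridNorm N (BFD.globalError N u v t) ≤ C * BFD.meshSize N ^ 5)) ∧
    -- the truncation error is of order three
    (∀ w : ℝ → ℂ, ContDiff ℝ ((⊤ : ℕ∞) : WithTop ℕ∞) w → Function.Periodic w (2 * Real.pi) →
      ∃ C : ℝ, ∀ (N : ℕ) [NeZero N],
        BFD.gridNorm N (BFD.truncError c N w) ≤ C * BFD.meshSize N ^ 3 ∧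
        ∀ j : ZMod N,
          ‖BFD.truncError c N w (j, 0)
              - ((c * BFD.meshSize N ^ 3 / 96 : ℝ) : ℂ)
                * iteratedDeriv 5 w (BFD.node N (j, 0))‖
            ≤ C * BFD.meshSize N ^ 4 ∧
          ‖BFD.truncError c N w (j, 1)
              + ((c * BFD.meshSize N ^ 3 / 96 : ℝ) : ℂ)
                * iteratedDeriv 5 w (BFD.node N (j, 1))‖
            ≤ C * BFD.meshSize N ^ 4) ∧
    -- and, for Fourier modes, of no higher order unless `c = 0`
    (∀ ω : ℤ, ∃ C : ℝ, ∀ (N : ℕ) [NeZero N],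
      |BFD.gridNorm N (BFD.truncError c N (BFD.wave ω))
          - Real.sqrt (2 * Real.pi) * (|c| * |(ω : ℝ)| ^ 5 / 96) * BFD.meshSize N ^ 3|
        ≤ C * BFD.meshSize N ^ 4) := by
  refine ⟨fun N _ ω _ j => ⟨fun h => BFD.mode_eq_of_pos h j, fun h => BFD.mode_eq_of_nonpos h.le j⟩,
    fun N _ ω _ => ⟨BFD.blockOp_mode_low c ω, BFD.blockOp_mode_high c ω⟩,
    fun hc₀ N _ ω => BFD.r_eigen_system hc₀,
    fun N _ ω hω => ⟨BFD.norm_sq_coeff1 c _ ω, BFD.norm_sq_coeff2 hc hω, BFD.blockOp_psi hc hω⟩,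
    fun N _ => ⟨BFD.linearIndependent_psi hc, BFD.span_psi_eq_top hc⟩,
    BFD.exists_Qhat_expansion hc,
    fun N _ => BFD.existsUnique_semidiscreteSolution,
    BFD.exists_waveSolution_expansion hc,
    fun ω t => BFD.exists_waveSolution_expansion_of_pos hc ω,
    fun ω t => BFD.exists_gridNorm_globalError_waveSol hc ω,
    fun f u hf => BFD.exists_gridNorm_globalError_le hc (contDiff_infty.1 hf 7),
    fun w hw => BFD.exists_truncError_bounds c (contDiff_infty.1 hw 6),
    BFD.exists_gridNorm_truncError_wave c⟩
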